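/- Let $\mu,\lambda,\omega\in\mathbb{R}$ with $\mu>0$, $2\mu+2\lambda>0$, $\omega>0$. Put $\Delta^*\mathbf u=\mu\Delta\mathbf u+(\lambda+\mu)\nabla\nabla\cdot\mathbf u$ and $\mathcal T_\nu\mathbf u=\lambda(\nabla\cdot\mathbf u)\,\nu+\mu(\nabla\mathbf u+\nabla\mathbf u^{t})\,\nu$. Let $-\pi<\theta_{\min}<\theta_{\max}<\pi$ with $\theta_{\max}-\theta_{\min}<\pi$, let $h>0$, and in polar coordinates let $$S_h=\{0<r<h,\ \theta_{\min}<\theta<\theta_{\max}\},\quad \Gamma_h^+=\{0<r<h,\ \theta=\theta_{\max}\},\quad \Gamma_h^-=\{0<r<h,\ \theta=\theta_{\min}\},\quad \Lambda_h=\{r=h,\ \theta_{\min}<\theta<\theta_{\max}\}.$$ Let $\nu$ be the exterior unit normal of $S_h$. Let $\mathbf v,\mathbf w\in H^1(S_h)^2$ be complex-valued weak solutions of $\Delta^*\mathbf v+\omega^2\mathbf v=\mathbf 0$ and $\Delta^*\mathbf w+\omega^2\mathbf w=\mathbf 0$ in $S_h$ such that $$\mathbf w-\mathbf v=\mathbf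 f_1,\quad \mathcal T_\nu\mathbf w-\mathcal T_\nu\mathbf v=\mathbf g_1\ \text{ on }\Gamma_h^+,\qquad \mathbf w-\mathbf v=\mathbf f_2,\quad \mathcal T_\nu\mathbf w-\mathcal T_\nu\mathbf v=\mathbf g_2\ \text{ on }\Gamma_h^-,$$ where displacements are taken in the sense of traces and tractions in the weak sense (through Green's formula), and $\mathbf f_1\in C^{1,\alpha_1}(\Gamma_h^+)^2$, $\mathbf f_2\in C^{1,\alpha_2}(\Gamma_h^-)^2$, $\mathbf g_1\in C^{\beta_1}(\Gamma_h^+)^2$, $\mathbf g_2\in C^{\beta_2}(\Gamma_h^-)^2$ with $\alpha_1,\alpha_2,\beta_1,\beta_2\in(0,1)$. Values and derivatives of these functions at the corner $\mathbf 0$ are those of their continuous extensions, and $\nabla\mathbf f_i$ is the derivative along the edge. Then the following hold ($\mathbf a\cdot\mathbf b$ denotes the bilinear product). (1) Let $\kappa_{\mathrm s}=\omega\sqrt{1/\mu}$, let $\tau>0$, let $\mathbf d,\mathbf d^\perp\in\mathbb{R}^2$ be orthogonal unit vectors, and let $$\mathbf u_0(\mathbf x)=e^{\boldsymbol\xi\cdot\mathbf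 x}\boldsymbol\eta,\qquad \boldsymbol\xi=\tau\mathbf d+\mathrm i\sqrt{\kappa_{\mathrm s}^2+\tau^2}\,\mathbf d^\perp,\qquad \boldsymbol\eta=\mathbf d^\perp-\mathrm i\sqrt{1+\kappa_{\mathrm s}^2/\tau^2}\,\mathbf d .$$ With $\delta\mathbf f_i=\mathbf f_i-\mathbf f_i(\mathbf 0)$ and $\delta\mathbf g_i=\mathbf g_i-\mathbf g_i(\mathbf 0)$, $$\begin{aligned} &\mathbf g_1(\mathbf 0)\cdot\int_{\Gamma_h^+}\mathbf u_0\,d\sigma+\mathbf g_2(\mathbf 0)\cdot\int_{\Gamma_h^-}\mathbf u_0\,d\sigma-\mathbf f_1(\mathbf 0)\cdot\int_{\Gamma_h^+}\mathcal T_\nu\mathbf u_0\,d\sigma-\mathbf f_2(\mathbf 0)\cdot\int_{\Gamma_h^-}\mathcal T_\nu\mathbf u_0\,d\sigma\\ &=\int_{\Gamma_h^+}\mathcal T_\nu\mathbf u_0\cdot\delta\mathbf f_1\,d\sigma-\int_{\Gamma_h^+}\delta\mathbf g_1\cdot\mathbf u_0\,d\sigma+\int_{\Gamma_h^-}\mathcal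 T_\nu\mathbf u_0\cdot\delta\mathbf f_2\,d\sigma-\int_{\Gamma_h^-}\delta\mathbf g_2\cdot\mathbf u_0\,d\sigma\\ &\quad+\int_{\Lambda_h}\mathcal T_\nu(\mathbf v-\mathbf w)\cdot\mathbf u_0-\mathcal T_\nu\mathbf u_0\cdot(\mathbf v-\mathbf w)\,d\sigma . \end{aligned}$$ On $\Lambda_h$, $\mathbf v-\mathbf w$ is the trace, and $\int_{\Lambda_h}\mathcal T_\nu(\mathbf v-\mathbf w)\cdot\boldsymbol\varphi\,d\sigma$ is the duality pairing: the linear functional of smooth fields $\boldsymbol\varphi$ that is bounded in the norm of $H^1(S_h)^2$, depends only on $\boldsymbol\varphi|_{\Lambda_h}$, and is given by Green's formula when $\boldsymbol\varphi$ vanishes near $\partial S_h\setminus\Lambda_h$. That this trace and this functional exist is part of the claim. (2) $\mathbf f_1(\mathbf 0)=\mathbf f_2(\mathbf 0)$. (3) If moreover $\nabla\mathbf f_1(\mathbf 0)=\nabla\mathbf f_2(\mathbf 0)=\mathbf 0$, then $\mathbf g_1(\mathbf 0)=\Theta\,\mathbf g_2(\mathbf 0)$, where $$\Theta=\begin{bmatrix}-\cos(\theta_{\max}-\theta_{\min})&-\sin(\theta_{\max}-\theta_{\min})\\-\sin(\theta_{\max}-\theta_{\min})&\cos(\theta_{\max}-\theta_{\min})\end{bmatrix}.$$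 -/

import Mathlib

open MeasureTheory Filter Topology Set
open scoped Matrix ContDiff NNReal

noncomputable section

namespace LameCorner

/-- The Euclidean plane `ℝ²`. -/
abbrev Plane := EuclideanSpace ℝ (Fin 2)

/-- Values of complex displacement fields. The product `a ⬝ᵥ b` on `CVec` is the bilinear one
(no complex conjugation). -/
abbrev CVec := Fin 2 → ℂ

/-! ### The truncated sector, its edges and its arc -/

/-- The unit vector `(cos θ, sin θ)`. -/
def unitDir (θ : ℝ) : Plane := !₂[Real.cos θ, Real.sin θ]

/-- The open infinite sector with arguments strictly between `θmin` and `θmax`. -/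
def sector (θmin θmax : ℝ) : Set Plane :=
  {x | ∃ r θ : ℝ, 0 < r ∧ θmin < θ ∧ θ < θmax ∧ x = r • unitDir θ}

/-- The truncated open sector `S_h`. -/
def sectorDisk (θmin θmax h : ℝ) : Set Plane := sector θmin θmax ∩ Metric.ball 0 h

/-- The open edge of length `h` in direction `θ`; `Γ_h^+` and `Γ_h^-` are the edges in the
directions `θmax` and `θmin`. -/
def edge (θ h : ℝ) : Set Plane := {x | ∃ r : ℝ, 0 < r ∧ r < h ∧ x = r • unitDir θ}

/-- The open arc `Λ_h`. -/
def arc (θmin θmax h : ℝ) : Set Plane := sector θmin θmax ∩ Metric.sphere 0 h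

/-- Arc length on `edge θ h` (the parametrization has unit speed). -/
def edgeMeasure (θ h : ℝ) : Measure Plane :=
  Measure.map (fun r : ℝ => r • unitDir θ) (volume.restrict (Ioo 0 h))

/-- Arc length on `arc θmin θmax h` (the parametrization has speed `h`). -/
def arcMeasure (θmin θmax h : ℝ) : Measure Plane :=
  ENNReal.ofReal h •
    Measure.map (fun θ : ℝ => h • unitDir θ) (volume.restrict (Ioo θmin θmax))

/-- Exterior unit normal of the truncated sector on the edge with the largest argument. -/
def normalMax (θmax : ℝ) : Plane := !₂[-Real.sin θmax, Real.cos θmax]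

/-- Exterior unit normal of the truncated sector on the edge with the smallest argument. -/
def normalMin (θmin : ℝ) : Plane := !₂[Real.sin θmin, -Real.cos θmin]

/-! ### Derivatives and the Sobolev space `H¹` -/

/-- Classical partial derivative of a scalar function. -/
def pderiv (j : Fin 2) (φ : Plane → ℂ) (x : Plane) : ℂ :=
  fderiv ℝ φ x (EuclideanSpace.single j 1)

/-- Classical gradient of a vector field, `(∇φ)_{ij} = ∂_j φ_i`. -/
def fieldGrad (φ : Plane → CVec) (x : Plane) : Matrix (Fin 2) (Fin 2) ℂ :=
  Matrix.of fun i j => pderiv j (fun y => φ y i) x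

/-- `g` is a weak `j`-th partial derivative of `u` on the open set `U`. -/
def HasWeakPartial (U : Set Plane) (j : Fin 2) (u g : Plane → ℂ) : Prop :=
  ∀ φ : Plane → ℂ, ContDiff ℝ ∞ φ → HasCompactSupport φ → tsupport φ ⊆ U →
    ∫ x in U, u x * pderiv j φ x = -∫ x in U, g x * φ x

/-- Existence of a square integrable weak `j`-th partial derivative. -/
def HasL2Partial (U : Set Plane) (j : Fin 2) (u : Plane → ℂ) : Prop :=
  ∃ g : Plane → ℂ, MemLp g 2 (volume.restrict U) ∧ HasWeakPartial U j u g

open Classical in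
/-- The square integrable weak `j`-th partial derivative (unique up to null sets of `U`);
zero if there is none. -/
def weakPartial (U : Set Plane) (j : Fin 2) (u : Plane → ℂ) : Plane → ℂ :=
  if H : HasL2Partial U j u then H.choose else 0

/-- `u ∈ H¹(U)²`. -/
def MemH1 (U : Set Plane) (u : Plane → CVec) : Prop :=
  ∀ i, MemLp (fun x => u x i) 2 (volume.restrict U) ∧
    ∀ j, HasL2Partial U j (fun x => u x i)

/-- Weak gradient of a vector field, `(∇u)_{ij} = ∂_j u_i`. -/
def weakGrad (U : Set Plane) (u : Plane → CVec) (x : Plane) : Matrix (Fin 2) (Fin 2) ℂ :=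
  Matrix.of fun i j => weakPartial U j (fun y => u y i) x

/-- The `H¹(U)²` norm of a field that is smooth up to the boundary of the bounded set `U`. -/
def h1Norm (U : Set Plane) (φ : Plane → CVec) : ℝ :=
  Real.sqrt (∫ x in U, ((∑ i, ‖φ x i‖ ^ 2) + ∑ i, ∑ j, ‖fieldGrad φ x i j‖ ^ 2))

/-- `f` is the trace of `u ∈ H¹(U)²` on a piece of `∂U` with arc length measure `σ`: fields that
are smooth up to the boundary and converge to `u` in `H¹(U)²` have restrictions that converge
to `f` in `L²(σ)²`. -/
def IsTrace (U : Set Plane) (σ : Measure Plane) (u f : Plane → CVec) : Prop :=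
  ∃ φ : ℕ → Plane → CVec, (∀ n, ContDiff ℝ ∞ (φ n)) ∧
    (∀ i, Tendsto (fun n => eLpNorm (fun x => φ n x i - u x i) 2 (volume.restrict U))
      atTop (𝓝 0)) ∧
    (∀ i j, Tendsto
      (fun n => eLpNorm (fun x => fieldGrad (φ n) x i j - weakGrad U u x i j) 2
        (volume.restrict U)) atTop (𝓝 0)) ∧
    ∀ i, Tendsto (fun n => eLpNorm (fun x => φ n x i - f x i) 2 σ) atTop (𝓝 0)

/-! ### The Lamé system and tractions -/

/-- The stress `λ (div u) I + μ (∇u + ∇uᵀ)` as a function of the gradient `G = ∇u`. -/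
def stress (lam mu : ℝ) (G : Matrix (Fin 2) (Fin 2) ℂ) : Matrix (Fin 2) (Fin 2) ℂ :=
  ((lam : ℂ) * G.trace) • (1 : Matrix (Fin 2) (Fin 2) ℂ) + (mu : ℂ) • (G + Gᵀ)

/-- Classical traction `T_ν φ = λ (div φ) ν + 2 μ (∇ˢ φ) ν` of a smooth field. -/
def traction (lam mu : ℝ) (ν : Plane) (φ : Plane → CVec) (x : Plane) : CVec :=
  stress lam mu (fieldGrad φ x) *ᵥ fun i => (ν i : ℂ)

/-- The form `∫_U σ(u) : ∇φ - ω² u · φ`. For `φ` compactly supported in `U` it is the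
distributional pairing of `-(Δ* u + ω² u)` with `φ`, where `Δ* u = div σ(u) = μ Δ u + (λ+μ) ∇ div u`.
If `Δ* u + ω² u = 0` in `U`, it is the pairing of the traction `T_ν u` on `∂U` with `φ`. -/
def lameForm (lam mu om : ℝ) (U : Set Plane) (u φ : Plane → CVec) : ℂ :=
  ∫ x in U, ((∑ i, ∑ j, stress lam mu (weakGrad U u x) i j * fieldGrad φ x i j)
    - (om : ℂ) ^ 2 * (u x ⬝ᵥ φ x))

/-- `u ∈ H¹(U)²` is a weak solution of `Δ* u + ω² u = 0` in `U`. -/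
def IsLameSolution (lam mu om : ℝ) (U : Set Plane) (u : Plane → CVec) : Prop :=
  MemH1 U u ∧ ∀ φ : Plane → CVec, ContDiff ℝ ∞ φ → HasCompactSupport φ → tsupport φ ⊆ U →
    lameForm lam mu om U u φ = 0

/-- Test fields for the relatively open piece `Γ` of `∂U`: they vanish near the rest of `∂U`. -/
def IsBoundaryTest (U Γ : Set Plane) (φ : Plane → CVec) : Prop :=
  ContDiff ℝ ∞ φ ∧ HasCompactSupport φ ∧ Disjoint (tsupport φ) (frontier U \ Γ)

/-- `T_ν w - T_ν v = g` on the piece `Γ` of `∂U` with arc length measure `σ`, for solutions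
`v`, `w` of the Lamé system in `U` (the tractions being distributions on `Γ`). -/
def TractionJumpOn (lam mu om : ℝ) (U Γ : Set Plane) (σ : Measure Plane)
    (v w g : Plane → CVec) : Prop :=
  ∀ φ : Plane → CVec, IsBoundaryTest U Γ φ →
    lameForm lam mu om U w φ - lameForm lam mu om U v φ = ∫ x, g x ⬝ᵥ φ x ∂σ

/-- `ℓ` is the pairing `φ ↦ ∫_Γ T_ν u · φ dσ` between the traction on `Γ` of a solution `u` and
traces on `Γ` of smooth fields. It is a linear functional, bounded in the `H¹(U)²` norm, that
depends only on the restriction of the field to `Γ` (so it is a bounded functional of the trace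
in `H^{1/2}(Γ)²`), and it is given by Green's formula on the fields that vanish near `∂U \ Γ`. -/
structure IsTractionPairing (lam mu om : ℝ) (U Γ : Set Plane) (u : Plane → CVec)
    (ℓ : (Plane → CVec) → ℂ) : Prop where
  map_add : ∀ φ ψ : Plane → CVec, ContDiff ℝ ∞ φ → ContDiff ℝ ∞ ψ →
    ℓ (fun x => φ x + ψ x) = ℓ φ + ℓ ψ
  map_smul : ∀ (c : ℂ) (φ : Plane → CVec), ContDiff ℝ ∞ φ → ℓ (fun x => c • φ x) = c * ℓ φ
  bound : ∃ C : ℝ, ∀ φ : Plane → CVec, ContDiff ℝ ∞ φ → ‖ℓ φ‖ ≤ C * h1Norm U φ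
  local_on : ∀ φ : Plane → CVec, ContDiff ℝ ∞ φ → (∀ x ∈ Γ, φ x = 0) → ℓ φ = 0
  green : ∀ φ : Plane → CVec, IsBoundaryTest U Γ φ → ℓ φ = lameForm lam mu om U u φ

/-! ### Hölder spaces on an edge -/

/-- The function `r ↦ f (r (cos θ, sin θ))`, that is, `f` in the arc length parameter. -/
def alongEdge (θ : ℝ) (f : Plane → CVec) (r : ℝ) : CVec := f (r • unitDir θ)

/-- The tangential derivative at the corner of a function on the edge in direction `θ`. -/
def edgeDerivAtCorner (θ h : ℝ) (f : Plane → CVec) : CVec :=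
  derivWithin (alongEdge θ f) (Ico 0 h) 0

/-- `f ∈ C^{1,α}` on the edge in direction `θ`, the value at the corner being that of the
continuous extension. -/
def IsC1Holder (θ h : ℝ) (α : ℝ≥0) (f : Plane → CVec) : Prop :=
  DifferentiableOn ℝ (alongEdge θ f) (Ico 0 h) ∧
    ∃ C : ℝ≥0, HolderOnWith C α (derivWithin (alongEdge θ f) (Ico 0 h)) (Ico 0 h)

/-- `g ∈ C^β` on the edge in direction `θ`, the value at the corner being that of the continuous
extension. -/
def IsHolder (θ h : ℝ) (β : ℝ≥0) (g : Plane → CVec) : Prop :=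
  ∃ C : ℝ≥0, HolderOnWith C β (alongEdge θ g) (Ico 0 h)

/-! ### The complex geometrical optics solution and the matrix `Θ` -/

/-- `κ_s = ω √(1/μ)`. -/
def kappaS (mu om : ℝ) : ℝ := om * Real.sqrt (1 / mu)

/-- `ξ = τ d + i √(κ_s² + τ²) d^⊥`. -/
def cgoXi (mu om τ : ℝ) (d dperp : Plane) : CVec := fun j =>
  (τ : ℂ) * (d j : ℂ)
    + Complex.I * (Real.sqrt (kappaS mu om ^ 2 + τ ^ 2) : ℂ) * (dperp j : ℂ)

/-- `η = d^⊥ - i √(1 + κ_s²/τ²) d`. -/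
def cgoEta (mu om τ : ℝ) (d dperp : Plane) : CVec := fun j =>
  (dperp j : ℂ) - Complex.I * (Real.sqrt (1 + kappaS mu om ^ 2 / τ ^ 2) : ℂ) * (d j : ℂ)

/-- The complex geometrical optics solution `u₀(x) = e^{ξ·x} η`. -/
def cgo (mu om τ : ℝ) (d dperp : Plane) (x : Plane) : CVec :=
  Complex.exp (∑ j, cgoXi mu om τ d dperp j * (x j : ℂ)) • cgoEta mu om τ d dperp

/-- The matrix `Θ` for the opening angle `θ`. -/
def thetaMatrix (θ : ℝ) : Matrix (Fin 2) (Fin 2) ℂ :=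
  !![-(Real.cos θ : ℂ), -(Real.sin θ : ℂ); -(Real.sin θ : ℂ), (Real.cos θ : ℂ)]

end LameCorner

end

open LameCorner

namespace LameCorner

/-! ### Geometry of the truncated sector -/

/-! Put `u = w - v`. It lies in `H¹` of the sector and has displacements `f₁`, `f₂` and weak
tractions `g₁`, `g₂` on the two edges. Every integral formula comes from
`integral_divergence_sectorDisk`, which is the divergence theorem on a rectangle read in polar
coordinates.

Part (1) is Betti's reciprocity formula for `u` and an exponential shear field. It needs two objects
on the arc. The trace exists because the divergence theorem for `|φ|² X` with suitable vector fields
`X` bounds boundary `L²` norms by the `H¹` norm (`traceBounded_arc`, `traceBounded_edges`); Green's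
formula then passes to `H¹` limits, and applying it to the stress of a smooth solution gives
`lameForm_eq_boundary`. The traction functional is what remains of the Lamé form of `v - w` after
the edge contributions are taken out (`isTractionPairing_arc`). The substantial point is that it
sees only the values on the arc: if `φ` vanishes on the arc, Green's formula must hold with the two
edge terms alone (`edgePairing_of_eq_zero_on_arc`). The hypotheses give this only for fields
vanishing near the rest of the boundary. Cutoffs close the gap: at the arc `φ` vanishes to first
order, which balances the gradient of the cutoff, and at the corner a point of the plane has zero
`H¹` capacity, so the gradients of the cutoffs tend weakly to zero in `L²`
(`tendsto_integral_mul_kernel`).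

Part (2) holds because an `H¹` function in two dimensions cannot have different limits along the two
edges. Testing with the rotating fields `N² e^{-N²|x|²} (-x₂, x₁)`, which are divergence free and
tangent to circles, leaves only the gradient of `u` and two edge fluxes. The fields tend weakly to
zero in `L²`, while the fluxes concentrate at the corner with opposite signs and mass one half
(`GreenFormula.corner_eq`).

For part (3) a stronger fact is proved: both corner tractions vanish
(`HasCauchyData.traction_eq_zero`). Let `ψ` solve the static equations and decay in the sector, and
test with `N (h² - |x|²) ψ(Nx)`. In the limit the frequency term and all terms with the cutoff's
gradient disappear, and so do the displacement terms, because `f - f(0) = o(r)` on each edge with a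
common value `f(0)`. What survives is that `g₁(0)` and `g₂(0)`, paired with the integrals of `ψ`
along the two edges, sum to zero (`HasCauchyData.corner_orthogonality`). Suitable `ψ` are `e^{ζ·x}`
times a polynomial of degree at most one, with `ζ` isotropic, that is, holomorphic or
antiholomorphic exponentials; convexity of the sector makes them decay. Four such fields give a
homogeneous linear system for the four components of `g₁(0)`, `g₂(0)`, which is nonsingular because
the opening lies strictly between `0` and `π` and `λ + μ`, `μ` are positive
(`eq_zero_of_corner_relations`). -/

/-- The standing assumptions on the truncated sector. -/
structure IsConvexSector (θmin θmax h : ℝ) : Prop where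
  hmin : -Real.pi < θmin
  hlt : θmin < θmax
  hmax : θmax < Real.pi
  hangle : θmax - θmin < Real.pi
  hh : 0 < h

@[simp] lemma unitDir_zero (θ : ℝ) : unitDir θ 0 = Real.cos θ := by simp [unitDir]
@[simp] lemma unitDir_one (θ : ℝ) : unitDir θ 1 = Real.sin θ := by simp [unitDir]
@[simp] lemma normalMax_zero (θ : ℝ) : normalMax θ 0 = -Real.sin θ := by simp [normalMax]
@[simp] lemma normalMax_one (θ : ℝ) : normalMax θ 1 = Real.cos θ := by simp [normalMax]
@[simp] lemma normalMin_zero (θ : ℝ) : normalMin θ 0 = Real.sin θ := by simp [normalMin]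
@[simp] lemma normalMin_one (θ : ℝ) : normalMin θ 1 = -Real.cos θ := by simp [normalMin]

@[simp] lemma norm_unitDir (θ : ℝ) : ‖unitDir θ‖ = 1 := by
  simp [EuclideanSpace.norm_eq, Fin.sum_univ_two]

lemma norm_smul_unitDir {r : ℝ} (hr : 0 ≤ r) (θ : ℝ) : ‖r • unitDir θ‖ = r := by
  rw [norm_smul, norm_unitDir, mul_one, Real.norm_of_nonneg hr]

lemma continuous_unitDir : Continuous unitDir := by
  unfold unitDir; fun_prop

lemma Plane.ext {x y : Plane} (h0 : x 0 = y 0) (h1 : x 1 = y 1) : x = y := by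
  ext i; fin_cases i <;> assumption

/-- Polar coordinates with the argument in a prescribed window of length `2π`. -/
lemma exists_polar (m : ℝ) (x : Plane) :
    ∃ φ, -Real.pi < φ ∧ φ ≤ Real.pi ∧ x = ‖x‖ • unitDir (m + φ) := by
  set z : ℂ := (⟨x 0, x 1⟩ : ℂ) * Complex.exp (-(m : ℂ) * Complex.I) with hz
  have hnorm : ‖z‖ = ‖x‖ := by
    rw [hz, norm_mul]
    have : ‖Complex.exp (-(m : ℂ) * Complex.I)‖ = 1 := by
      have := Complex.norm_exp_ofReal_mul_I (-m)
      simpa using this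
    rw [this, mul_one, EuclideanSpace.norm_eq, Fin.sum_univ_two, Complex.norm_def,
      Complex.normSq_apply]
    simp [sq]
  refine ⟨z.arg, Complex.neg_pi_lt_arg z, Complex.arg_le_pi z, ?_⟩
  have h1 : (⟨x 0, x 1⟩ : ℂ) = ‖x‖ * Complex.exp (((m + z.arg : ℝ) : ℂ) * Complex.I) := by
    have h2 := Complex.norm_mul_exp_arg_mul_I z
    rw [hnorm] at h2
    push_cast
    rw [add_mul, Complex.exp_add, mul_left_comm, h2, hz, mul_left_comm, ← Complex.exp_add]
    simp
  rw [Complex.exp_mul_I, ← Complex.ofReal_cos, ← Complex.ofReal_sin] at h1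
  have e0 := congrArg Complex.re h1
  have e1 := congrArg Complex.im h1
  simp only [ Complex.add_re, Complex.add_im,
    Complex.ofReal_re, Complex.ofReal_im, Complex.mul_re, Complex.mul_im, Complex.I_re,
    Complex.I_im, mul_zero, mul_one, sub_self, add_zero, zero_add] at e0 e1
  apply Plane.ext
  · simpa using e0
  · simpa using e1

/-- With opening less than `π` the sector is an intersection of two open half-planes, each bounded
by the line through one edge; openness is read off from this. -/
lemma mem_sector_iff {θmin θmax : ℝ} (hlt : θmin < θmax) (hangle : θmax - θmin < Real.pi)
    (x : Plane) : x ∈ sector θmin θmax ↔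
      -Real.sin θmax * x 0 + Real.cos θmax * x 1 < 0 ∧
        Real.sin θmin * x 0 - Real.cos θmin * x 1 < 0 := by
  constructor
  · rintro ⟨r, θ, hr, h1, h2, rfl⟩
    have e1 : 0 < Real.sin (θmax - θ) := Real.sin_pos_of_pos_of_lt_pi (by linarith) (by linarith)
    have e2 : 0 < Real.sin (θ - θmin) := Real.sin_pos_of_pos_of_lt_pi (by linarith) (by linarith)
    rw [Real.sin_sub] at e1 e2
    simp only [PiLp.smul_apply, unitDir_zero, unitDir_one, smul_eq_mul]
    constructor <;> nlinarith
  · rintro ⟨h1, h2⟩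
    have hx : x ≠ 0 := by rintro rfl; simp at h1
    have hx' : 0 < ‖x‖ := norm_pos_iff.2 hx
    -- Arguments are measured from the bisector, so an argument beyond an edge exceeds it by less
    -- than `π`, where the sine has the wrong sign.
    obtain ⟨φ, hφ1, hφ2, he⟩ := exists_polar ((θmin + θmax) / 2) x
    set θ := (θmin + θmax) / 2 + φ with hθ
    refine ⟨‖x‖, θ, hx', ?_, ?_, he⟩
    all_goals
      rw [he] at h1 h2
      simp only [PiLp.smul_apply, unitDir_zero, unitDir_one, smul_eq_mul] at h1 h2
      have e1 : 0 < Real.sin (θmax - θ) := by rw [Real.sin_sub]; nlinarith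
      have e2 : 0 < Real.sin (θ - θmin) := by rw [Real.sin_sub]; nlinarith
      by_contra hcon
      push Not at hcon
    · exact absurd e2 (not_lt.2 (Real.sin_nonpos_of_nonpos_of_neg_pi_le (by linarith)
        (by linarith)))
    · exact absurd e1 (not_lt.2 (Real.sin_nonpos_of_nonpos_of_neg_pi_le (by linarith)
        (by linarith)))

lemma isOpen_sector {θmin θmax : ℝ} (hlt : θmin < θmax) (hangle : θmax - θmin < Real.pi) :
    IsOpen (sector θmin θmax) := by
  have : sector θmin θmax = {x : Plane | -Real.sin θmax * x 0 + Real.cos θmax * x 1 < 0} ∩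
      {x : Plane | Real.sin θmin * x 0 - Real.cos θmin * x 1 < 0} := by
    ext x; exact mem_sector_iff hlt hangle x
  rw [this]
  exact (isOpen_lt (by fun_prop) continuous_const).inter
    (isOpen_lt (by fun_prop) continuous_const)

variable {θmin θmax h : ℝ}

lemma isOpen_sectorDisk (H : IsConvexSector θmin θmax h) : IsOpen (sectorDisk θmin θmax h) :=
  (isOpen_sector H.hlt H.hangle).inter Metric.isOpen_ball

lemma measurableSet_sectorDisk (H : IsConvexSector θmin θmax h) :
    MeasurableSet (sectorDisk θmin θmax h) := (isOpen_sectorDisk H).measurableSet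

lemma sectorDisk_subset_ball : sectorDisk θmin θmax h ⊆ Metric.ball 0 h := inter_subset_right

lemma norm_lt_of_mem_sectorDisk {x : Plane} (hx : x ∈ sectorDisk θmin θmax h) : ‖x‖ < h := by
  simpa using hx.2

lemma ne_zero_of_mem_sectorDisk {x : Plane} (hx : x ∈ sectorDisk θmin θmax h) : x ≠ 0 := by
  obtain ⟨r, θ, hr, -, -, rfl⟩ := hx.1
  rw [← norm_pos_iff, norm_smul_unitDir hr.le]; exact hr

/-- The closure lies in the image of the closed polar rectangle. A frontier point must come from one
of its four sides, since the remaining points of the rectangle map into the open set itself. -/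
lemma frontier_sectorDisk_subset (H : IsConvexSector θmin θmax h) :
    frontier (sectorDisk θmin θmax h) ⊆
      ({0} ∪ edge θmax h ∪ edge θmin h) ∪ Metric.sphere 0 h := by
  set K : Set Plane := (fun p : ℝ × ℝ => p.1 • unitDir p.2) '' (Icc 0 h ×ˢ Icc θmin θmax) with hK
  have hcont : Continuous fun p : ℝ × ℝ => p.1 • unitDir p.2 :=
    continuous_fst.smul (continuous_unitDir.comp continuous_snd)
  have hKc : IsClosed K := ((isCompact_Icc.prod isCompact_Icc).image hcont).isClosed
  have hsub : sectorDisk θmin θmax h ⊆ K := by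
    rintro x ⟨⟨r, θ, hr, h1, h2, rfl⟩, hx⟩
    rw [Metric.mem_ball, dist_zero_right, norm_smul_unitDir hr.le] at hx
    exact ⟨(r, θ), ⟨⟨hr.le, hx.le⟩, ⟨h1.le, h2.le⟩⟩, rfl⟩
  intro x hx
  rw [frontier, (isOpen_sectorDisk H).interior_eq] at hx
  obtain ⟨⟨r, θ⟩, ⟨⟨hr0, hrh⟩, ⟨h1, h2⟩⟩, rfl⟩ := closure_minimal hsub hKc hx.1
  dsimp only at *
  rcases hr0.eq_or_lt with rfl | hr0
  · left; left; left; simp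
  rcases hrh.eq_or_lt with rfl | hrh
  · right; rw [Metric.mem_sphere, dist_zero_right, norm_smul_unitDir hr0.le]
  rcases h1.eq_or_lt with rfl | h1
  · left; right; exact ⟨r, hr0, hrh, rfl⟩
  rcases h2.eq_or_lt with rfl | h2
  · left; left; right; exact ⟨r, hr0, hrh, rfl⟩
  · exact absurd ⟨⟨r, θ, hr0, h1, h2, rfl⟩, by
      rwa [Metric.mem_ball, dist_zero_right, norm_smul_unitDir hr0.le]⟩ hx.2

lemma smul_unitDir_eq_iff {r r' θ θ' : ℝ} (hr : 0 < r) (hr' : 0 < r')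
    (hθ : θ ∈ Ioo (-Real.pi) Real.pi) (hθ' : θ' ∈ Ioo (-Real.pi) Real.pi)
    (he : r • unitDir θ = r' • unitDir θ') : r = r' ∧ θ = θ' := by
  have h1 : polarCoord.symm (r, θ) = polarCoord.symm (r', θ') := by
    rw [polarCoord_symm_apply, polarCoord_symm_apply]
    have e0 := congrArg (fun x : Plane => x 0) he
    have e1 := congrArg (fun x : Plane => x 1) he
    simp at e0 e1
    simp [e0, e1]
  have m1 : ((r, θ) : ℝ × ℝ) ∈ polarCoord.target := ⟨hr, hθ⟩
  have m2 : ((r', θ') : ℝ × ℝ) ∈ polarCoord.target := ⟨hr', hθ'⟩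
  have h2 := polarCoord.symm.injOn m1 m2 h1
  simpa using h2

lemma smul_unitDir_mem_sector_iff (H : IsConvexSector θmin θmax h) {r θ : ℝ} (hr : 0 < r)
    (hθ : θ ∈ Ioo (-Real.pi) Real.pi) :
    r • unitDir θ ∈ sector θmin θmax ↔ θ ∈ Ioo θmin θmax := by
  constructor
  · rintro ⟨r', θ', hr', h1, h2, he⟩
    obtain ⟨-, rfl⟩ := smul_unitDir_eq_iff hr hr' hθ
      ⟨H.hmin.trans h1, h2.trans H.hmax⟩ he
    exact ⟨h1, h2⟩
  · rintro ⟨h1, h2⟩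
    exact ⟨r, θ, hr, h1, h2, rfl⟩

lemma smul_unitDir_mem_sectorDisk_iff (H : IsConvexSector θmin θmax h) {r θ : ℝ} (hr : 0 < r)
    (hθ : θ ∈ Ioo (-Real.pi) Real.pi) :
    r • unitDir θ ∈ sectorDisk θmin θmax h ↔ r < h ∧ θ ∈ Ioo θmin θmax := by
  rw [sectorDisk, mem_inter_iff, smul_unitDir_mem_sector_iff H hr hθ, Metric.mem_ball,
    dist_zero_right, norm_smul_unitDir hr.le, and_comm]

/-! ### Polar coordinates and the divergence theorem -/

lemma integral_plane_eq_polar {E : Type*} [NormedAddCommGroup E] [NormedSpace ℝ E]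
    (F : Plane → E) :
    ∫ x, F x = ∫ p in Ioi (0 : ℝ) ×ˢ Ioo (-Real.pi) Real.pi, p.1 • F (p.1 • unitDir p.2) := by
  have h1 := (PiLp.volume_preserving_toLp (Fin 2)).integral_comp
    (MeasurableEquiv.toLp 2 (Fin 2 → ℝ)).measurableEmbedding F
  have h2 := (volume_preserving_finTwoArrow ℝ).symm.integral_comp
    (MeasurableEquiv.finTwoArrow (α := ℝ)).symm.measurableEmbedding
    (fun y => F (WithLp.toLp 2 y))
  rw [← h1, ← h2, ← integral_comp_polarCoord_symm]
  refine setIntegral_congr_fun (measurableSet_Ioi.prod measurableSet_Ioo) fun p _ => ?_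
  dsimp only
  congr 2
  apply Plane.ext
  · simp [polarCoord_symm_apply, MeasurableEquiv.finTwoArrow]
  · simp [polarCoord_symm_apply, MeasurableEquiv.finTwoArrow]

/-- The bounds `-π < θmin` and `θmax < π` keep the sector inside the domain of the polar chart, so
it corresponds exactly to a rectangle. -/
lemma setIntegral_sectorDisk_eq_polar {E : Type*} [NormedAddCommGroup E] [NormedSpace ℝ E]
    (H : IsConvexSector θmin θmax h) (F : Plane → E) :
    ∫ x in sectorDisk θmin θmax h, F x =
      ∫ p in Ioo 0 h ×ˢ Ioo θmin θmax, p.1 • F (p.1 • unitDir p.2) := by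
  rw [← integral_indicator (measurableSet_sectorDisk H), integral_plane_eq_polar,
    ← integral_indicator (measurableSet_Ioi.prod measurableSet_Ioo),
    ← integral_indicator (measurableSet_Ioo.prod measurableSet_Ioo)]
  congr 1
  ext ⟨r, θ⟩
  have hpi := H.hmin
  have hpi' := H.hmax
  by_cases hp : ((r, θ) : ℝ × ℝ) ∈ Ioi (0 : ℝ) ×ˢ Ioo (-Real.pi) Real.pi
  · rw [indicator_of_mem hp]
    by_cases hq : ((r, θ) : ℝ × ℝ) ∈ Ioo 0 h ×ˢ Ioo θmin θmax
    · rw [indicator_of_mem hq, indicator_of_mem]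
      exact (smul_unitDir_mem_sectorDisk_iff H hp.1 hp.2).2 ⟨hq.1.2, hq.2⟩
    · rw [indicator_of_notMem hq, indicator_of_notMem, smul_zero]
      intro hc
      obtain ⟨h1, h2⟩ := (smul_unitDir_mem_sectorDisk_iff H hp.1 hp.2).1 hc
      exact hq ⟨⟨hp.1, h1⟩, h2⟩
  · rw [indicator_of_notMem hp, indicator_of_notMem]
    intro hc
    exact hp ⟨hc.1.1, hpi.trans hc.2.1, hc.2.2.trans hpi'⟩

lemma measurableEmbedding_smul_unitDir (θ : ℝ) :
    MeasurableEmbedding fun r : ℝ => r • unitDir θ := by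
  refine Topology.IsClosedEmbedding.measurableEmbedding ?_
  refine isClosedEmbedding_smul_left ?_
  intro h0
  have := norm_unitDir θ
  simp [h0] at this

lemma integral_edgeMeasure {E : Type*} [NormedAddCommGroup E] [NormedSpace ℝ E]
    (θ h : ℝ) (F : Plane → E) :
    ∫ x, F x ∂(edgeMeasure θ h) = ∫ r in Ioo 0 h, F (r • unitDir θ) :=
  (measurableEmbedding_smul_unitDir θ).integral_map _

lemma integral_arcMeasure {E : Type*} [NormedAddCommGroup E] [NormedSpace ℝ E]
    (hh : 0 < h) {F : Plane → E} (hF : Continuous F) :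
    ∫ x, F x ∂(arcMeasure θmin θmax h) = h • ∫ θ in Ioo θmin θmax, F (h • unitDir θ) := by
  rw [arcMeasure, integral_smul_measure, ENNReal.toReal_ofReal hh.le, integral_map]
  · exact (continuous_unitDir.const_smul h).measurable.aemeasurable
  · exact hF.aestronglyMeasurable

lemma pderiv_eq_fderiv_apply (F : Plane → ℂ) (x y : Plane) :
    fderiv ℝ F x y = y 0 • pderiv 0 F x + y 1 • pderiv 1 F x := by
  have : y = y 0 • EuclideanSpace.single (0 : Fin 2) (1 : ℝ)
      + y 1 • EuclideanSpace.single (1 : Fin 2) (1 : ℝ) := by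
    apply Plane.ext <;> simp
  conv_lhs => rw [this]
  rw [map_add, map_smul, map_smul]; rfl

lemma continuous_pderiv {F : Plane → ℂ} (hF : ContDiff ℝ 1 F) (j : Fin 2) :
    Continuous (pderiv j F) :=
  (hF.continuous_fderiv one_ne_zero).clm_apply continuous_const

lemma hasDerivAt_unitDir (θ : ℝ) : HasDerivAt unitDir (normalMax θ) θ := by
  have he : unitDir = fun t => Real.cos t • EuclideanSpace.single (0 : Fin 2) (1 : ℝ)
      + Real.sin t • EuclideanSpace.single (1 : Fin 2) (1 : ℝ) := by
    funext t; apply Plane.ext <;> simp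
  have hd := ((Real.hasDerivAt_cos θ).smul_const (EuclideanSpace.single (0 : Fin 2) (1 : ℝ))).add
    ((Real.hasDerivAt_sin θ).smul_const (EuclideanSpace.single (1 : Fin 2) (1 : ℝ)))
  have hn : normalMax θ = -Real.sin θ • EuclideanSpace.single (0 : Fin 2) (1 : ℝ)
      + Real.cos θ • EuclideanSpace.single (1 : Fin 2) (1 : ℝ) := by
    apply Plane.ext <;> simp
  rw [he, hn]
  exact hd

/-- The divergence theorem on the truncated sector. -/
theorem integral_divergence_sectorDisk (H : IsConvexSector θmin θmax h) {F : Fin 2 → Plane → ℂ}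
    (hF : ∀ j, ContDiff ℝ 1 (F j)) :
    ∫ x in sectorDisk θmin θmax h, ∑ j, pderiv j (F j) x =
      ∫ x, ∑ j, (normalMax θmax j : ℂ) * F j x ∂(edgeMeasure θmax h)
      + ∫ x, ∑ j, (normalMin θmin j : ℂ) * F j x ∂(edgeMeasure θmin h)
      + ∫ x, ∑ j, (((h⁻¹ • x : Plane) j : ℝ) : ℂ) * F j x ∂(arcMeasure θmin θmax h) := by
  have hh := H.hh
  have hd : ∀ j, Differentiable ℝ (F j) := fun j => (hF j).differentiable one_ne_zero
  set p : ℝ × ℝ → Plane := fun q => q.1 • unitDir q.2 with hp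
  have hu : ContDiff ℝ 1 unitDir := by
    rw [contDiff_euclidean]
    intro i
    fin_cases i
    · simpa [unitDir] using Real.contDiff_cos
    · simpa [unitDir] using Real.contDiff_sin
  have hpc : ContDiff ℝ 1 p := contDiff_fst.smul (hu.comp contDiff_snd)
  have hFp : ∀ j, ContDiff ℝ 1 fun q => F j (p q) := fun j => (hF j).comp hpc
  -- `f` is `r` times the radial component and `g` the angular component of the field: `r div F =
  -- ∂_r (r F_r) + ∂_θ F_θ`. The factor `r` makes the side `r = 0` of the rectangle contribute
  -- nothing.
  set f : ℝ × ℝ → ℂ := fun q => q.1 * (Real.cos q.2 * F 0 (p q) + Real.sin q.2 * F 1 (p q))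
    with hf
  set g : ℝ × ℝ → ℂ := fun q => -Real.sin q.2 * F 0 (p q) + Real.cos q.2 * F 1 (p q) with hg
  have hcos : ContDiff ℝ 1 fun q : ℝ × ℝ => (Real.cos q.2 : ℂ) :=
    Complex.ofRealCLM.contDiff.comp (Real.contDiff_cos.comp contDiff_snd)
  have hsin : ContDiff ℝ 1 fun q : ℝ × ℝ => (Real.sin q.2 : ℂ) :=
    Complex.ofRealCLM.contDiff.comp (Real.contDiff_sin.comp contDiff_snd)
  have hfst : ContDiff ℝ 1 fun q : ℝ × ℝ => (q.1 : ℂ) :=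
    Complex.ofRealCLM.contDiff.comp contDiff_fst
  have hfc : ContDiff ℝ 1 f := hfst.mul ((hcos.mul (hFp 0)).add (hsin.mul (hFp 1)))
  have hgc : ContDiff ℝ 1 g := (hsin.neg.mul (hFp 0)).add (hcos.mul (hFp 1))
  have key : ∀ q : ℝ × ℝ, fderiv ℝ f q (1, 0) + fderiv ℝ g q (0, 1) =
      q.1 • ∑ j, pderiv j (F j) (p q) := by
    rintro ⟨r, θ⟩
    have l1 : HasDerivAt (fun t : ℝ => ((t, θ) : ℝ × ℝ)) (1, 0) r :=
      (hasDerivAt_id r).prodMk (hasDerivAt_const r θ)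
    have l2 : HasDerivAt (fun t : ℝ => ((r, t) : ℝ × ℝ)) (0, 1) θ :=
      (hasDerivAt_const θ r).prodMk (hasDerivAt_id θ)
    have f1 := ((hfc.differentiable one_ne_zero) (r, θ)).hasFDerivAt.comp_hasDerivAt r l1
    have g1 := ((hgc.differentiable one_ne_zero) (r, θ)).hasFDerivAt.comp_hasDerivAt θ l2
    have p1 : HasDerivAt (fun t : ℝ => t • unitDir θ) (unitDir θ) r := by
      simpa using (hasDerivAt_id r).smul_const (unitDir θ)
    have p2 : HasDerivAt (fun t : ℝ => r • unitDir t) (r • normalMax θ) θ :=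
      (hasDerivAt_unitDir θ).const_smul r
    have F1 : ∀ j, HasDerivAt (fun t : ℝ => F j (t • unitDir θ)) _ r := fun j =>
      ((hd j) (r • unitDir θ)).hasFDerivAt.comp_hasDerivAt r p1
    have F2 : ∀ j, HasDerivAt (fun t : ℝ => F j (r • unitDir t)) _ θ := fun j =>
      ((hd j) (r • unitDir θ)).hasFDerivAt.comp_hasDerivAt θ p2
    have f2 : HasDerivAt (fun t : ℝ => f (t, θ)) _ r :=
      ((hasDerivAt_id r).ofReal_comp).mul
        (((F1 0).const_mul (Real.cos θ : ℂ)).add ((F1 1).const_mul (Real.sin θ : ℂ)))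
    have g2 : HasDerivAt (fun t : ℝ => g (r, t)) _ θ :=
      ((Real.hasDerivAt_sin θ).ofReal_comp.neg.mul (F2 0)).add
        ((Real.hasDerivAt_cos θ).ofReal_comp.mul (F2 1))
    rw [f1.unique f2, g1.unique g2]
    simp only [pderiv_eq_fderiv_apply, Fin.sum_univ_two, PiLp.smul_apply, unitDir_zero,
      unitDir_one, normalMax_zero, normalMax_one, Complex.real_smul, smul_eq_mul, hp, Pi.neg_apply]
    have hcs : (Real.cos θ : ℂ) ^ 2 + (Real.sin θ : ℂ) ^ 2 = 1 := by
      exact_mod_cast Real.cos_sq_add_sin_sq θ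
    push_cast at hcs ⊢
    simp only [id]
    linear_combination (r * (pderiv 0 (F 0) (r • unitDir θ) + pderiv 1 (F 1) (r • unitDir θ)))
      * hcs
  have hcontk : Continuous fun q : ℝ × ℝ => fderiv ℝ f q (1, 0) + fderiv ℝ g q (0, 1) :=
    ((hfc.continuous_fderiv one_ne_zero).clm_apply continuous_const).add
      ((hgc.continuous_fderiv one_ne_zero).clm_apply continuous_const)
  have hint : IntegrableOn (fun q : ℝ × ℝ => fderiv ℝ f q (1, 0) + fderiv ℝ g q (0, 1))
      (uIcc 0 h ×ˢ uIcc θmin θmax) :=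
    hcontk.continuousOn.integrableOn_compact (isCompact_uIcc.prod isCompact_uIcc)
  have main := integral2_divergence_prod_of_hasFDerivAt f g (fderiv ℝ f) (fderiv ℝ g)
    0 θmin h θmax hfc.continuous.continuousOn hgc.continuous.continuousOn
    (fun q _ => ((hfc.differentiable one_ne_zero) q).hasFDerivAt)
    (fun q _ => ((hgc.differentiable one_ne_zero) q).hasFDerivAt) hint
  rw [setIntegral_sectorDisk_eq_polar H]
  have hint' : IntegrableOn (fun q : ℝ × ℝ => fderiv ℝ f q (1, 0) + fderiv ℝ g q (0, 1))
      (Ioo 0 h ×ˢ Ioo θmin θmax) := by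
    refine hint.mono_set ?_
    rw [uIcc_of_le hh.le, uIcc_of_le H.hlt.le]
    exact prod_mono Ioo_subset_Icc_self Ioo_subset_Icc_self
  have lhs : ∫ q in Ioo 0 h ×ˢ Ioo θmin θmax, q.1 • ∑ j, pderiv j (F j) (q.1 • unitDir q.2) =
      ∫ x in (0 : ℝ)..h, ∫ y in θmin..θmax, fderiv ℝ f (x, y) (1, 0) + fderiv ℝ g (x, y) (0, 1) := by
    rw [intervalIntegral.integral_of_le hh.le, integral_Ioc_eq_integral_Ioo]
    simp_rw [intervalIntegral.integral_of_le H.hlt.le, integral_Ioc_eq_integral_Ioo]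
    rw [Measure.volume_eq_prod] at hint' ⊢
    rw [← setIntegral_prod _ hint']
    exact setIntegral_congr_fun (measurableSet_Ioo.prod measurableSet_Ioo)
      fun q _ => (key q).symm
  rw [lhs, main]
  have hFc : ∀ j, Continuous (F j) := fun j => (hF j).continuous
  have hcoord : ∀ j : Fin 2, Continuous fun x : Plane => ((x j : ℝ) : ℂ) := fun j => by fun_prop
  rw [integral_edgeMeasure, integral_edgeMeasure, integral_arcMeasure hh
    (by
      refine continuous_finsetSum _ fun j _ => Continuous.mul ?_ (hFc j)
      exact (hcoord j).comp (continuous_const_smul h⁻¹)),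
    intervalIntegral.integral_of_le hh.le, intervalIntegral.integral_of_le hh.le,
    intervalIntegral.integral_of_le H.hlt.le, intervalIntegral.integral_of_le H.hlt.le]
  simp_rw [integral_Ioc_eq_integral_Ioo]
  have z : ∫ y in Ioo θmin θmax, f (0, y) = 0 := by simp [hf]
  have a : ∫ y in Ioo θmin θmax, f (h, y) = h • ∫ θ in Ioo θmin θmax,
      ∑ j, (((h⁻¹ • h • unitDir θ : Plane) j : ℝ) : ℂ) * F j (h • unitDir θ) := by
    rw [← integral_smul]
    refine setIntegral_congr_fun measurableSet_Ioo fun θ _ => ?_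
    simp [hf, hp, smul_smul, inv_mul_cancel₀ hh.ne', Fin.sum_univ_two, mul_add]
  have b : ∫ r in Ioo 0 h, ∑ j, (normalMin θmin j : ℂ) * F j (r • unitDir θmin) =
      -∫ r in Ioo 0 h, g (r, θmin) := by
    rw [← integral_neg]
    refine setIntegral_congr_fun measurableSet_Ioo fun r _ => ?_
    simp [hg, hp, Fin.sum_univ_two, add_comm]
  have c : ∫ r in Ioo 0 h, ∑ j, (normalMax θmax j : ℂ) * F j (r • unitDir θmax) =
      ∫ r in Ioo 0 h, g (r, θmax) := by
    refine setIntegral_congr_fun measurableSet_Ioo fun r _ => ?_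
    simp [hg, hp, Fin.sum_univ_two]
  rw [z, a, b, c]
  ring


/-! ### Calculus of partial derivatives -/

lemma pderiv_add {f g : Plane → ℂ} {x : Plane} (j : Fin 2) (hf : DifferentiableAt ℝ f x)
    (hg : DifferentiableAt ℝ g x) :
    pderiv j (fun y => f y + g y) x = pderiv j f x + pderiv j g x := by
  unfold pderiv; rw [fderiv_fun_add hf hg]; rfl

lemma pderiv_sub {f g : Plane → ℂ} {x : Plane} (j : Fin 2) (hf : DifferentiableAt ℝ f x)
    (hg : DifferentiableAt ℝ g x) :
    pderiv j (fun y => f y - g y) x = pderiv j f x - pderiv j g x := by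
  unfold pderiv; rw [fderiv_fun_sub hf hg]; rfl

lemma pderiv_mul {f g : Plane → ℂ} {x : Plane} (j : Fin 2) (hf : DifferentiableAt ℝ f x)
    (hg : DifferentiableAt ℝ g x) :
    pderiv j (fun y => f y * g y) x = f x * pderiv j g x + pderiv j f x * g x := by
  unfold pderiv; rw [fderiv_fun_mul hf hg]; simp [mul_comm]

@[simp] lemma pderiv_const (j : Fin 2) (c : ℂ) (x : Plane) : pderiv j (fun _ => c) x = 0 := by
  simp [pderiv]

lemma pderiv_const_mul {f : Plane → ℂ} {x : Plane} (j : Fin 2) (c : ℂ)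
    (hf : DifferentiableAt ℝ f x) : pderiv j (fun y => c * f y) x = c * pderiv j f x := by
  rw [pderiv_mul j (by fun_prop) hf]; simp

lemma pderiv_neg (f : Plane → ℂ) (j : Fin 2) (x : Plane) :
    pderiv j (fun y => -f y) x = -pderiv j f x := by
  unfold pderiv; rw [fderiv_fun_neg]; rfl

lemma pderiv_comp_smul {f : Plane → ℂ} (hf : Differentiable ℝ f) (j : Fin 2) (c : ℝ) (x : Plane) :
    pderiv j (fun y => f (c • y)) x = c * pderiv j f (c • x) := by
  have h1 : HasFDerivAt (fun y : Plane => c • y) (c • ContinuousLinearMap.id ℝ Plane) x :=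
    (hasFDerivAt_id x).const_smul c
  have h2 := (hf (c • x)).hasFDerivAt.comp x h1
  unfold pderiv
  rw [show (fun y => f (c • y)) = f ∘ fun y => c • y from rfl, h2.fderiv]
  simp

lemma hasFDerivAt_coord (i : Fin 2) (x : Plane) : HasFDerivAt (fun y : Plane => ((y i : ℝ) : ℂ))
    (Complex.ofRealCLM.comp (EuclideanSpace.proj i : Plane →L[ℝ] ℝ)) x :=
  (Complex.ofRealCLM.comp (EuclideanSpace.proj i : Plane →L[ℝ] ℝ)).hasFDerivAt

lemma contDiff_coord {n : WithTop ℕ∞} (i : Fin 2) :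
    ContDiff ℝ n fun y : Plane => ((y i : ℝ) : ℂ) :=
  (Complex.ofRealCLM.comp (EuclideanSpace.proj i : Plane →L[ℝ] ℝ)).contDiff

lemma pderiv_coord (i j : Fin 2) (x : Plane) :
    pderiv j (fun y : Plane => ((y i : ℝ) : ℂ)) x = if i = j then 1 else 0 := by
  unfold pderiv
  rw [(hasFDerivAt_coord i x).fderiv]
  split_ifs with h <;> simp [EuclideanSpace.proj, h]

lemma pderiv_cexp {f : Plane → ℂ} {x : Plane} (j : Fin 2) (hf : DifferentiableAt ℝ f x) :
    pderiv j (fun y => Complex.exp (f y)) x = Complex.exp (f x) * pderiv j f x := by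
  unfold pderiv
  rw [hf.hasFDerivAt.cexp.fderiv]
  simp

lemma pderiv_conj {f : Plane → ℂ} {x : Plane} (j : Fin 2) (hf : DifferentiableAt ℝ f x) :
    pderiv j (fun y => (starRingEnd ℂ) (f y)) x = (starRingEnd ℂ) (pderiv j f x) := by
  have h := (Complex.conjCLE : ℂ →L[ℝ] ℂ).hasFDerivAt.comp x hf.hasFDerivAt
  unfold pderiv
  rw [show (fun y => (starRingEnd ℂ) (f y)) = ⇑(Complex.conjCLE : ℂ →L[ℝ] ℂ) ∘ f from rfl,
    h.fderiv]
  simp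

lemma contDiff_pderiv {f : Plane → ℂ} {m n : WithTop ℕ∞} (hf : ContDiff ℝ n f) (hmn : m + 1 ≤ n)
    (j : Fin 2) : ContDiff ℝ m (pderiv j f) :=
  (hf.fderiv_right hmn).clm_apply contDiff_const

lemma contDiff_component {φ : Plane → CVec} {n : WithTop ℕ∞} (hφ : ContDiff ℝ n φ) (i : Fin 2) :
    ContDiff ℝ n fun x => φ x i := contDiff_pi.1 hφ i

/-! ### Pairings in `L²` -/

section L2

variable {α : Type*} [MeasurableSpace α] {μ : Measure α}

lemma eLpNorm_two_eq {f : α → ℂ} (hf : MemLp f 2 μ) :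
    eLpNorm f 2 μ = ENNReal.ofReal (Real.sqrt (∫ x, ‖f x‖ ^ 2 ∂μ)) := by
  rw [hf.eLpNorm_eq_integral_rpow_norm (by norm_num) (by norm_num)]
  congr 1
  rw [Real.sqrt_eq_rpow]
  norm_num

lemma integrable_sq {f : α → ℂ} (hf : MemLp f 2 μ) : Integrable (fun x => ‖f x‖ ^ 2) μ :=
  hf.integrable_norm_pow two_ne_zero

lemma integrable_mul_of_memLp {f g : α → ℂ} (hf : MemLp f 2 μ) (hg : MemLp g 2 μ) :
    Integrable (fun x => f x * g x) μ := hf.integrable_mul hg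

lemma enorm_integral_mul_le {f g : α → ℂ} (hf : AEStronglyMeasurable f μ)
    (hg : AEStronglyMeasurable g μ) :
    ‖∫ x, f x * g x ∂μ‖ₑ ≤ eLpNorm f 2 μ * eLpNorm g 2 μ := by
  refine (enorm_integral_le_lintegral_enorm _).trans ?_
  rw [← eLpNorm_one_eq_lintegral_enorm]
  have h := eLpNorm_smul_le_mul_eLpNorm (p := 2) (q := 2) (r := 1) hg hf
  exact h

lemma norm_integral_mul_le {f g : α → ℂ} (hf : MemLp f 2 μ) (hg : MemLp g 2 μ) :
    ‖∫ x, f x * g x ∂μ‖ ≤ Real.sqrt (∫ x, ‖f x‖ ^ 2 ∂μ) * Real.sqrt (∫ x, ‖g x‖ ^ 2 ∂μ) := by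
  have h := enorm_integral_mul_le hf.1 hg.1
  rw [eLpNorm_two_eq hf, eLpNorm_two_eq hg, ← ENNReal.ofReal_mul (Real.sqrt_nonneg _),
    ← ofReal_norm, ENNReal.ofReal_le_ofReal_iff (by positivity)] at h
  exact h

lemma tendsto_integral_mul {k f : α → ℂ} {φ : ℕ → α → ℂ} (hk : MemLp k 2 μ) (hf : MemLp f 2 μ)
    (hφ : ∀ n, MemLp (φ n) 2 μ)
    (hlim : Tendsto (fun n => eLpNorm (fun x => φ n x - f x) 2 μ) atTop (𝓝 0)) :
    Tendsto (fun n => ∫ x, k x * φ n x ∂μ) atTop (𝓝 (∫ x, k x * f x ∂μ)) := by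
  rw [tendsto_iff_edist_tendsto_0]
  have h0 : Tendsto (fun n => eLpNorm k 2 μ * eLpNorm (fun x => φ n x - f x) 2 μ) atTop
      (𝓝 0) := by
    simpa using ENNReal.Tendsto.const_mul hlim (Or.inr hk.2.ne)
  refine tendsto_of_tendsto_of_tendsto_of_le_of_le tendsto_const_nhds h0 (fun _ => zero_le)
    fun n => ?_
  dsimp only
  rw [edist_eq_enorm_sub, ← integral_sub (integrable_mul_of_memLp hk (hφ n))
    (integrable_mul_of_memLp hk hf)]
  simp_rw [← mul_sub]
  exact enorm_integral_mul_le hk.1 ((hφ n).sub hf).1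

/-- An `L²` limit of `L²` functions is in `L²` if it is measurable. -/
lemma memLp_of_tendsto {f : α → ℂ} {φ : ℕ → α → ℂ} (hf : AEStronglyMeasurable f μ)
    (hφ : ∀ n, MemLp (φ n) 2 μ)
    (hlim : Tendsto (fun n => eLpNorm (fun x => φ n x - f x) 2 μ) atTop (𝓝 0)) :
    MemLp f 2 μ := by
  obtain ⟨n, hn⟩ := (hlim.eventually (gt_mem_nhds ENNReal.zero_lt_top)).exists
  have h1 : MemLp (fun x => φ n x - f x) 2 μ := ⟨(hφ n).1.sub hf, hn⟩
  have h2 := (hφ n).sub h1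
  refine h2.ae_eq (Eventually.of_forall fun x => ?_)
  simp

/-- Completeness of `L²`. -/
lemma exists_tendsto_of_cauchy {φ : ℕ → α → ℂ} (hφ : ∀ n, MemLp (φ n) 2 μ)
    (hc : Tendsto (fun p : ℕ × ℕ => eLpNorm (fun x => φ p.1 x - φ p.2 x) 2 μ)
      atTop (𝓝 0)) :
    ∃ f, MemLp f 2 μ ∧ Tendsto (fun n => eLpNorm (fun x => φ n x - f x) 2 μ) atTop (𝓝 0) := by
  have : Fact ((1 : ENNReal) ≤ 2) := ⟨by norm_num⟩
  have hcs : CauchySeq fun n => (hφ n).toLp (φ n) := by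
    rw [cauchySeq_iff_tendsto_dist_atTop_0]
    have h1 := (ENNReal.tendsto_toReal ENNReal.zero_ne_top).comp hc
    refine h1.congr fun p => ?_
    rw [dist_comm, dist_comm, Lp.dist_def]
    simp only [Function.comp]
    congr 1
    refine eLpNorm_congr_ae ?_
    filter_upwards [(hφ p.1).coeFn_toLp, (hφ p.2).coeFn_toLp] with x h1 h2
    simp [h1, h2]
  obtain ⟨F, hF⟩ := cauchySeq_tendsto_of_complete hcs
  refine ⟨F, Lp.memLp F, ?_⟩
  have h2 := (Lp.tendsto_Lp_iff_tendsto_eLpNorm' _ F).1 hF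
  refine h2.congr fun n => ?_
  refine eLpNorm_congr_ae ?_
  filter_upwards [(hφ n).coeFn_toLp] with x h1
  simp [h1]

end L2

/-! ### The measures on the sector and its boundary -/

/-- A finite measure carried by the closed ball of radius `h`. -/
structure IsBallMeasure (h : ℝ) (σ : Measure Plane) : Prop where
  finite : IsFiniteMeasure σ
  ae_norm_le : ∀ᵐ x ∂σ, ‖x‖ ≤ h

lemma IsBallMeasure.memLp {σ : Measure Plane} (hσ : IsBallMeasure h σ) {f : Plane → ℂ}
    (hf : Continuous f) (p : ENNReal) : MemLp f p σ := by
  have := hσ.finite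
  obtain ⟨C, hC⟩ := (isCompact_closedBall (0 : Plane) h).exists_bound_of_continuousOn
    hf.continuousOn
  refine MemLp.of_bound hf.aestronglyMeasurable C ?_
  filter_upwards [hσ.ae_norm_le] with x hx
  exact hC x (by simpa using hx)

lemma IsBallMeasure.integrable {σ : Measure Plane} (hσ : IsBallMeasure h σ) {f : Plane → ℂ}
    (hf : Continuous f) : Integrable f σ := memLp_one_iff_integrable.1 (hσ.memLp hf 1)

lemma isBallMeasure_sectorDisk (H : IsConvexSector θmin θmax h) :
    IsBallMeasure h (volume.restrict (sectorDisk θmin θmax h)) where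
  finite := ⟨by
    rw [Measure.restrict_apply_univ]
    exact (measure_mono sectorDisk_subset_ball).trans_lt measure_ball_lt_top⟩
  ae_norm_le := (ae_restrict_mem (measurableSet_sectorDisk H)).mono
    fun _ hx => (norm_lt_of_mem_sectorDisk hx).le

lemma isBallMeasure_edge (θ h : ℝ) : IsBallMeasure h (edgeMeasure θ h) where
  finite := by unfold edgeMeasure; infer_instance
  ae_norm_le := by
    rw [edgeMeasure, (measurableEmbedding_smul_unitDir θ).ae_map_iff]
    refine (ae_restrict_mem measurableSet_Ioo).mono fun r hr => ?_
    rw [norm_smul_unitDir hr.1.le]; exact hr.2.le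

lemma continuous_smul_unitDir (h : ℝ) : Continuous fun θ : ℝ => h • unitDir θ :=
  continuous_unitDir.const_smul h

lemma ae_arcMeasure (H : IsConvexSector θmin θmax h) :
    ∀ᵐ x ∂(arcMeasure θmin θmax h), x ∈ arc θmin θmax h := by
  have hm : MeasurableSet (arc θmin θmax h) :=
    (isOpen_sector H.hlt H.hangle).measurableSet.inter Metric.isClosed_sphere.measurableSet
  rw [arcMeasure]
  refine Measure.ae_smul_measure ?_ _
  refine (ae_map_iff (p := fun x => x ∈ arc θmin θmax h)
    (continuous_smul_unitDir h).measurable.aemeasurable hm).2 ?_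
  refine (ae_restrict_mem measurableSet_Ioo).mono fun θ hθ => ?_
  refine ⟨⟨h, θ, H.hh, hθ.1, hθ.2, rfl⟩, ?_⟩
  rw [Metric.mem_sphere, dist_zero_right, norm_smul_unitDir H.hh.le]

lemma norm_of_mem_arc {x : Plane} (hx : x ∈ arc θmin θmax h) : ‖x‖ = h := by simpa using hx.2

lemma isBallMeasure_arc (H : IsConvexSector θmin θmax h) :
    IsBallMeasure h (arcMeasure θmin θmax h) where
  finite := by
    unfold arcMeasure
    exact Measure.smul_finite _ ENNReal.ofReal_ne_top
  ae_norm_le := (ae_arcMeasure H).mono fun x hx => (norm_of_mem_arc hx).le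

lemma ae_edgeMeasure (θ h : ℝ) : ∀ᵐ x ∂(edgeMeasure θ h), x ∈ edge θ h := by
  rw [edgeMeasure, (measurableEmbedding_smul_unitDir θ).ae_map_iff]
  exact (ae_restrict_mem measurableSet_Ioo).mono fun r hr => ⟨r, hr.1, hr.2, rfl⟩


/-! ### Trace inequalities -/

/-- The square of the `H¹(U)` norm of a smooth scalar function. -/
noncomputable def scalarH1Sq (U : Set Plane) (φ : Plane → ℂ) : ℝ :=
  ∫ x in U, (‖φ x‖ ^ 2 + ∑ j, ‖pderiv j φ x‖ ^ 2)

lemma continuous_h1Density {φ : Plane → ℂ} (hφ : ContDiff ℝ 1 φ) :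
    Continuous fun x => ‖φ x‖ ^ 2 + ∑ j, ‖pderiv j φ x‖ ^ 2 := by
  have h1 := hφ.continuous
  have h2 := fun j => continuous_pderiv hφ j
  fun_prop

lemma IsBallMeasure.integrable_real {σ : Measure Plane} (hσ : IsBallMeasure h σ) {f : Plane → ℝ}
    (hf : Continuous f) : Integrable f σ := by
  have := (hσ.integrable (Complex.continuous_ofReal.comp hf)).re
  simpa using this

/-- The volume term in the divergence theorem for `|φ|² X`. -/
lemma norm_integral_div_sq_le (H : IsConvexSector θmin θmax h) {φ : Plane → ℂ}
    (hφ : ContDiff ℝ 1 φ) {X : Fin 2 → Plane → ℂ} (hX : ∀ j, ContDiff ℝ 1 (X j)) {M : ℝ}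
    (hM : ∀ j, ∀ x ∈ sectorDisk θmin θmax h, ‖X j x‖ ≤ M)
    (hM' : ∀ j, ∀ x ∈ sectorDisk θmin θmax h, ‖pderiv j (X j) x‖ ≤ M) :
    ‖∫ x in sectorDisk θmin θmax h,
      ∑ j, pderiv j (fun y => φ y * (starRingEnd ℂ) (φ y) * X j y) x‖ ≤
      4 * M * scalarH1Sq (sectorDisk θmin θmax h) φ := by
  rw [scalarH1Sq, ← integral_const_mul]
  have hd : Differentiable ℝ φ := hφ.differentiable one_ne_zero
  have hdc : Differentiable ℝ fun y => (starRingEnd ℂ) (φ y) :=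
    Complex.conjCLE.differentiable.comp hd
  refine norm_integral_le_of_norm_le
    (((isBallMeasure_sectorDisk H).integrable_real (continuous_h1Density hφ)).const_mul (4 * M)) ?_
  refine (ae_restrict_mem (measurableSet_sectorDisk H)).mono fun x hx => ?_
  have hMx : ∀ j, ‖X j x‖ ≤ M := fun j => hM j x hx
  have hMx' : ∀ j, ‖pderiv j (X j) x‖ ≤ M := fun j => hM' j x hx
  have hM0 : 0 ≤ M := (norm_nonneg _).trans (hMx 0)
  -- Product rule and `2ab ≤ a² + b²`; summing over the two directions produces `4 M` in front of
  -- the `H¹` density.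
  have key : ∀ j, ‖pderiv j (fun y => φ y * (starRingEnd ℂ) (φ y) * X j y) x‖ ≤
      M * (2 * ‖φ x‖ ^ 2 + ‖pderiv j φ x‖ ^ 2) := by
    intro j
    rw [pderiv_mul j ((hd x).fun_mul (hdc x)) ((hX j).differentiable one_ne_zero x),
      pderiv_mul j (hd x) (hdc x), pderiv_conj j (hd x)]
    refine (norm_add_le _ _).trans ?_
    simp only [norm_mul]
    have e1 : ‖φ x * (starRingEnd ℂ) (pderiv j φ x) + pderiv j φ x * (starRingEnd ℂ) (φ x)‖ ≤
        2 * (‖φ x‖ * ‖pderiv j φ x‖) := by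
      refine (norm_add_le _ _).trans (le_of_eq ?_)
      simp only [norm_mul, RCLike.norm_conj]; ring
    rw [RCLike.norm_conj]
    have e2 := two_mul_le_add_sq ‖φ x‖ ‖pderiv j φ x‖
    calc ‖φ x‖ * ‖φ x‖ * ‖pderiv j (X j) x‖ +
          ‖φ x * (starRingEnd ℂ) (pderiv j φ x) + pderiv j φ x * (starRingEnd ℂ) (φ x)‖ * ‖X j x‖
        ≤ ‖φ x‖ * ‖φ x‖ * M + (2 * (‖φ x‖ * ‖pderiv j φ x‖)) * M := by
          gcongr
          · exact hMx' j
          · exact hMx j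
      _ ≤ M * (2 * ‖φ x‖ ^ 2 + ‖pderiv j φ x‖ ^ 2) := by nlinarith
  refine (norm_sum_le _ _).trans ((Finset.sum_le_sum fun j _ => key j).trans ?_)
  simp only [Fin.sum_univ_two]
  nlinarith [sq_nonneg ‖φ x‖, sq_nonneg ‖pderiv 0 φ x‖, sq_nonneg ‖pderiv 1 φ x‖,
    mul_nonneg hM0 (sq_nonneg ‖pderiv 0 φ x‖), mul_nonneg hM0 (sq_nonneg ‖pderiv 1 φ x‖)]

lemma mul_conj_eq (z : ℂ) : z * (starRingEnd ℂ) z = ((‖z‖ ^ 2 : ℝ) : ℂ) := by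
  rw [Complex.mul_conj, Complex.normSq_eq_norm_sq]

lemma contDiff_mul_conj {φ : Plane → ℂ} (hφ : ContDiff ℝ 1 φ) :
    ContDiff ℝ 1 fun y => φ y * (starRingEnd ℂ) (φ y) :=
  hφ.mul ((Complex.conjCLE : ℂ →L[ℝ] ℂ).contDiff.comp hφ)

/-- The measure `σ` on `∂U` has traces of `H¹(U)` functions in `L²(σ)`. -/
def TraceBounded (U : Set Plane) (σ : Measure Plane) : Prop :=
  ∃ C : ℝ, 0 ≤ C ∧ ∀ φ : Plane → ℂ, ContDiff ℝ 1 φ →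
    ∫ x, ‖φ x‖ ^ 2 ∂σ ≤ C * scalarH1Sq U φ

/-- Take `X = x`: this field is tangent to both edges and has normal component `h` on the arc, so
only the arc term survives. -/
lemma traceBounded_arc (H : IsConvexSector θmin θmax h) :
    TraceBounded (sectorDisk θmin θmax h) (arcMeasure θmin θmax h) := by
  have hh := H.hh
  refine ⟨h⁻¹ * (4 * max h 1), by positivity, fun φ hφ => ?_⟩
  have hX : ∀ j : Fin 2, ContDiff ℝ 1 fun y : Plane => ((y j : ℝ) : ℂ) := contDiff_coord
  have hle := norm_integral_div_sq_le H hφ hX (M := max h 1)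
    (fun j x hx => by
      rw [Complex.norm_real]
      exact (PiLp.norm_apply_le x j).trans
        ((norm_lt_of_mem_sectorDisk hx).le.trans (le_max_left _ _)))
    (fun j x _ => by rw [pderiv_coord]; simp)
  rw [integral_divergence_sectorDisk H fun j => (contDiff_mul_conj hφ).mul (hX j)] at hle
  have z1 : ∫ x, ∑ j, (normalMax θmax j : ℂ) * (φ x * (starRingEnd ℂ) (φ x) * ((x j : ℝ) : ℂ))
      ∂(edgeMeasure θmax h) = 0 := by
    rw [integral_edgeMeasure]
    simp only [Fin.sum_univ_two]
    refine integral_eq_zero_of_ae (Eventually.of_forall fun r => ?_)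
    simp; ring
  have z2 : ∫ x, ∑ j, (normalMin θmin j : ℂ) * (φ x * (starRingEnd ℂ) (φ x) * ((x j : ℝ) : ℂ))
      ∂(edgeMeasure θmin h) = 0 := by
    rw [integral_edgeMeasure]
    simp only [Fin.sum_univ_two]
    refine integral_eq_zero_of_ae (Eventually.of_forall fun r => ?_)
    simp; ring
  have z3 : ∫ x, ∑ j, (((h⁻¹ • x : Plane) j : ℝ) : ℂ) *
      (φ x * (starRingEnd ℂ) (φ x) * ((x j : ℝ) : ℂ)) ∂(arcMeasure θmin θmax h) =
      ((h * ∫ x, ‖φ x‖ ^ 2 ∂(arcMeasure θmin θmax h) : ℝ) : ℂ) := by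
    rw [← integral_const_mul, ← integral_complex_ofReal]
    refine integral_congr_ae ?_
    filter_upwards [ae_arcMeasure H] with x hx
    have h1 : ‖x‖ ^ 2 = h ^ 2 := by rw [norm_of_mem_arc hx]
    rw [EuclideanSpace.norm_sq_eq, Fin.sum_univ_two] at h1
    simp only [Real.norm_eq_abs, sq_abs] at h1
    have h2 : ((x 0 : ℝ) : ℂ) ^ 2 + ((x 1 : ℝ) : ℂ) ^ 2 = (h : ℂ) ^ 2 := by exact_mod_cast h1
    have h3 : (h : ℂ) ≠ 0 := by exact_mod_cast hh.ne'
    rw [mul_conj_eq, Fin.sum_univ_two]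
    simp only [PiLp.smul_apply, smul_eq_mul]
    push_cast
    calc (h : ℂ)⁻¹ * (x 0 : ℝ) * ((‖φ x‖ : ℂ) ^ 2 * (x 0 : ℝ)) +
          (h : ℂ)⁻¹ * (x 1 : ℝ) * ((‖φ x‖ : ℂ) ^ 2 * (x 1 : ℝ))
        = (h : ℂ)⁻¹ * (‖φ x‖ : ℂ) ^ 2 * (((x 0 : ℝ) : ℂ) ^ 2 + ((x 1 : ℝ) : ℂ) ^ 2) := by ring
      _ = _ := by rw [h2]; field_simp
  rw [z1, z2, z3, zero_add, zero_add, Complex.norm_real] at hle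
  have hle' := (le_abs_self _).trans hle
  calc ∫ x, ‖φ x‖ ^ 2 ∂(arcMeasure θmin θmax h)
      = h⁻¹ * (h * ∫ x, ‖φ x‖ ^ 2 ∂(arcMeasure θmin θmax h)) := by
        rw [inv_mul_cancel_left₀ hh.ne']
    _ ≤ h⁻¹ * (4 * max h 1 * scalarH1Sq (sectorDisk θmin θmax h) φ) := by gcongr
    _ = _ := by ring

/-- Take for `X` the constant unit vector opposite to the bisector. Its normal component on either
edge is the sine of the half-opening, which is positive; the arc term is already controlled by the
estimate on the arc. -/
lemma traceBounded_edges (H : IsConvexSector θmin θmax h) :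
    TraceBounded (sectorDisk θmin θmax h) (edgeMeasure θmax h) ∧
      TraceBounded (sectorDisk θmin θmax h) (edgeMeasure θmin h) := by
  have hh := H.hh
  obtain ⟨C, hC0, hC⟩ := traceBounded_arc H
  set s := Real.sin ((θmax - θmin) / 2) with hs
  have hspos : 0 < s := Real.sin_pos_of_pos_of_lt_pi (by linarith [H.hlt])
    (by linarith [H.hangle, Real.pi_pos])
  have main : ∀ φ : Plane → ℂ, ContDiff ℝ 1 φ →
      ∫ x, ‖φ x‖ ^ 2 ∂(edgeMeasure θmax h) + ∫ x, ‖φ x‖ ^ 2 ∂(edgeMeasure θmin h) ≤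
        (s⁻¹ * (4 + 2 * C)) * scalarH1Sq (sectorDisk θmin θmax h) φ := by
    intro φ hφ
    set m := (θmin + θmax) / 2 with hm
    have hX : ∀ j : Fin 2, ContDiff ℝ 1 fun _ : Plane => ((-(unitDir m j) : ℝ) : ℂ) :=
      fun _ => contDiff_const
    have hle := norm_integral_div_sq_le H hφ hX (M := 1)
      (fun j x _ => by
        rw [Complex.norm_real, norm_neg]
        exact (PiLp.norm_apply_le (unitDir m) j).trans (norm_unitDir m).le)
      (fun j x _ => by rw [pderiv_const]; simp)
    rw [integral_divergence_sectorDisk H fun j => (contDiff_mul_conj hφ).mul (hX j)] at hle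
    have z1 : ∫ x, ∑ j, (normalMax θmax j : ℂ) *
        (φ x * (starRingEnd ℂ) (φ x) * ((-(unitDir m j) : ℝ) : ℂ)) ∂(edgeMeasure θmax h) =
        ((s * ∫ x, ‖φ x‖ ^ 2 ∂(edgeMeasure θmax h) : ℝ) : ℂ) := by
      rw [← integral_const_mul, ← integral_complex_ofReal]
      congr 1 with x
      have : s = Real.sin θmax * Real.cos m - Real.cos θmax * Real.sin m := by
        rw [← Real.sin_sub, hs, hm]; congr 1; ring
      rw [mul_conj_eq, Fin.sum_univ_two, this]
      simp only [normalMax_zero, normalMax_one, unitDir_zero, unitDir_one]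
      push_cast; ring
    have z2 : ∫ x, ∑ j, (normalMin θmin j : ℂ) *
        (φ x * (starRingEnd ℂ) (φ x) * ((-(unitDir m j) : ℝ) : ℂ)) ∂(edgeMeasure θmin h) =
        ((s * ∫ x, ‖φ x‖ ^ 2 ∂(edgeMeasure θmin h) : ℝ) : ℂ) := by
      rw [← integral_const_mul, ← integral_complex_ofReal]
      congr 1 with x
      have : s = Real.sin m * Real.cos θmin - Real.cos m * Real.sin θmin := by
        rw [← Real.sin_sub, hs, hm]; congr 1; ring
      rw [mul_conj_eq, Fin.sum_univ_two, this]
      simp only [normalMin_zero, normalMin_one, unitDir_zero, unitDir_one]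
      push_cast; ring
    have z3 : ‖∫ x, ∑ j, (((h⁻¹ • x : Plane) j : ℝ) : ℂ) *
        (φ x * (starRingEnd ℂ) (φ x) * ((-(unitDir m j) : ℝ) : ℂ)) ∂(arcMeasure θmin θmax h)‖ ≤
        2 * ∫ x, ‖φ x‖ ^ 2 ∂(arcMeasure θmin θmax h) := by
      rw [← integral_const_mul]
      refine norm_integral_le_of_norm_le (((isBallMeasure_arc H).integrable_real
        (hφ.continuous.norm.pow 2)).const_mul 2) ?_
      filter_upwards [ae_arcMeasure H] with x hx
      have e1 : ∀ j, ‖(h⁻¹ • x : Plane) j‖ ≤ 1 := fun j => by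
        refine (PiLp.norm_apply_le _ j).trans ?_
        rw [norm_smul, norm_of_mem_arc hx, norm_inv, Real.norm_of_nonneg hh.le,
          inv_mul_cancel₀ hh.ne']
      have e2 : ∀ j, ‖unitDir m j‖ ≤ 1 := fun j =>
        (PiLp.norm_apply_le (unitDir m) j).trans (norm_unitDir m).le
      have e3 : ∀ j : Fin 2, ‖(((h⁻¹ • x : Plane) j : ℝ) : ℂ) *
          (φ x * (starRingEnd ℂ) (φ x) * ((-(unitDir m j) : ℝ) : ℂ))‖ ≤ ‖φ x‖ ^ 2 := fun j => by
        rw [norm_mul, norm_mul, norm_mul, RCLike.norm_conj, Complex.norm_real, Complex.norm_real,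
          norm_neg]
        calc _ ≤ 1 * (‖φ x‖ * ‖φ x‖ * 1) := by
              gcongr
              · exact e1 j
              · exact e2 j
          _ = _ := by ring
      refine (norm_sum_le _ _).trans ((Finset.sum_le_sum fun j _ => e3 j).trans ?_)
      rw [Fin.sum_univ_two, two_mul]
    rw [z1, z2] at hle
    have hCφ := hC φ hφ
    set A := ∫ x, ‖φ x‖ ^ 2 ∂(edgeMeasure θmax h)
    set B := ∫ x, ‖φ x‖ ^ 2 ∂(edgeMeasure θmin h)
    have h5 : s * (A + B) ≤ 4 * scalarH1Sq (sectorDisk θmin θmax h) φ +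
        2 * ∫ x, ‖φ x‖ ^ 2 ∂(arcMeasure θmin θmax h) := by
      have h6 := norm_sub_norm_le (((s * A : ℝ) : ℂ) + ((s * B : ℝ) : ℂ))
        (-(∫ x, ∑ j, (((h⁻¹ • x : Plane) j : ℝ) : ℂ) *
        (φ x * (starRingEnd ℂ) (φ x) * ((-(unitDir m j) : ℝ) : ℂ)) ∂(arcMeasure θmin θmax h)))
      rw [norm_neg, sub_neg_eq_add, ← Complex.ofReal_add, Complex.norm_real] at h6
      rw [← Complex.ofReal_add] at hle
      have h7 := le_abs_self (s * A + s * B)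
      rw [Real.norm_eq_abs] at h6
      linarith
    calc A + B = s⁻¹ * (s * (A + B)) := by rw [inv_mul_cancel_left₀ hspos.ne']
      _ ≤ s⁻¹ * ((4 + 2 * C) * scalarH1Sq (sectorDisk θmin θmax h) φ) := by
        refine mul_le_mul_of_nonneg_left ?_ (inv_nonneg.2 hspos.le)
        linarith
      _ = _ := by ring
  constructor
  · refine ⟨s⁻¹ * (4 + 2 * C), by positivity, fun φ hφ => ?_⟩
    have h1 := main φ hφ
    have h2 : 0 ≤ ∫ x, ‖φ x‖ ^ 2 ∂(edgeMeasure θmin h) := integral_nonneg fun x => by positivity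
    linarith
  · refine ⟨s⁻¹ * (4 + 2 * C), by positivity, fun φ hφ => ?_⟩
    have h1 := main φ hφ
    have h2 : 0 ≤ ∫ x, ‖φ x‖ ^ 2 ∂(edgeMeasure θmax h) := integral_nonneg fun x => by positivity
    linarith

/-- The trace inequality in terms of `L²` norms. -/
lemma TraceBounded.eLpNorm_le {U : Set Plane} {σ : Measure Plane} (hT : TraceBounded U σ)
    (hU : IsBallMeasure h (volume.restrict U)) (hσ : IsBallMeasure h σ) :
    ∃ C : ℝ≥0, ∀ φ : Plane → ℂ, ContDiff ℝ 1 φ →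
      eLpNorm φ 2 σ ≤ C * (eLpNorm φ 2 (volume.restrict U)
        + ∑ j, eLpNorm (pderiv j φ) 2 (volume.restrict U)) := by
  obtain ⟨C, hC0, hC⟩ := hT
  refine ⟨(Real.sqrt C).toNNReal, fun φ hφ => ?_⟩
  have hp := fun j => continuous_pderiv hφ j
  have m1 := hσ.memLp hφ.continuous 2
  have m2 := hU.memLp hφ.continuous 2
  have m3 := fun j => hU.memLp (hp j) 2
  rw [eLpNorm_two_eq m1, eLpNorm_two_eq m2]
  simp_rw [fun j => eLpNorm_two_eq (m3 j)]
  rw [Fin.sum_univ_two, ← ENNReal.ofReal_add (by positivity) (by positivity),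
    ← ENNReal.ofReal_add (by positivity) (by positivity)]
  change _ ≤ ENNReal.ofReal (Real.sqrt C) * _
  rw [← ENNReal.ofReal_mul (by positivity)]
  refine ENNReal.ofReal_le_ofReal ?_
  have e : scalarH1Sq U φ = (∫ x in U, ‖φ x‖ ^ 2) + ((∫ x in U, ‖pderiv 0 φ x‖ ^ 2) +
      ∫ x in U, ‖pderiv 1 φ x‖ ^ 2) := by
    unfold scalarH1Sq
    simp_rw [Fin.sum_univ_two]
    have hi : Integrable (fun x => ‖pderiv 0 φ x‖ ^ 2 + ‖pderiv 1 φ x‖ ^ 2)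
        (volume.restrict U) := (integrable_sq (m3 0)).add (integrable_sq (m3 1))
    rw [integral_add (integrable_sq m2) hi,
      integral_add (integrable_sq (m3 0)) (integrable_sq (m3 1))]
  have sub : ∀ a b : ℝ, 0 ≤ a → 0 ≤ b → Real.sqrt (a + b) ≤ Real.sqrt a + Real.sqrt b := by
    intro a b ha hb
    rw [Real.sqrt_le_left (by positivity)]
    nlinarith [Real.sq_sqrt ha, Real.sq_sqrt hb,
      mul_nonneg (Real.sqrt_nonneg a) (Real.sqrt_nonneg b)]
  have n0 : ∀ f : Plane → ℂ, 0 ≤ ∫ x in U, ‖f x‖ ^ 2 := fun f =>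
    integral_nonneg fun x => by positivity
  refine (Real.sqrt_le_sqrt (hC φ hφ)).trans ?_
  rw [Real.sqrt_mul hC0, e]
  gcongr
  refine (sub _ _ (n0 _) (add_nonneg (n0 _) (n0 _))).trans ?_
  gcongr
  exact sub _ _ (n0 _) (n0 _)


/-! ### Traces and Green's formula for `H¹` functions -/

/-- The smooth functions `φ n` converge in `H¹(U)` to `u`, the partial derivatives of `u`
being `G`. -/
structure IsH1Limit (U : Set Plane) (u : Plane → ℂ) (G : Fin 2 → Plane → ℂ)
    (φ : ℕ → Plane → ℂ) : Prop where
  smooth : ∀ n, ContDiff ℝ 1 (φ n)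
  lim : Tendsto (fun n => eLpNorm (fun x => φ n x - u x) 2 (volume.restrict U)) atTop (𝓝 0)
  lim_grad : ∀ j, Tendsto (fun n => eLpNorm (fun x => pderiv j (φ n) x - G j x) 2
    (volume.restrict U)) atTop (𝓝 0)

lemma eLpNorm_sub_le_add {α : Type*} [MeasurableSpace α] {μ : Measure α} {f g k : α → ℂ}
    (hf : AEStronglyMeasurable f μ) (hg : AEStronglyMeasurable g μ)
    (hk : AEStronglyMeasurable k μ) :
    eLpNorm (fun x => f x - g x) 2 μ ≤
      eLpNorm (fun x => f x - k x) 2 μ + eLpNorm (fun x => g x - k x) 2 μ := by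
  have h1 := eLpNorm_sub_le (hf.sub hk) (hg.sub hk) (p := 2) (by norm_num)
  refine le_trans (le_of_eq ?_) h1
  congr 1
  funext x
  simp

/-- Used twice: with one sequence taken twice it gives the Cauchy property, hence existence of the
trace; on the diagonal of two sequences it gives independence of the approximation. -/
lemma tendsto_trace_sub {U : Set Plane} {σ : Measure Plane} (hT : TraceBounded U σ)
    (hU : IsBallMeasure h (volume.restrict U)) (hσ : IsBallMeasure h σ)
    {u : Plane → ℂ} {G : Fin 2 → Plane → ℂ} {φ ψ : ℕ → Plane → ℂ}
    (hu : AEStronglyMeasurable u (volume.restrict U))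
    (hG : ∀ j, AEStronglyMeasurable (G j) (volume.restrict U))
    (hφ : IsH1Limit U u G φ) (hψ : IsH1Limit U u G ψ) :
    Tendsto (fun p : ℕ × ℕ => eLpNorm (fun x => φ p.1 x - ψ p.2 x) 2 σ) atTop (𝓝 0) := by
  obtain ⟨C, hC⟩ := hT.eLpNorm_le hU hσ
  have hfst : Tendsto (Prod.fst : ℕ × ℕ → ℕ) atTop atTop := by
    rw [← prod_atTop_atTop_eq]; exact tendsto_fst
  have hsnd : Tendsto (Prod.snd : ℕ × ℕ → ℕ) atTop atTop := by
    rw [← prod_atTop_atTop_eq]; exact tendsto_snd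
  have l0 := (hφ.lim.comp hfst).add (hψ.lim.comp hsnd)
  have l1 := fun j => ((hφ.lim_grad j).comp hfst).add ((hψ.lim_grad j).comp hsnd)
  have l2 := ENNReal.Tendsto.const_mul (a := (C : ENNReal))
    (l0.add (tendsto_finsetSum Finset.univ fun j _ => l1 j)) (Or.inr ENNReal.coe_ne_top)
  simp only [add_zero, Finset.sum_const_zero, mul_zero] at l2
  refine tendsto_of_tendsto_of_tendsto_of_le_of_le tendsto_const_nhds l2 (fun _ => zero_le)
    fun p => ?_
  refine (hC _ ((hφ.smooth p.1).sub (hψ.smooth p.2))).trans ?_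
  have e : ∀ j, pderiv j (fun x => φ p.1 x - ψ p.2 x) =
      fun x => pderiv j (φ p.1) x - pderiv j (ψ p.2) x := fun j => funext fun x =>
    pderiv_sub j ((hφ.smooth p.1).differentiable one_ne_zero x)
      ((hψ.smooth p.2).differentiable one_ne_zero x)
  simp_rw [e]
  dsimp only [Function.comp]
  gcongr with j
  · exact eLpNorm_sub_le_add (hφ.smooth _).continuous.aestronglyMeasurable
      (hψ.smooth _).continuous.aestronglyMeasurable hu
  · exact eLpNorm_sub_le_add (continuous_pderiv (hφ.smooth _) j).aestronglyMeasurable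
      (continuous_pderiv (hψ.smooth _) j).aestronglyMeasurable (hG j)

lemma exists_trace {U : Set Plane} {σ : Measure Plane} (hT : TraceBounded U σ)
    (hU : IsBallMeasure h (volume.restrict U)) (hσ : IsBallMeasure h σ)
    {u : Plane → ℂ} {G : Fin 2 → Plane → ℂ} {φ : ℕ → Plane → ℂ}
    (hu : AEStronglyMeasurable u (volume.restrict U))
    (hG : ∀ j, AEStronglyMeasurable (G j) (volume.restrict U)) (hφ : IsH1Limit U u G φ) :
    ∃ t : Plane → ℂ, MemLp t 2 σ ∧
      Tendsto (fun n => eLpNorm (fun x => φ n x - t x) 2 σ) atTop (𝓝 0) :=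
  exists_tendsto_of_cauchy (fun n => hσ.memLp (hφ.smooth n).continuous 2)
    (tendsto_trace_sub hT hU hσ hu hG hφ hφ)

/-- The trace does not depend on the approximating sequence. -/
lemma tendsto_trace_of_tendsto {U : Set Plane} {σ : Measure Plane} (hT : TraceBounded U σ)
    (hU : IsBallMeasure h (volume.restrict U)) (hσ : IsBallMeasure h σ)
    {u : Plane → ℂ} {G : Fin 2 → Plane → ℂ} {φ ψ : ℕ → Plane → ℂ} {f : Plane → ℂ}
    (hu : AEStronglyMeasurable u (volume.restrict U))
    (hG : ∀ j, AEStronglyMeasurable (G j) (volume.restrict U))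
    (hφ : IsH1Limit U u G φ) (hψ : IsH1Limit U u G ψ) (hf : AEStronglyMeasurable f σ)
    (hlim : Tendsto (fun n => eLpNorm (fun x => ψ n x - f x) 2 σ) atTop (𝓝 0)) :
    Tendsto (fun n => eLpNorm (fun x => φ n x - f x) 2 σ) atTop (𝓝 0) := by
  have hdiag : Tendsto (fun n : ℕ => ((n, n) : ℕ × ℕ)) atTop atTop := tendsto_atTop_diagonal
  have l := ((tendsto_trace_sub hT hU hσ hu hG hφ hψ).comp hdiag).add hlim
  rw [add_zero] at l
  refine tendsto_of_tendsto_of_tendsto_of_le_of_le tendsto_const_nhds l (fun _ => zero_le)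
    fun n => ?_
  have m1 := (hφ.smooth n).continuous.aestronglyMeasurable (μ := σ)
  have m2 := (hψ.smooth n).continuous.aestronglyMeasurable (μ := σ)
  have h1 := eLpNorm_add_le (m1.sub m2) (m2.sub hf) (p := 2) (by norm_num)
  refine le_trans (le_of_eq ?_) h1
  congr 1
  funext x
  simp

/-- Green's formula on the truncated sector for a function `u` with partial derivatives `G` and
traces `f₁`, `f₂`, `t` on the two edges and on the arc. -/
def GreenFormula (θmin θmax h : ℝ) (u : Plane → ℂ) (G : Fin 2 → Plane → ℂ)
    (f₁ f₂ t : Plane → ℂ) : Prop :=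
  ∀ F : Fin 2 → Plane → ℂ, (∀ j, ContDiff ℝ 1 (F j)) →
    (∫ x in sectorDisk θmin θmax h, ∑ j, F j x * G j x) +
      ∫ x in sectorDisk θmin θmax h, (∑ j, pderiv j (F j) x) * u x =
    (∫ x, (∑ j, (normalMax θmax j : ℂ) * F j x) * f₁ x ∂(edgeMeasure θmax h))
      + (∫ x, (∑ j, (normalMin θmin j : ℂ) * F j x) * f₂ x ∂(edgeMeasure θmin h))
      + ∫ x, (∑ j, (((h⁻¹ • x : Plane) j : ℝ) : ℂ) * F j x) * t x ∂(arcMeasure θmin θmax h)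

lemma greenFormula_of_contDiff (H : IsConvexSector θmin θmax h) {φ : Plane → ℂ}
    (hφ : ContDiff ℝ 1 φ) : GreenFormula θmin θmax h φ (fun j => pderiv j φ) φ φ φ := by
  intro F hF
  have hdiv := integral_divergence_sectorDisk H fun j => (hF j).mul hφ
  have hB := isBallMeasure_sectorDisk H
  have c1 := hφ.continuous
  have c2 := fun j => continuous_pderiv hφ j
  have c3 := fun j => (hF j).continuous
  have c4 := fun j => continuous_pderiv (hF j) j
  rw [← integral_add (hB.integrable (by fun_prop)) (hB.integrable (by fun_prop))]
  refine Eq.trans ?_ (hdiv.trans ?_)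
  · congr 1 with x
    rw [Finset.sum_mul, ← Finset.sum_add_distrib]
    refine Finset.sum_congr rfl fun j _ => ?_
    rw [pderiv_mul j ((hF j).differentiable one_ne_zero x) (hφ.differentiable one_ne_zero x)]
  · simp_rw [Finset.sum_mul, mul_assoc]

/-- Green's formula passes to limits in `H¹`. -/
theorem IsH1Limit.greenFormula (H : IsConvexSector θmin θmax h) {u : Plane → ℂ}
    {G : Fin 2 → Plane → ℂ} {φ : ℕ → Plane → ℂ} {f₁ f₂ t : Plane → ℂ}
    (hφ : IsH1Limit (sectorDisk θmin θmax h) u G φ)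
    (hu : MemLp u 2 (volume.restrict (sectorDisk θmin θmax h)))
    (hG : ∀ j, MemLp (G j) 2 (volume.restrict (sectorDisk θmin θmax h)))
    (hf₁ : MemLp f₁ 2 (edgeMeasure θmax h)) (hf₂ : MemLp f₂ 2 (edgeMeasure θmin h))
    (ht : MemLp t 2 (arcMeasure θmin θmax h))
    (l₁ : Tendsto (fun n => eLpNorm (fun x => φ n x - f₁ x) 2 (edgeMeasure θmax h)) atTop (𝓝 0))
    (l₂ : Tendsto (fun n => eLpNorm (fun x => φ n x - f₂ x) 2 (edgeMeasure θmin h)) atTop (𝓝 0))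
    (l₃ : Tendsto (fun n => eLpNorm (fun x => φ n x - t x) 2 (arcMeasure θmin θmax h))
      atTop (𝓝 0)) :
    GreenFormula θmin θmax h u G f₁ f₂ t := by
  intro F hF
  have hB := isBallMeasure_sectorDisk H
  have hE₁ := isBallMeasure_edge θmax h
  have hE₂ := isBallMeasure_edge θmin h
  have hA := isBallMeasure_arc H
  have c1 := fun n => (hφ.smooth n).continuous
  have c2 := fun n j => continuous_pderiv (hφ.smooth n) j
  have c3 := fun j => (hF j).continuous
  have c4 := fun j => continuous_pderiv (hF j) j
  have c5 : Continuous fun x => ∑ j, pderiv j (F j) x := by fun_prop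
  have c6 : ∀ c : Fin 2 → ℂ, Continuous fun x => ∑ j, c j * F j x := fun c => by fun_prop
  have c7 : Continuous fun x : Plane => ∑ j, (((h⁻¹ • x : Plane) j : ℝ) : ℂ) * F j x := by
    refine continuous_finsetSum _ fun j _ => Continuous.mul ?_ (c3 j)
    exact (contDiff_coord (n := 0) j).continuous.comp (continuous_const_smul h⁻¹)
  have g := fun n => greenFormula_of_contDiff H (hφ.smooth n) F hF
  have t1 : Tendsto (fun n => ∫ x in sectorDisk θmin θmax h, ∑ j, F j x * pderiv j (φ n) x) atTop
      (𝓝 (∫ x in sectorDisk θmin θmax h, ∑ j, F j x * G j x)) := by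
    have e1 : ∀ n, ∫ x in sectorDisk θmin θmax h, ∑ j, F j x * pderiv j (φ n) x =
        ∑ j, ∫ x in sectorDisk θmin θmax h, F j x * pderiv j (φ n) x := fun n =>
      integral_finsetSum _ fun j _ => integrable_mul_of_memLp (hB.memLp (c3 j) 2)
        (hB.memLp (c2 n j) 2)
    have e2 : ∫ x in sectorDisk θmin θmax h, ∑ j, F j x * G j x =
        ∑ j, ∫ x in sectorDisk θmin θmax h, F j x * G j x :=
      integral_finsetSum _ fun j _ => integrable_mul_of_memLp (hB.memLp (c3 j) 2) (hG j)
    simp_rw [e1]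
    rw [e2]
    exact tendsto_finsetSum _ fun j _ => tendsto_integral_mul (hB.memLp (c3 j) 2) (hG j)
      (fun n => hB.memLp (c2 n j) 2) (hφ.lim_grad j)
  have t2 := tendsto_integral_mul (hB.memLp c5 2) hu (fun n => hB.memLp (c1 n) 2) hφ.lim
  have t3 := tendsto_integral_mul (hE₁.memLp (c6 fun j => (normalMax θmax j : ℂ)) 2) hf₁
    (fun n => hE₁.memLp (c1 n) 2) l₁
  have t4 := tendsto_integral_mul (hE₂.memLp (c6 fun j => (normalMin θmin j : ℂ)) 2) hf₂
    (fun n => hE₂.memLp (c1 n) 2) l₂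
  have t5 := tendsto_integral_mul (hA.memLp c7 2) ht (fun n => hA.memLp (c1 n) 2) l₃
  have L := t1.add t2
  have R := (t3.add t4).add t5
  exact tendsto_nhds_unique (L.congr g) R

/-! ### Weak gradients -/

lemma HasL2Partial.memLp_weakPartial {U : Set Plane} {j : Fin 2} {u : Plane → ℂ}
    (hu : HasL2Partial U j u) : MemLp (weakPartial U j u) 2 (volume.restrict U) := by
  unfold weakPartial; rw [dif_pos hu]; exact hu.choose_spec.1

lemma HasL2Partial.hasWeakPartial {U : Set Plane} {j : Fin 2} {u : Plane → ℂ}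
    (hu : HasL2Partial U j u) : HasWeakPartial U j u (weakPartial U j u) := by
  unfold weakPartial; rw [dif_pos hu]; exact hu.choose_spec.2

lemma MemH1.memLp {U : Set Plane} {u : Plane → CVec} (hu : MemH1 U u) (i : Fin 2) :
    MemLp (fun x => u x i) 2 (volume.restrict U) := (hu i).1

lemma MemH1.memLp_weakGrad {U : Set Plane} {u : Plane → CVec} (hu : MemH1 U u) (i j : Fin 2) :
    MemLp (fun x => weakGrad U u x i j) 2 (volume.restrict U) :=
  ((hu i).2 j).memLp_weakPartial

lemma memLp_and_memLp_pderiv {U : Set Plane} (hU : IsBallMeasure h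
    (volume.restrict U)) {φ : Plane → ℂ} (hφ : ContDiff ℝ ∞ φ) (j : Fin 2) :
    MemLp φ 2 (volume.restrict U) ∧ MemLp (pderiv j φ) 2 (volume.restrict U) :=
  ⟨hU.memLp hφ.continuous 2, hU.memLp (continuous_pderiv (hφ.of_le (by norm_num)) j) 2⟩

/-- Weak partial derivatives are unique up to null sets. -/
lemma HasWeakPartial.ae_eq {U : Set Plane} (hU : IsOpen U)
    (hB : IsBallMeasure h (volume.restrict U)) {j : Fin 2} {u g g' : Plane → ℂ}
    (hg : MemLp g 2 (volume.restrict U)) (hg' : MemLp g' 2 (volume.restrict U))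
    (H : HasWeakPartial U j u g) (H' : HasWeakPartial U j u g') :
    g =ᵐ[volume.restrict U] g' := by
  have := hB.finite
  have hi : IntegrableOn (fun x => g x - g' x) U volume := (hg.sub hg').integrable one_le_two
  have key := hU.ae_eq_zero_of_integral_contDiff_smul_eq_zero hi.locallyIntegrableOn
    (fun ψ hψ hc hs => ?_)
  · refine (ae_restrict_iff' hU.measurableSet).2 (key.mono fun x hx hxU => ?_)
    exact sub_eq_zero.1 (hx hxU)
  · set φ : Plane → ℂ := fun x => (ψ x : ℂ) with hφ
    have hφs : ContDiff ℝ ∞ φ := Complex.ofRealCLM.contDiff.comp hψ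
    have hφc : HasCompactSupport φ := hc.comp_left (g := ((↑) : ℝ → ℂ)) rfl
    have hsub : tsupport φ ⊆ tsupport ψ :=
      closure_mono fun x hx hx' => hx (by simp [hφ, hx'])
    have e1 := H φ hφs hφc (hsub.trans hs)
    have e2 := H' φ hφs hφc (hsub.trans hs)
    have hm := hB.memLp hφs.continuous 2
    have e3 : ∫ x in U, (g x - g' x) * φ x = 0 := by
      simp_rw [sub_mul]
      rw [integral_sub (integrable_mul_of_memLp hg hm) (integrable_mul_of_memLp hg' hm)]
      rw [e1] at e2
      linear_combination -e2
    rw [← setIntegral_eq_integral_of_forall_compl_eq_zero (s := U), ← e3]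
    · congr 1 with x
      rw [Complex.real_smul, mul_comm]
    · intro x hx
      have : ψ x = 0 := image_eq_zero_of_notMem_tsupport fun hx' => hx (hs hx')
      rw [this, zero_smul]

lemma HasWeakPartial.sub {U : Set Plane} (hB : IsBallMeasure h (volume.restrict U)) {j : Fin 2}
    {u u' g g' : Plane → ℂ} (hu : MemLp u 2 (volume.restrict U))
    (hu' : MemLp u' 2 (volume.restrict U)) (hg : MemLp g 2 (volume.restrict U))
    (hg' : MemLp g' 2 (volume.restrict U)) (H : HasWeakPartial U j u g)
    (H' : HasWeakPartial U j u' g') :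
    HasWeakPartial U j (fun x => u x - u' x) (fun x => g x - g' x) := by
  intro φ hφ hc hs
  obtain ⟨m1, m2⟩ := memLp_and_memLp_pderiv hB hφ j
  simp_rw [sub_mul]
  rw [integral_sub (integrable_mul_of_memLp hu m2) (integrable_mul_of_memLp hu' m2),
    integral_sub (integrable_mul_of_memLp hg m1) (integrable_mul_of_memLp hg' m1),
    H φ hφ hc hs, H' φ hφ hc hs]
  ring

lemma MemH1.sub {U : Set Plane} (hB : IsBallMeasure h (volume.restrict U)) {u u' : Plane → CVec}
    (hu : MemH1 U u) (hu' : MemH1 U u') : MemH1 U fun x => u x - u' x := fun i =>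
  ⟨(hu i).1.sub (hu' i).1, fun j => ⟨_,
    ((hu i).2 j).memLp_weakPartial.sub ((hu' i).2 j).memLp_weakPartial,
    HasWeakPartial.sub hB (hu i).1 (hu' i).1 ((hu i).2 j).memLp_weakPartial
      ((hu' i).2 j).memLp_weakPartial ((hu i).2 j).hasWeakPartial ((hu' i).2 j).hasWeakPartial⟩⟩

/-- A weak derivative is a chosen representative, so linearity holds only almost everywhere, by
uniqueness. -/
lemma weakGrad_sub_ae_eq {U : Set Plane} (hU : IsOpen U)
    (hB : IsBallMeasure h (volume.restrict U)) {u u' : Plane → CVec}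
    (hu : MemH1 U u) (hu' : MemH1 U u') :
    weakGrad U (fun x => u x - u' x) =ᵐ[volume.restrict U]
      fun x => weakGrad U u x - weakGrad U u' x := by
  have key : ∀ i j, weakPartial U j (fun y => u y i - u' y i) =ᵐ[volume.restrict U]
      fun x => weakPartial U j (fun y => u y i) x - weakPartial U j (fun y => u' y i) x := by
    intro i j
    exact HasWeakPartial.ae_eq hU hB (((MemH1.sub hB hu hu') i).2 j).memLp_weakPartial
      (((hu i).2 j).memLp_weakPartial.sub ((hu' i).2 j).memLp_weakPartial)
      (((MemH1.sub hB hu hu') i).2 j).hasWeakPartial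
      (HasWeakPartial.sub hB (hu i).1 (hu' i).1 ((hu i).2 j).memLp_weakPartial
      ((hu' i).2 j).memLp_weakPartial ((hu i).2 j).hasWeakPartial ((hu' i).2 j).hasWeakPartial)
  have k2 : ∀ᵐ x ∂(volume.restrict U), ∀ i j, weakPartial U j (fun y => u y i - u' y i) x =
      weakPartial U j (fun y => u y i) x - weakPartial U j (fun y => u' y i) x :=
    ae_all_iff.2 fun i => ae_all_iff.2 fun j => key i j
  filter_upwards [k2] with x hx
  ext i j
  exact hx i j


lemma IsTrace.exists_isH1Limit {U : Set Plane} {σ : Measure Plane} {u f : Plane → CVec}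
    (hT : IsTrace U σ u f) : ∃ φ : ℕ → Plane → CVec, (∀ n, ContDiff ℝ ∞ (φ n)) ∧
      (∀ i, IsH1Limit U (fun x => u x i) (fun j x => weakGrad U u x i j) fun n x => φ n x i) ∧
      ∀ i, Tendsto (fun n => eLpNorm (fun x => φ n x i - f x i) 2 σ) atTop (𝓝 0) := by
  obtain ⟨φ, h1, h2, h3, h4⟩ := hT
  exact ⟨φ, h1, fun i => ⟨fun n => (contDiff_component (h1 n) i).of_le (by norm_num), h2 i,
    fun j => h3 i j⟩, h4⟩

lemma aestronglyMeasurable_edge {θ : ℝ} {f : Plane → CVec}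
    (hf : ContinuousOn (alongEdge θ f) (Ico 0 h)) (i : Fin 2) :
    AEStronglyMeasurable (fun x => f x i) (edgeMeasure θ h) := by
  rw [edgeMeasure, (measurableEmbedding_smul_unitDir θ).aestronglyMeasurable_map_iff]
  have h1 : ContinuousOn (fun r => alongEdge θ f r i) (Ioo 0 h) :=
    (continuousOn_pi.1 (hf.mono Ioo_subset_Ico_self)) i
  exact h1.aestronglyMeasurable measurableSet_Ioo

/-- Existence of the trace on the arc, and Green's formula, for an `H¹` field with given traces
on the two edges. -/
theorem exists_trace_greenFormula (H : IsConvexSector θmin θmax h) {u f₁ f₂ : Plane → CVec}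
    (hu : MemH1 (sectorDisk θmin θmax h) u)
    (hf₁ : ∀ i, AEStronglyMeasurable (fun x => f₁ x i) (edgeMeasure θmax h))
    (hf₂ : ∀ i, AEStronglyMeasurable (fun x => f₂ x i) (edgeMeasure θmin h))
    (T₁ : IsTrace (sectorDisk θmin θmax h) (edgeMeasure θmax h) u f₁)
    (T₂ : IsTrace (sectorDisk θmin θmax h) (edgeMeasure θmin h) u f₂) :
    ∃ t : Plane → CVec, IsTrace (sectorDisk θmin θmax h) (arcMeasure θmin θmax h) u t ∧
      (∀ i, MemLp (fun x => f₁ x i) 2 (edgeMeasure θmax h)) ∧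
      (∀ i, MemLp (fun x => f₂ x i) 2 (edgeMeasure θmin h)) ∧
      (∀ i, MemLp (fun x => t x i) 2 (arcMeasure θmin θmax h)) ∧
      ∀ i, GreenFormula θmin θmax h (fun x => u x i)
        (fun j x => weakGrad (sectorDisk θmin θmax h) u x i j) (fun x => f₁ x i)
        (fun x => f₂ x i) fun x => t x i := by
  obtain ⟨φ, hφs, hφ, hφ₁⟩ := T₁.exists_isH1Limit
  obtain ⟨ψ, hψs, hψ, hψ₂⟩ := T₂.exists_isH1Limit
  have hB := isBallMeasure_sectorDisk H
  have hE₁ := isBallMeasure_edge θmax h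
  have hE₂ := isBallMeasure_edge θmin h
  have hA := isBallMeasure_arc H
  have hum := fun i => (hu.memLp i).1
  have hGm := fun i j => (hu.memLp_weakGrad i j).1
  choose t ht1 ht2 using fun i => exists_trace (traceBounded_arc H) hB hA (hum i) (hGm i) (hφ i)
  -- The two edge traces come with different approximating sequences, while the limit in Green's
  -- formula needs one sequence converging on all three boundary pieces. Independence of the
  -- approximation lets `φ` serve for all of them.
  have hφ₂ := fun i => tendsto_trace_of_tendsto (traceBounded_edges H).2 hB hE₂ (hum i) (hGm i)
    (hφ i) (hψ i) (hf₂ i) (hψ₂ i)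
  have m₁ := fun i => memLp_of_tendsto (hf₁ i)
    (fun n => hE₁.memLp ((hφ i).smooth n).continuous 2) (hφ₁ i)
  have m₂ := fun i => memLp_of_tendsto (hf₂ i)
    (fun n => hE₂.memLp ((hφ i).smooth n).continuous 2) (hφ₂ i)
  exact ⟨fun x i => t i x, ⟨φ, hφs, fun i => (hφ i).lim, fun i j => (hφ i).lim_grad j, ht2⟩,
    m₁, m₂, ht1, fun i => (hφ i).greenFormula H (hu.memLp i) (hu.memLp_weakGrad i) (m₁ i) (m₂ i)
      (ht1 i) (hφ₁ i) (hφ₂ i) (ht2 i)⟩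

/-- The edge data are those of `w - v`, whereas the arc term is written for `v - w`; the two chosen
weak gradients are opposite only almost everywhere. -/
lemma IsTrace.neg_sub {U : Set Plane} (hU : IsOpen U) (hB : IsBallMeasure h (volume.restrict U))
    {σ : Measure Plane} {v w t : Plane → CVec} (hv : MemH1 U v) (hw : MemH1 U w)
    (hT : IsTrace U σ (fun x => w x - v x) t) :
    IsTrace U σ (fun x => v x - w x) fun x => -t x := by
  obtain ⟨φ, h1, h2, h3, h4⟩ := hT
  have neg : ∀ {μ : Measure Plane} (f g f' g' : Plane → ℂ),
      (∀ᵐ x ∂μ, f' x - g' x = -(f x - g x)) →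
      eLpNorm (fun x => f' x - g' x) 2 μ = eLpNorm (fun x => f x - g x) 2 μ := by
    intro μ f g f' g' hfg
    rw [← eLpNorm_neg]
    refine eLpNorm_congr_ae (hfg.mono fun x hx => ?_)
    rw [Pi.neg_apply, hx, neg_neg]
  refine ⟨fun n x => -φ n x, fun n => (h1 n).neg, fun i => (h2 i).congr fun n => (neg _ _ _ _ ?_).symm,
    fun i j => (h3 i j).congr fun n => (neg _ _ _ _ ?_).symm,
    fun i => (h4 i).congr fun n => (neg _ _ _ _ ?_).symm⟩
  · refine Eventually.of_forall fun x => ?_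
    simp only [Pi.neg_apply, Pi.sub_apply]; ring
  · filter_upwards [weakGrad_sub_ae_eq hU hB hv hw, weakGrad_sub_ae_eq hU hB hw hv] with x e1 e2
    rw [e1, e2]
    have : fieldGrad (fun x => -φ n x) x i j = -fieldGrad (φ n) x i j :=
      pderiv_neg (fun y => φ n y i) j x
    rw [this]
    simp only [Matrix.sub_apply]; ring
  · refine Eventually.of_forall fun x => ?_
    simp only [Pi.neg_apply]; ring

/-! ### The bilinear form of the Lamé operator -/

lemma stress_apply (lam mu : ℝ) (G : Matrix (Fin 2) (Fin 2) ℂ) (i j : Fin 2) :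
    stress lam mu G i j = lam * (G 0 0 + G 1 1) * (if i = j then 1 else 0)
      + mu * (G i j + G j i) := by
  simp [stress, Matrix.trace_fin_two, Matrix.one_apply, mul_add]

lemma stress_sub (lam mu : ℝ) (A B : Matrix (Fin 2) (Fin 2) ℂ) :
    stress lam mu (A - B) = stress lam mu A - stress lam mu B := by
  ext i j; simp only [stress_apply, Matrix.sub_apply]; ring

/-- The symmetry of the elasticity tensor. It lets the stress be moved from `u` to the test field,
which is what makes reciprocity possible. -/
lemma stress_symm (lam mu : ℝ) (A B : Matrix (Fin 2) (Fin 2) ℂ) :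
    ∑ i, ∑ j, stress lam mu A i j * B i j = ∑ i, ∑ j, stress lam mu B i j * A i j := by
  simp [stress_apply, Fin.sum_univ_two]; ring

section LameForm

variable {lam mu om : ℝ} {U : Set Plane}

lemma MemH1.memLp_stress {u : Plane → CVec} (hu : MemH1 U u) (i j : Fin 2) :
    MemLp (fun x => stress lam mu (weakGrad U u x) i j) 2 (volume.restrict U) := by
  simp_rw [stress_apply]
  exact ((((hu.memLp_weakGrad 0 0).add (hu.memLp_weakGrad 1 1)).const_mul _).mul_const _).add
    (((hu.memLp_weakGrad i j).add (hu.memLp_weakGrad j i)).const_mul _)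

lemma continuous_fieldGrad {φ : Plane → CVec} (hφ : ContDiff ℝ 1 φ) (i j : Fin 2) :
    Continuous fun x => fieldGrad φ x i j := continuous_pderiv (contDiff_component hφ i) j

lemma integrable_stress_mul (hB : IsBallMeasure h (volume.restrict U)) {u φ : Plane → CVec}
    (hu : MemH1 U u) (hφ : ContDiff ℝ 1 φ) (i j : Fin 2) :
    IntegrableOn (fun x => stress lam mu (weakGrad U u x) i j * fieldGrad φ x i j) U :=
  integrable_mul_of_memLp (hu.memLp_stress i j) (hB.memLp (continuous_fieldGrad hφ i j) 2)

lemma integrable_mul_field (hB : IsBallMeasure h (volume.restrict U)) {u φ : Plane → CVec}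
    (hu : MemH1 U u) (hφ : ContDiff ℝ 1 φ) (i : Fin 2) :
    IntegrableOn (fun x => u x i * φ x i) U :=
  integrable_mul_of_memLp (hu.memLp i) (hB.memLp (contDiff_component hφ i).continuous 2)

lemma lameForm_eq_sum (hB : IsBallMeasure h (volume.restrict U)) {u φ : Plane → CVec}
    (hu : MemH1 U u) (hφ : ContDiff ℝ 1 φ) :
    lameForm lam mu om U u φ =
      (∑ i, ∑ j, ∫ x in U, stress lam mu (weakGrad U u x) i j * fieldGrad φ x i j)
        - (om : ℂ) ^ 2 * ∑ i, ∫ x in U, u x i * φ x i := by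
  have i1 := integrable_stress_mul (lam := lam) (mu := mu) hB hu hφ
  have i2 := integrable_mul_field hB hu hφ
  unfold lameForm
  simp only [dotProduct]
  rw [integral_sub (integrable_finsetSum _ fun i _ => integrable_finsetSum _ fun j _ => i1 i j)
    ((integrable_finsetSum _ fun i _ => i2 i).const_mul _),
    integral_finsetSum _ fun i _ => integrable_finsetSum _ fun j _ => i1 i j,
    integral_const_mul, integral_finsetSum _ fun i _ => i2 i]
  congr 1
  exact Finset.sum_congr rfl fun i _ => integral_finsetSum _ fun j _ => i1 i j

lemma lameForm_sub (hU : IsOpen U) (hB : IsBallMeasure h (volume.restrict U))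
    {v w φ : Plane → CVec} (hv : MemH1 U v) (hw : MemH1 U w) (hφ : ContDiff ℝ 1 φ) :
    lameForm lam mu om U (fun x => w x - v x) φ =
      lameForm lam mu om U w φ - lameForm lam mu om U v φ := by
  have i1 := fun (u) (hu : MemH1 U u) => integrable_stress_mul (lam := lam) (mu := mu) hB hu hφ
  have i2 := fun (u) (hu : MemH1 U u) => integrable_mul_field hB hu hφ
  have i3 : ∀ u, MemH1 U u → IntegrableOn (fun x => (∑ i, ∑ j,
      stress lam mu (weakGrad U u x) i j * fieldGrad φ x i j) - (om : ℂ) ^ 2 * (u x ⬝ᵥ φ x)) U :=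
    fun u hu => (integrable_finsetSum _ fun i _ => integrable_finsetSum _ fun j _ =>
      i1 u hu i j).sub ((integrable_finsetSum _ fun i _ => i2 u hu i).const_mul _)
  unfold lameForm
  rw [← integral_sub (i3 w hw) (i3 v hv)]
  refine integral_congr_ae ?_
  filter_upwards [weakGrad_sub_ae_eq hU hB hw hv] with x hx
  rw [hx, stress_sub]
  simp only [Fin.sum_univ_two, Matrix.sub_apply, dotProduct, Pi.sub_apply]
  ring

lemma lameForm_add (hB : IsBallMeasure h (volume.restrict U)) {u φ ψ : Plane → CVec}
    (hu : MemH1 U u) (hφ : ContDiff ℝ 1 φ) (hψ : ContDiff ℝ 1 ψ) :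
    lameForm lam mu om U u (fun x => φ x + ψ x) =
      lameForm lam mu om U u φ + lameForm lam mu om U u ψ := by
  have e : ∀ x i j, fieldGrad (fun x => φ x + ψ x) x i j = fieldGrad φ x i j + fieldGrad ψ x i j :=
    fun x i j => pderiv_add j ((contDiff_component hφ i).differentiable one_ne_zero x)
      ((contDiff_component hψ i).differentiable one_ne_zero x)
  rw [lameForm_eq_sum hB hu hφ, lameForm_eq_sum hB hu hψ, lameForm_eq_sum hB hu (hφ.add hψ)]
  simp_rw [e, Pi.add_apply, mul_add]
  simp_rw [integral_add (integrable_stress_mul hB hu hφ _ _) (integrable_stress_mul hB hu hψ _ _),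
    integral_add (integrable_mul_field hB hu hφ _) (integrable_mul_field hB hu hψ _),
    Finset.sum_add_distrib]
  ring

lemma lameForm_smul (hB : IsBallMeasure h (volume.restrict U)) {u φ : Plane → CVec}
    (hu : MemH1 U u) (hφ : ContDiff ℝ 1 φ) (c : ℂ) :
    lameForm lam mu om U u (fun x => c • φ x) = c * lameForm lam mu om U u φ := by
  have e : ∀ x i j, fieldGrad (fun x => c • φ x) x i j = c * fieldGrad φ x i j :=
    fun x i j => pderiv_const_mul j c ((contDiff_component hφ i).differentiable one_ne_zero x)
  have hc : ContDiff ℝ 1 fun x => c • φ x := hφ.const_smul c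
  rw [lameForm_eq_sum hB hu hφ, lameForm_eq_sum hB hu hc]
  simp_rw [e, Pi.smul_apply, smul_eq_mul, mul_left_comm _ c, integral_const_mul, ← Finset.mul_sum]
  ring

lemma scalar_le_h1Norm (hB : IsBallMeasure h (volume.restrict U)) {φ : Plane → CVec}
    (hφ : ContDiff ℝ 1 φ) (i : Fin 2) : scalarH1Sq U (fun x => φ x i) ≤ h1Norm U φ ^ 2 := by
  have c0 := fun i => (contDiff_component hφ i).continuous
  have c1 := fun i j => continuous_fieldGrad hφ i j
  rw [h1Norm, Real.sq_sqrt (integral_nonneg fun x => by positivity), scalarH1Sq]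
  refine integral_mono (hB.integrable_real (continuous_h1Density (contDiff_component hφ i)))
    (hB.integrable_real (by fun_prop)) fun x => ?_
  refine add_le_add (Finset.single_le_sum (f := fun i => ‖φ x i‖ ^ 2)
    (fun i _ => by positivity) (Finset.mem_univ i)) ?_
  exact Finset.single_le_sum (f := fun i => ∑ j, ‖fieldGrad φ x i j‖ ^ 2)
    (fun i _ => by positivity) (Finset.mem_univ i)

lemma sqrt_le_h1Norm (hB : IsBallMeasure h (volume.restrict U)) {φ : Plane → CVec}
    (hφ : ContDiff ℝ 1 φ) (i : Fin 2) :
    Real.sqrt (∫ x in U, ‖φ x i‖ ^ 2) ≤ h1Norm U φ ∧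
      ∀ j, Real.sqrt (∫ x in U, ‖fieldGrad φ x i j‖ ^ 2) ≤ h1Norm U φ := by
  have c0 := (contDiff_component hφ i).continuous
  have c1 := fun j => continuous_fieldGrad hφ i j
  have hd := hB.integrable_real (continuous_h1Density (contDiff_component hφ i))
  have hn : 0 ≤ h1Norm U φ := Real.sqrt_nonneg _
  have hs := scalar_le_h1Norm hB hφ i
  constructor
  · rw [Real.sqrt_le_left hn]
    refine le_trans (integral_mono (hB.integrable_real (by fun_prop)) hd fun x => ?_) hs
    exact le_add_of_nonneg_right (by positivity)
  · intro j
    rw [Real.sqrt_le_left hn]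
    have c1j := c1 j
    refine le_trans (integral_mono (hB.integrable_real (by fun_prop)) hd fun x => ?_) hs
    refine le_add_of_nonneg_of_le (by positivity) ?_
    exact Finset.single_le_sum (f := fun j => ‖pderiv j (fun y => φ y i) x‖ ^ 2)
      (fun i _ => by positivity) (Finset.mem_univ j)

lemma norm_lameForm_le (hB : IsBallMeasure h (volume.restrict U)) {u : Plane → CVec}
    (hu : MemH1 U u) : ∃ C : ℝ, ∀ φ : Plane → CVec, ContDiff ℝ 1 φ →
      ‖lameForm lam mu om U u φ‖ ≤ C * h1Norm U φ := by
  refine ⟨(∑ i, ∑ j, Real.sqrt (∫ x in U, ‖stress lam mu (weakGrad U u x) i j‖ ^ 2))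
    + om ^ 2 * ∑ i, Real.sqrt (∫ x in U, ‖u x i‖ ^ 2), fun φ hφ => ?_⟩
  rw [lameForm_eq_sum hB hu hφ, add_mul, mul_assoc, Finset.sum_mul, Finset.sum_mul]
  simp_rw [Finset.sum_mul]
  refine (norm_sub_le _ _).trans (add_le_add ?_ ?_)
  · refine (norm_sum_le _ _).trans (Finset.sum_le_sum fun i _ => ?_)
    refine (norm_sum_le _ _).trans (Finset.sum_le_sum fun j _ => ?_)
    refine (norm_integral_mul_le (hu.memLp_stress i j)
      (hB.memLp (continuous_fieldGrad hφ i j) 2)).trans ?_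
    gcongr
    exact (sqrt_le_h1Norm hB hφ i).2 j
  · rw [norm_mul, norm_pow, Complex.norm_real, Real.norm_eq_abs, sq_abs]
    gcongr
    refine (norm_sum_le _ _).trans (Finset.sum_le_sum fun i _ => ?_)
    refine (norm_integral_mul_le (hu.memLp i)
      (hB.memLp (contDiff_component hφ i).continuous 2)).trans ?_
    gcongr
    exact (sqrt_le_h1Norm hB hφ i).1

/-- Pairings with square integrable fields on `∂U` are bounded in the `H¹(U)` norm. -/
lemma norm_integral_dotProduct_le (hB : IsBallMeasure h (volume.restrict U)) {σ : Measure Plane}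
    (hσ : IsBallMeasure h σ) (hT : TraceBounded U σ) {g : Plane → CVec}
    (hg : ∀ i, MemLp (fun x => g x i) 2 σ) : ∃ C : ℝ, ∀ φ : Plane → CVec, ContDiff ℝ 1 φ →
      ‖∫ x, g x ⬝ᵥ φ x ∂σ‖ ≤ C * h1Norm U φ := by
  obtain ⟨C, hC0, hC⟩ := hT
  refine ⟨∑ i, Real.sqrt (∫ x, ‖g x i‖ ^ 2 ∂σ) * Real.sqrt C, fun φ hφ => ?_⟩
  have hm := fun i => hσ.memLp (contDiff_component hφ i).continuous 2
  simp only [dotProduct]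
  rw [integral_finsetSum _ fun i _ => integrable_mul_of_memLp (hg i) (hm i), Finset.sum_mul]
  refine (norm_sum_le _ _).trans (Finset.sum_le_sum fun i _ => ?_)
  refine (norm_integral_mul_le (hg i) (hm i)).trans ?_
  rw [mul_assoc]
  gcongr
  refine (Real.sqrt_le_sqrt (hC _ (contDiff_component hφ i))).trans ?_
  rw [Real.sqrt_mul hC0]
  gcongr
  have hn : 0 ≤ h1Norm U φ := Real.sqrt_nonneg _
  rw [Real.sqrt_le_left hn]
  exact scalar_le_h1Norm hB hφ i

end LameForm


/-! ### Concentrating kernels -/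

/-- In the plane the scaling `k ↦ N k(N·)` preserves the `L²` norm, so these kernels all have the
same norm; it is finite because `4` exceeds the dimension. -/
lemma integral_kernel_sq (N : ℝ) (hN : 0 < N) :
    Integrable (fun x : Plane => (N / (1 + N * ‖x‖) ^ 2) ^ 2) ∧
    ∫ x : Plane, (N / (1 + N * ‖x‖) ^ 2) ^ 2 = ∫ x : Plane, (1 + ‖x‖) ^ (-(4 : ℝ)) := by
  have e : (fun x : Plane => (N / (1 + N * ‖x‖) ^ 2) ^ 2) =
      fun x => N ^ 2 * (fun y : Plane => (1 + ‖y‖) ^ (-(4 : ℝ))) (N • x) := by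
    funext x
    have h1 : 0 < 1 + N * ‖x‖ := by positivity
    simp only [norm_smul, Real.norm_of_nonneg hN.le]
    rw [Real.rpow_neg h1.le, show (4 : ℝ) = ((4 : ℕ) : ℝ) by norm_num, Real.rpow_natCast]
    field_simp
  have hi : Integrable fun y : Plane => (1 + ‖y‖) ^ (-(4 : ℝ)) :=
    integrable_one_add_norm (by simp; norm_num)
  constructor
  · rw [e]
    exact ((integrable_comp_smul_iff volume _ hN.ne').2 hi).const_mul _
  · rw [e, integral_const_mul,
      Measure.integral_comp_smul volume (fun y : Plane => (1 + ‖y‖) ^ (-(4 : ℝ))) N]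
    simp only [finrank_euclideanSpace, Fintype.card_fin, smul_eq_mul]
    rw [abs_of_pos (by positivity), ← mul_assoc, mul_inv_cancel₀ (by positivity), one_mul]

/-- Kernels of size `N (1 + N |x|)⁻³` converge weakly to zero in `L²`. -/
lemma tendsto_integral_mul_kernel (H : IsConvexSector θmin θmax h) {q : Plane → ℂ}
    (hq : MemLp q 2 (volume.restrict (sectorDisk θmin θmax h))) {k : ℕ → Plane → ℂ} {C : ℝ}
    (hk : ∀ n : ℕ, ∀ x ∈ sectorDisk θmin θmax h,
      ‖k n x‖ ≤ C * ((n + 1 : ℝ) / (1 + (n + 1 : ℝ) * ‖x‖) ^ 3)) :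
    Tendsto (fun n => ∫ x in sectorDisk θmin θmax h, q x * k n x) atTop (𝓝 0) := by
  set U := sectorDisk θmin θmax h with hU
  have hB := isBallMeasure_sectorDisk H
  -- The third power is split. One factor `(1 + N|x|)⁻¹` is given to `q`, and the product tends to
  -- zero in `L²` by dominated convergence, the sector not containing the origin. The other two
  -- factors form a kernel of fixed `L²` norm.
  set a : ℕ → Plane → ℝ := fun n x => ‖q x‖ * (1 + (n + 1 : ℝ) * ‖x‖)⁻¹ with ha
  set b : ℕ → Plane → ℝ := fun n x => (n + 1 : ℝ) / (1 + (n + 1 : ℝ) * ‖x‖) ^ 2 with hb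
  have pos : ∀ (n : ℕ) (x : Plane), 0 < 1 + (n + 1 : ℝ) * ‖x‖ := fun n x => by positivity
  have ca : ∀ n : ℕ, Continuous fun x : Plane => (1 + (n + 1 : ℝ) * ‖x‖)⁻¹ := fun n =>
    (by fun_prop : Continuous fun x : Plane => 1 + (n + 1 : ℝ) * ‖x‖).inv₀ fun x => (pos n x).ne'
  have cb : ∀ n, Continuous (b n) := fun n =>
    continuous_const.div (by fun_prop) fun x => (pow_pos (pos n x) 2).ne'
  have ma : ∀ n, MemLp (fun x => (a n x : ℂ)) 2 (volume.restrict U) := fun n => by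
    refine hq.of_le ?_ (Eventually.of_forall fun x => ?_)
    · exact Complex.continuous_ofReal.comp_aestronglyMeasurable
        (hq.1.norm.mul (ca n).aestronglyMeasurable)
    · rw [Complex.norm_real, Real.norm_of_nonneg (by have := pos n x; positivity)]
      exact mul_le_of_le_one_right (norm_nonneg _)
        (inv_le_one_of_one_le₀ (le_add_of_nonneg_right (by positivity)))
  have mb : ∀ n, MemLp (fun x => (b n x : ℂ)) 2 (volume.restrict U) := fun n =>
    hB.memLp (Complex.continuous_ofReal.comp (cb n)) 2
  set K := ∫ x : Plane, (1 + ‖x‖) ^ (-(4 : ℝ)) with hK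
  have key : ∀ n, ‖∫ x in U, q x * k n x‖ ≤
      |C| * (Real.sqrt (∫ x in U, a n x ^ 2) * Real.sqrt K) := by
    intro n
    have hab : Integrable (fun x => a n x * b n x) (volume.restrict U) := by
      have := (integrable_mul_of_memLp (ma n) (mb n)).re
      refine this.congr (Eventually.of_forall fun x => ?_)
      simp [← Complex.ofReal_mul]
    have h1 : ‖∫ x in U, q x * k n x‖ ≤ ∫ x in U, |C| * (a n x * b n x) := by
      refine norm_integral_le_of_norm_le (hab.const_mul _) ?_
      refine (ae_restrict_mem (measurableSet_sectorDisk H)).mono fun x hx => ?_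
      rw [norm_mul]
      have hp := pos n x
      calc ‖q x‖ * ‖k n x‖ ≤ ‖q x‖ * (|C| * ((n + 1 : ℝ) / (1 + (n + 1 : ℝ) * ‖x‖) ^ 3)) := by
            gcongr
            refine (hk n x hx).trans ?_
            gcongr
            exact le_abs_self C
        _ = |C| * (a n x * b n x) := by
            simp only [ha, hb]; field_simp
    refine h1.trans ?_
    rw [integral_const_mul]
    gcongr
    have h2 := norm_integral_mul_le (ma n) (mb n)
    simp only [← Complex.ofReal_mul, integral_complex_ofReal, Complex.norm_real,
      Real.norm_eq_abs, sq_abs] at h2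
    refine (le_abs_self _).trans (h2.trans ?_)
    gcongr
    obtain ⟨i1, i2⟩ := integral_kernel_sq (n + 1 : ℝ) (by positivity)
    rw [hK, ← i2]
    exact setIntegral_le_integral i1 (Eventually.of_forall fun x => by positivity)
  have lim : Tendsto (fun n => ∫ x in U, a n x ^ 2) atTop (𝓝 0) := by
    have := tendsto_integral_of_dominated_convergence (μ := volume.restrict U)
      (F := fun n x => a n x ^ 2) (f := fun _ => (0 : ℝ)) (fun x => ‖q x‖ ^ 2)
      (fun n => ((hq.1.norm.mul (ca n).aestronglyMeasurable)).pow 2) (integrable_sq hq)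
      (fun n => Eventually.of_forall fun x => ?_) ?_
    · simpa using this
    · rw [Real.norm_of_nonneg (by positivity)]
      have hp := pos n x
      gcongr
      exact mul_le_of_le_one_right (norm_nonneg _)
        (inv_le_one_of_one_le₀ (le_add_of_nonneg_right (by positivity)))
    · refine (ae_restrict_mem (measurableSet_sectorDisk H)).mono fun x hx => ?_
      have hx0 : 0 < ‖x‖ := norm_pos_iff.2 (ne_zero_of_mem_sectorDisk hx)
      have t1 : Tendsto (fun n : ℕ => (n + 1 : ℝ)) atTop atTop :=
        tendsto_atTop_add_const_right _ _ tendsto_natCast_atTop_atTop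
      have t2 : Tendsto (fun n : ℕ => (1 + (n + 1 : ℝ) * ‖x‖)⁻¹) atTop (𝓝 0) :=
        tendsto_inv_atTop_zero.comp
          (tendsto_atTop_add_const_left _ _ (t1.atTop_mul_const hx0))
      have t3 := (t2.const_mul ‖q x‖).pow 2
      simpa using t3
  have lim2 : Tendsto (fun n => |C| * (Real.sqrt (∫ x in U, a n x ^ 2) * Real.sqrt K)) atTop
      (𝓝 0) := by
    have := ((lim.sqrt).mul_const (Real.sqrt K)).const_mul |C|
    simpa using this
  exact squeeze_zero_norm key lim2

/-! ### Cutoff functions -/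

lemma exists_deriv_smoothTransition_bound : ∃ C : ℝ, 0 ≤ C ∧
    ∀ t, |deriv Real.smoothTransition t| ≤ C ∧
      (t < 0 → deriv Real.smoothTransition t = 0) ∧
      (1 < t → deriv Real.smoothTransition t = 0) := by
  have hc : Continuous (deriv Real.smoothTransition) :=
    (Real.smoothTransition.contDiff (n := 1)).continuous_deriv le_rfl
  obtain ⟨C, hC⟩ := (isCompact_Icc (a := (0 : ℝ)) (b := 1)).exists_bound_of_continuousOn
    hc.continuousOn
  have z0 : ∀ t : ℝ, t < 0 → deriv Real.smoothTransition t = 0 := fun t ht => by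
    have : Real.smoothTransition =ᶠ[𝓝 t] fun _ => 0 :=
      (gt_mem_nhds ht).mono fun s hs => Real.smoothTransition.zero_of_nonpos (le_of_lt hs)
    rw [this.deriv_eq, deriv_const]
  have z1 : ∀ t : ℝ, 1 < t → deriv Real.smoothTransition t = 0 := fun t ht => by
    have : Real.smoothTransition =ᶠ[𝓝 t] fun _ => 1 :=
      (lt_mem_nhds ht).mono fun s hs => Real.smoothTransition.one_of_one_le (le_of_lt hs)
    rw [this.deriv_eq, deriv_const]
  refine ⟨|C|, abs_nonneg C, fun t => ⟨?_, z0 t, z1 t⟩⟩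
  rcases lt_or_ge t 0 with h0 | h0
  · rw [z0 t h0, abs_zero]; exact abs_nonneg C
  rcases lt_or_ge 1 t with h1 | h1
  · rw [z1 t h1, abs_zero]; exact abs_nonneg C
  · exact (hC t ⟨h0, h1⟩).trans (le_abs_self C)

lemma pderiv_smoothTransition {k : Plane → ℝ} {x : Plane} (j : Fin 2)
    (hk : DifferentiableAt ℝ k x) :
    pderiv j (fun y => ((Real.smoothTransition (k y) : ℝ) : ℂ)) x =
      ((deriv Real.smoothTransition (k x) : ℝ) : ℂ) * pderiv j (fun y => (k y : ℂ)) x := by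
  have hT := ((Real.smoothTransition.contDiff (n := 1)).differentiable one_ne_zero
    (k x)).hasDerivAt
  have h1 := Complex.ofRealCLM.hasFDerivAt.comp x (hT.comp_hasFDerivAt x hk.hasFDerivAt)
  have h2 := Complex.ofRealCLM.hasFDerivAt.comp x hk.hasFDerivAt
  unfold pderiv
  rw [show (fun y => ((Real.smoothTransition (k y) : ℝ) : ℂ)) =
    ⇑Complex.ofRealCLM ∘ Real.smoothTransition ∘ k from rfl, h1.fderiv,
    show (fun y => (k y : ℂ)) = ⇑Complex.ofRealCLM ∘ k from rfl, h2.fderiv]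
  simp

lemma pderiv_norm_sq (j : Fin 2) (x : Plane) :
    pderiv j (fun y => ((‖y‖ ^ 2 : ℝ) : ℂ)) x = 2 * (x j : ℝ) := by
  have h1 := Complex.ofRealCLM.hasFDerivAt.comp x (hasStrictFDerivAt_norm_sq x).hasFDerivAt
  unfold pderiv
  rw [show (fun y : Plane => ((‖y‖ ^ 2 : ℝ) : ℂ)) = ⇑Complex.ofRealCLM ∘ fun y => ‖y‖ ^ 2 from rfl,
    h1.fderiv]
  simp [EuclideanSpace.inner_single_right]


/-! ### The traction on the two edges -/

/-- Green's formula for a solution `u` with tractions `g₁`, `g₂` on the two edges, tested with a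
field `φ` for which the arc does not contribute. -/
def EdgePairing (lam mu om θmin θmax h : ℝ) (u g₁ g₂ φ : Plane → CVec) : Prop :=
  lameForm lam mu om (sectorDisk θmin θmax h) u φ =
    (∫ x, g₁ x ⬝ᵥ φ x ∂(edgeMeasure θmax h)) + ∫ x, g₂ x ⬝ᵥ φ x ∂(edgeMeasure θmin h)

lemma integrable_dotProduct {σ : Measure Plane} (hσ : IsBallMeasure h σ) {g φ : Plane → CVec}
    (hg : ∀ i, MemLp (fun x => g x i) 2 σ) (hφ : Continuous φ) :
    Integrable (fun x => g x ⬝ᵥ φ x) σ :=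
  integrable_finsetSum _ fun i _ => integrable_mul_of_memLp (hg i)
    (hσ.memLp ((continuous_apply i).comp hφ) 2)

variable {lam mu om : ℝ}

lemma EdgePairing.add (H : IsConvexSector θmin θmax h) {u g₁ g₂ φ ψ : Plane → CVec}
    (hu : MemH1 (sectorDisk θmin θmax h) u)
    (hg₁ : ∀ i, MemLp (fun x => g₁ x i) 2 (edgeMeasure θmax h))
    (hg₂ : ∀ i, MemLp (fun x => g₂ x i) 2 (edgeMeasure θmin h))
    (hφ : ContDiff ℝ 1 φ) (hψ : ContDiff ℝ 1 ψ)
    (h₁ : EdgePairing lam mu om θmin θmax h u g₁ g₂ φ)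
    (h₂ : EdgePairing lam mu om θmin θmax h u g₁ g₂ ψ) :
    EdgePairing lam mu om θmin θmax h u g₁ g₂ fun x => φ x + ψ x := by
  unfold EdgePairing at *
  rw [lameForm_add (isBallMeasure_sectorDisk H) hu hφ hψ, h₁, h₂]
  simp_rw [dotProduct_add]
  rw [integral_add (integrable_dotProduct (isBallMeasure_edge _ _) hg₁ hφ.continuous)
      (integrable_dotProduct (isBallMeasure_edge _ _) hg₁ hψ.continuous),
    integral_add (integrable_dotProduct (isBallMeasure_edge _ _) hg₂ hφ.continuous)
      (integrable_dotProduct (isBallMeasure_edge _ _) hg₂ hψ.continuous)]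
  ring

lemma integral_dotProduct_eq_zero_of_edge {θ : ℝ} {g φ : Plane → CVec}
    (hφ : ∀ x ∈ edge θ h, φ x = 0) : ∫ x, g x ⬝ᵥ φ x ∂(edgeMeasure θ h) = 0 := by
  refine integral_eq_zero_of_ae ((ae_edgeMeasure θ h).mono fun x hx => ?_)
  simp [hφ x hx]

/-- Vanishing is checked near a set containing the frontier, so the frontier need not be determined
exactly. -/
lemma isBoundaryTest_of_eventually (H : IsConvexSector θmin θmax h) {Γ : Set Plane}
    {φ : Plane → CVec} (hφ : ContDiff ℝ ∞ φ) (h0 : ∀ x, h ^ 2 < ‖x‖ ^ 2 → φ x = 0)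
    (h1 : ∀ y ∈ (({0} ∪ edge θmax h ∪ edge θmin h) ∪ Metric.sphere (0 : Plane) h) \ Γ,
      φ =ᶠ[𝓝 y] 0) : IsBoundaryTest (sectorDisk θmin θmax h) Γ φ := by
  refine ⟨hφ, ?_, ?_⟩
  · refine HasCompactSupport.intro (isCompact_closedBall (0 : Plane) h) fun x hx => h0 x ?_
    have : h < ‖x‖ := by simpa using hx
    have := H.hh
    gcongr
  · rw [Set.disjoint_right]
    intro y hy
    rw [notMem_tsupport_iff_eventuallyEq]
    exact h1 y ⟨frontier_sectorDisk_subset H hy.1, hy.2⟩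

/-- The pairing for fields that vanish near the corner and near the arc. -/
lemma edgePairing_of_eq_zero_near (H : IsConvexSector θmin θmax h) {u g₁ g₂ φ : Plane → CVec}
    (hu : MemH1 (sectorDisk θmin θmax h) u)
    (hg₁ : ∀ i, MemLp (fun x => g₁ x i) 2 (edgeMeasure θmax h))
    (hg₂ : ∀ i, MemLp (fun x => g₂ x i) 2 (edgeMeasure θmin h))
    (T₁ : ∀ φ, IsBoundaryTest (sectorDisk θmin θmax h) (edge θmax h) φ →
      lameForm lam mu om (sectorDisk θmin θmax h) u φ = ∫ x, g₁ x ⬝ᵥ φ x ∂(edgeMeasure θmax h))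
    (T₂ : ∀ φ, IsBoundaryTest (sectorDisk θmin θmax h) (edge θmin h) φ →
      lameForm lam mu om (sectorDisk θmin θmax h) u φ = ∫ x, g₂ x ⬝ᵥ φ x ∂(edgeMeasure θmin h))
    (hφ : ContDiff ℝ ∞ φ) {ε : ℝ} (hε : 0 < ε) (h0 : ∀ x, ‖x‖ < ε → φ x = 0)
    (h1 : ∀ x, h ^ 2 - ε < ‖x‖ ^ 2 → φ x = 0) :
    EdgePairing lam mu om θmin θmax h u g₁ g₂ φ := by
  have hh := H.hh
  set m := (θmin + θmax) / 2 with hm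
  set s := Real.sin ((θmax - θmin) / 2) with hs
  have hspos : 0 < s := Real.sin_pos_of_pos_of_lt_pi (by linarith [H.hlt])
    (by linarith [H.hangle, Real.pi_pos])
  -- The signed distance to the bisector line: it equals `r s` on one edge and `-r s` on the other.
  set L : Plane → ℝ := fun x => -Real.sin m * x 0 + Real.cos m * x 1 with hL
  have hLc : ContDiff ℝ ∞ L := by
    have h0 : ContDiff ℝ ∞ fun x : Plane => x 0 :=
      (EuclideanSpace.proj (0 : Fin 2) : Plane →L[ℝ] ℝ).contDiff
    have h1 : ContDiff ℝ ∞ fun x : Plane => x 1 :=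
      (EuclideanSpace.proj (1 : Fin 2) : Plane →L[ℝ] ℝ).contDiff
    exact (contDiff_const.mul h0).add (contDiff_const.mul h1)
  have hL₁ : ∀ r, L (r • unitDir θmax) = r * s := fun r => by
    have : s = Real.sin θmax * Real.cos m - Real.cos θmax * Real.sin m := by
      rw [← Real.sin_sub, hs, hm]; congr 1; ring
    simp only [hL, this, PiLp.smul_apply, unitDir_zero, unitDir_one, smul_eq_mul]; ring
  have hL₂ : ∀ r, L (r • unitDir θmin) = -(r * s) := fun r => by
    have : s = Real.sin m * Real.cos θmin - Real.cos m * Real.sin θmin := by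
      rw [← Real.sin_sub, hs, hm]; congr 1; ring
    simp only [hL, this, PiLp.smul_apply, unitDir_zero, unitDir_one, smul_eq_mul]; ring
  -- At distance at least `ε` from the corner, `|L| ≥ ε s > c` on the edges. A transition confined
  -- to `|L| ≤ c` therefore splits `φ` into two admissible fields, each seen by one edge only.
  set c := ε * s / 2 with hc
  have hcpos : 0 < c := by positivity
  set A : Plane → ℝ := fun x => Real.smoothTransition (1 / 2 + L x / (2 * c)) with hA
  have hAc : ContDiff ℝ ∞ A :=
    Real.smoothTransition.contDiff.comp (contDiff_const.add (hLc.div_const _))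
  have hA1 : ∀ x, c ≤ L x → A x = 1 := fun x hx => Real.smoothTransition.one_of_one_le (by
    have : 1 / 2 ≤ L x / (2 * c) := by rw [le_div_iff₀ (by positivity)]; linarith
    linarith)
  have hA0 : ∀ x, L x ≤ -c → A x = 0 := fun x hx => Real.smoothTransition.zero_of_nonpos (by
    have : L x / (2 * c) ≤ -(1 / 2) := by rw [div_le_iff₀ (by positivity)]; linarith
    linarith)
  have hφ1 : ContDiff ℝ ∞ fun x => A x • φ x := hAc.smul hφ
  have hφ2 : ContDiff ℝ ∞ fun x => (1 - A x) • φ x := (contDiff_const.sub hAc).smul hφ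
  have near0 : φ =ᶠ[𝓝 0] 0 := by
    filter_upwards [Metric.ball_mem_nhds (0 : Plane) hε] with x hx
    exact h0 x (by simpa using hx)
  have nearS : ∀ y ∈ Metric.sphere (0 : Plane) h, φ =ᶠ[𝓝 y] 0 := fun y hy => by
    have hy' : ‖y‖ = h := by simpa using hy
    have : {x : Plane | h ^ 2 - ε < ‖x‖ ^ 2} ∈ 𝓝 y :=
      (isOpen_lt continuous_const (by fun_prop)).mem_nhds (by simp [hy', hε])
    exact Filter.mem_of_superset this h1
  have nearE : ∀ r θ, 0 < r → r < ε → φ =ᶠ[𝓝 (r • unitDir θ)] 0 := fun r θ hr hr' => by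
    have : {x : Plane | ‖x‖ < ε} ∈ 𝓝 (r • unitDir θ) :=
      (isOpen_lt (by fun_prop) continuous_const).mem_nhds (by
        rw [mem_ofPred_eq, norm_smul_unitDir hr.le]; exact hr')
    exact Filter.mem_of_superset this h0
  have out : ∀ x, h ^ 2 < ‖x‖ ^ 2 → φ x = 0 := fun x hx => h1 x (by linarith)
  have on1 : ∀ x ∈ edge θmax h, (1 - A x) • φ x = 0 := by
    rintro x ⟨r, hr, hrh, rfl⟩
    rcases lt_or_ge r ε with hrε | hrε
    · rw [(nearE r θmax hr hrε).eq_of_nhds]; simp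
    · rw [hA1 _ (by rw [hL₁]; nlinarith), sub_self, zero_smul]
  have on2 : ∀ x ∈ edge θmin h, A x • φ x = 0 := by
    rintro x ⟨r, hr, hrh, rfl⟩
    rcases lt_or_ge r ε with hrε | hrε
    · rw [(nearE r θmin hr hrε).eq_of_nhds]; simp
    · rw [hA0 _ (by rw [hL₂]; nlinarith), zero_smul]
  have b1 : IsBoundaryTest (sectorDisk θmin θmax h) (edge θmax h) fun x => A x • φ x := by
    refine isBoundaryTest_of_eventually H hφ1 (fun x hx => by rw [out x hx, smul_zero]) ?_
    rintro y ⟨((hy | hy) | ⟨r, hr, hrh, rfl⟩) | hy, hy'⟩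
    · rw [mem_singleton_iff.1 hy]
      exact near0.mono fun x hx => by simp [hx]
    · exact absurd hy hy'
    · rcases lt_or_ge r ε with hrε | hrε
      · exact (nearE r θmin hr hrε).mono fun x hx => by simp [hx]
      · have : {x : Plane | L x < -c} ∈ 𝓝 (r • unitDir θmin) :=
          (isOpen_lt hLc.continuous continuous_const).mem_nhds (by
            rw [mem_ofPred_eq, hL₂]; nlinarith)
        exact Filter.mem_of_superset this fun x (hx : L x < -c) => by
          simp [hA0 x hx.le]
    · exact (nearS y hy).mono fun x hx => by simp [hx]
  have b2 : IsBoundaryTest (sectorDisk θmin θmax h) (edge θmin h) fun x => (1 - A x) • φ x := by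
    refine isBoundaryTest_of_eventually H hφ2 (fun x hx => by rw [out x hx, smul_zero]) ?_
    rintro y ⟨((hy | ⟨r, hr, hrh, rfl⟩) | hy) | hy, hy'⟩
    · rw [mem_singleton_iff.1 hy]
      exact near0.mono fun x hx => by simp [hx]
    · rcases lt_or_ge r ε with hrε | hrε
      · exact (nearE r θmax hr hrε).mono fun x hx => by simp [hx]
      · have : {x : Plane | c < L x} ∈ 𝓝 (r • unitDir θmax) :=
          (isOpen_lt continuous_const hLc.continuous).mem_nhds (by
            rw [mem_ofPred_eq, hL₁]; nlinarith)
        exact Filter.mem_of_superset this fun x (hx : c < L x) => by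
          simp [hA1 x hx.le]
    · exact absurd hy hy'
    · exact (nearS y hy).mono fun x hx => by simp [hx]
  have p1 : EdgePairing lam mu om θmin θmax h u g₁ g₂ fun x => A x • φ x := by
    unfold EdgePairing
    rw [T₁ _ b1, integral_dotProduct_eq_zero_of_edge on2, add_zero]
  have p2 : EdgePairing lam mu om θmin θmax h u g₁ g₂ fun x => (1 - A x) • φ x := by
    unfold EdgePairing
    rw [T₂ _ b2, integral_dotProduct_eq_zero_of_edge on1, zero_add]
  have p3 := p1.add H hu hg₁ hg₂ (hφ1.of_le (by norm_num)) (hφ2.of_le (by norm_num)) p2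
  have e : (fun x => A x • φ x + (1 - A x) • φ x) = φ := by
    funext x; rw [← add_smul, add_sub_cancel, one_smul]
  rwa [e] at p3

lemma tendsto_integral_mul_of_tendsto_one {α : Type*} [MeasurableSpace α] {μ : Measure α}
    {k : α → ℂ} (hk : Integrable k μ) {R : ℕ → α → ℂ}
    (hR : ∀ n, AEStronglyMeasurable (R n) μ) (hR1 : ∀ n x, ‖R n x‖ ≤ 1)
    (hlim : ∀ᵐ x ∂μ, Tendsto (fun n => R n x) atTop (𝓝 1)) :
    Tendsto (fun n => ∫ x, k x * R n x ∂μ) atTop (𝓝 (∫ x, k x ∂μ)) := by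
  refine tendsto_integral_of_dominated_convergence (fun x => ‖k x‖)
    (fun n => hk.1.mul (hR n)) hk.norm (fun n => Eventually.of_forall fun x => ?_) ?_
  · rw [norm_mul]
    exact mul_le_of_le_one_right (norm_nonneg _) (hR1 n x)
  · filter_upwards [hlim] with x hx
    simpa using hx.const_mul (k x)

/-- The pairing passes to the limit along cutoff functions. -/
lemma EdgePairing.of_cutoff (H : IsConvexSector θmin θmax h) {u g₁ g₂ φ : Plane → CVec}
    (hu : MemH1 (sectorDisk θmin θmax h) u)
    (hg₁ : ∀ i, MemLp (fun x => g₁ x i) 2 (edgeMeasure θmax h))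
    (hg₂ : ∀ i, MemLp (fun x => g₂ x i) 2 (edgeMeasure θmin h))
    (hφ : ContDiff ℝ 1 φ) {R : ℕ → Plane → ℂ} (hRs : ∀ n, ContDiff ℝ 1 (R n))
    (hR1 : ∀ n x, ‖R n x‖ ≤ 1)
    (hlim : ∀ x : Plane, 0 < ‖x‖ → ‖x‖ < h → Tendsto (fun n => R n x) atTop (𝓝 1))
    (hgrad : ∀ i j, ∀ q : Plane → ℂ, MemLp q 2 (volume.restrict (sectorDisk θmin θmax h)) →
      Tendsto (fun n => ∫ x in sectorDisk θmin θmax h, q x * (pderiv j (R n) x * φ x i))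
        atTop (𝓝 0))
    (hP : ∀ n, EdgePairing lam mu om θmin θmax h u g₁ g₂ fun x => R n x • φ x) :
    EdgePairing lam mu om θmin θmax h u g₁ g₂ φ := by
  have hB := isBallMeasure_sectorDisk H
  have hRc := fun n => (hRs n).continuous
  have hRφ : ∀ n, ContDiff ℝ 1 fun x => R n x • φ x := fun n => (hRs n).smul hφ
  have limU : ∀ᵐ x ∂(volume.restrict (sectorDisk θmin θmax h)),
      Tendsto (fun n => R n x) atTop (𝓝 1) :=
    (ae_restrict_mem (measurableSet_sectorDisk H)).mono fun x hx =>
      hlim x (norm_pos_iff.2 (ne_zero_of_mem_sectorDisk hx)) (norm_lt_of_mem_sectorDisk hx)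
  have limE : ∀ θ, ∀ᵐ x ∂(edgeMeasure θ h), Tendsto (fun n => R n x) atTop (𝓝 1) := fun θ =>
    (ae_edgeMeasure θ h).mono fun x hx => by
      obtain ⟨r, hr, hrh, rfl⟩ := hx
      exact hlim _ (by rwa [norm_smul_unitDir hr.le]) (by rwa [norm_smul_unitDir hr.le])
  have tE : ∀ θ (g : Plane → CVec), (∀ i, MemLp (fun x => g x i) 2 (edgeMeasure θ h)) →
      Tendsto (fun n => ∫ x, g x ⬝ᵥ (R n x • φ x) ∂(edgeMeasure θ h)) atTop
        (𝓝 (∫ x, g x ⬝ᵥ φ x ∂(edgeMeasure θ h))) := fun θ g hg => by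
    have := tendsto_integral_mul_of_tendsto_one
      (integrable_dotProduct (isBallMeasure_edge θ h) hg hφ.continuous)
      (fun n => (hRc n).aestronglyMeasurable) hR1 (limE θ)
    refine this.congr fun n => ?_
    congr 1 with x
    rw [dotProduct_smul, smul_eq_mul, mul_comm]
  have t1 : ∀ i j, Tendsto (fun n => ∫ x in sectorDisk θmin θmax h,
      stress lam mu (weakGrad (sectorDisk θmin θmax h) u x) i j *
        fieldGrad (fun x => R n x • φ x) x i j) atTop
      (𝓝 (∫ x in sectorDisk θmin θmax h,
        stress lam mu (weakGrad (sectorDisk θmin θmax h) u x) i j * fieldGrad φ x i j)) := by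
    intro i j
    -- The derivative of `R φ` has two parts: `R ∇φ` converges by dominated convergence, and `φ ∇R`
    -- disappears by `hgrad`, which asks for no more than weak convergence.
    have a1 := tendsto_integral_mul_of_tendsto_one
      (integrable_stress_mul (lam := lam) (mu := mu) hB hu hφ i j)
      (fun n => (hRc n).aestronglyMeasurable) hR1 limU
    have a2 := hgrad i j _ (hu.memLp_stress (lam := lam) (mu := mu) i j)
    have a3 := a1.add a2
    rw [add_zero] at a3
    refine a3.congr fun n => ?_
    have cR := continuous_pderiv (hRs n) j
    have cφ := (contDiff_component hφ i).continuous
    have cg := continuous_fieldGrad hφ i j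
    have i1 := integrable_mul_of_memLp (hu.memLp_stress (lam := lam) (mu := mu) i j)
      (hB.memLp (show Continuous fun x => fieldGrad φ x i j * R n x from cg.mul (hRc n)) 2)
    have i2 := integrable_mul_of_memLp (hu.memLp_stress (lam := lam) (mu := mu) i j)
      (hB.memLp (show Continuous fun x => pderiv j (R n) x * φ x i from cR.mul cφ) 2)
    simp_rw [mul_assoc]
    rw [← integral_add i1 i2]
    congr 1 with x
    have : fieldGrad (fun x => R n x • φ x) x i j =
        R n x * fieldGrad φ x i j + pderiv j (R n) x * φ x i :=
      pderiv_mul j ((hRs n).differentiable one_ne_zero x)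
        ((contDiff_component hφ i).differentiable one_ne_zero x)
    rw [this]
    ring
  have t2 : ∀ i, Tendsto (fun n => ∫ x in sectorDisk θmin θmax h, u x i * (R n x • φ x) i) atTop
      (𝓝 (∫ x in sectorDisk θmin θmax h, u x i * φ x i)) := by
    intro i
    have := tendsto_integral_mul_of_tendsto_one (integrable_mul_field hB hu hφ i)
      (fun n => (hRc n).aestronglyMeasurable) hR1 limU
    refine this.congr fun n => ?_
    congr 1 with x
    simp only [Pi.smul_apply, smul_eq_mul]; ring
  have L : Tendsto (fun n => lameForm lam mu om (sectorDisk θmin θmax h) u fun x => R n x • φ x)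
      atTop (𝓝 (lameForm lam mu om (sectorDisk θmin θmax h) u φ)) := by
    rw [lameForm_eq_sum hB hu hφ]
    simp_rw [fun n => lameForm_eq_sum (lam := lam) (mu := mu) (om := om) hB hu (hRφ n)]
    exact (tendsto_finsetSum _ fun i _ => tendsto_finsetSum _ fun j _ => t1 i j).sub
      ((tendsto_finsetSum _ fun i _ => t2 i).const_mul _)
  exact tendsto_nhds_unique (L.congr fun n => hP n) ((tE _ g₁ hg₁).add (tE _ g₂ hg₂))


/-! ### Cutoffs at the arc and at the corner -/

lemma tendsto_natCast_add_one : Tendsto (fun n : ℕ => (n + 1 : ℝ)) atTop atTop :=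
  tendsto_atTop_add_const_right _ _ tendsto_natCast_atTop_atTop

lemma norm_smoothTransition_le (t : ℝ) : ‖((Real.smoothTransition t : ℝ) : ℂ)‖ ≤ 1 := by
  rw [Complex.norm_real, Real.norm_of_nonneg (Real.smoothTransition.nonneg t)]
  exact Real.smoothTransition.le_one t

lemma contDiff_smoothTransition_comp {k : Plane → ℝ} (hk : ContDiff ℝ ∞ k) :
    ContDiff ℝ ∞ fun x => ((Real.smoothTransition (k x) : ℝ) : ℂ) :=
  Complex.ofRealCLM.contDiff.comp (Real.smoothTransition.contDiff.comp hk)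

lemma norm_coord_le (x : Plane) (j : Fin 2) : ‖((x j : ℝ) : ℂ)‖ ≤ ‖x‖ := by
  rw [Complex.norm_real]; exact PiLp.norm_apply_le x j

lemma pderiv_affine_norm_sq (a b : ℝ) (j : Fin 2) (x : Plane) :
    pderiv j (fun y => ((a * ‖y‖ ^ 2 + b : ℝ) : ℂ)) x = a * (2 * (x j : ℝ)) := by
  have hd : DifferentiableAt ℝ (fun y : Plane => ((‖y‖ ^ 2 : ℝ) : ℂ)) x :=
    Complex.ofRealCLM.differentiableAt.comp x
      (hasStrictFDerivAt_norm_sq x).hasFDerivAt.differentiableAt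
  have e : (fun y : Plane => ((a * ‖y‖ ^ 2 + b : ℝ) : ℂ)) =
      fun y => (a : ℂ) * ((‖y‖ ^ 2 : ℝ) : ℂ) + (b : ℂ) := by funext y; push_cast; ring
  rw [e, pderiv_add j (by fun_prop) (by fun_prop), pderiv_const_mul j _ hd, pderiv_norm_sq,
    pderiv_const, add_zero]

lemma contDiff_affine_norm_sq (a b : ℝ) : ContDiff ℝ ∞ fun y : Plane => a * ‖y‖ ^ 2 + b :=
  (contDiff_const.mul (contDiff_norm_sq ℝ)).add contDiff_const

lemma exists_bound_sectorDisk (h : ℝ) {f : Plane → ℂ} (hf : Continuous f) :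
    ∃ M, 0 ≤ M ∧ ∀ x : Plane, ‖x‖ ≤ h → ‖f x‖ ≤ M := by
  obtain ⟨C, hC⟩ := (isCompact_closedBall (0 : Plane) h).exists_bound_of_continuousOn
    hf.continuousOn
  exact ⟨|C|, abs_nonneg C, fun x hx => (hC x (by simpa using hx)).trans (le_abs_self C)⟩

/-- A smooth function that vanishes on the arc is controlled by the distance to the arc. -/
lemma exists_bound_of_eq_zero_on_arc (H : IsConvexSector θmin θmax h) {f : Plane → ℂ}
    (hf : ContDiff ℝ 1 f) (h0 : ∀ x ∈ arc θmin θmax h, f x = 0) :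
    ∃ K, 0 ≤ K ∧ ∀ x ∈ sectorDisk θmin θmax h, ‖f x‖ ≤ K * (h ^ 2 - ‖x‖ ^ 2) := by
  have hh := H.hh
  obtain ⟨C, hC⟩ := (isCompact_closedBall (0 : Plane) h).exists_bound_of_continuousOn
    (hf.continuous_fderiv one_ne_zero).continuousOn
  have hC0 : 0 ≤ C := (norm_nonneg _).trans (hC 0 (by simp [hh.le]))
  -- Mean value inequality along the radius, together with `h² - r² = (h - r)(h + r) ≥ h (h - r)`.
  refine ⟨C / h, by positivity, ?_⟩
  rintro x ⟨⟨r, θ, hr, h1, h2, rfl⟩, hx⟩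
  have hrh : r < h := by simpa [norm_smul_unitDir hr.le] using hx
  rw [norm_smul_unitDir hr.le]
  have hy : h • unitDir θ ∈ arc θmin θmax h :=
    ⟨⟨h, θ, hh, h1, h2, rfl⟩, by rw [Metric.mem_sphere, dist_zero_right, norm_smul_unitDir hh.le]⟩
  have key := (convex_closedBall (0 : Plane) h).norm_image_sub_le_of_norm_fderiv_le
    (𝕜 := ℝ) (f := f) (C := C) (fun z _ => hf.differentiable one_ne_zero z) hC
    (x := h • unitDir θ) (y := r • unitDir θ)
    (by simp [norm_smul_unitDir hh.le]) (by simp [norm_smul_unitDir hr.le, hrh.le])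
  rw [h0 _ hy, sub_zero, ← sub_smul, norm_smul, norm_unitDir, mul_one, Real.norm_eq_abs,
    abs_sub_comm, abs_of_pos (by linarith)] at key
  refine key.trans ?_
  rw [div_mul_eq_mul_div, le_div_iff₀ hh, mul_assoc]
  gcongr
  nlinarith

/-- The pairing for fields that vanish near the corner and on the arc. -/
lemma edgePairing_of_eq_zero_near_corner (H : IsConvexSector θmin θmax h)
    {u g₁ g₂ φ : Plane → CVec} (hu : MemH1 (sectorDisk θmin θmax h) u)
    (hg₁ : ∀ i, MemLp (fun x => g₁ x i) 2 (edgeMeasure θmax h))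
    (hg₂ : ∀ i, MemLp (fun x => g₂ x i) 2 (edgeMeasure θmin h))
    (T₁ : ∀ φ, IsBoundaryTest (sectorDisk θmin θmax h) (edge θmax h) φ →
      lameForm lam mu om (sectorDisk θmin θmax h) u φ = ∫ x, g₁ x ⬝ᵥ φ x ∂(edgeMeasure θmax h))
    (T₂ : ∀ φ, IsBoundaryTest (sectorDisk θmin θmax h) (edge θmin h) φ →
      lameForm lam mu om (sectorDisk θmin θmax h) u φ = ∫ x, g₂ x ⬝ᵥ φ x ∂(edgeMeasure θmin h))
    (hφ : ContDiff ℝ ∞ φ) {ε : ℝ} (hε : 0 < ε) (h0 : ∀ x, ‖x‖ < ε → φ x = 0) {K : ℝ}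
    (hK0 : 0 ≤ K)
    (hK : ∀ i, ∀ x ∈ sectorDisk θmin θmax h, ‖φ x i‖ ≤ K * (h ^ 2 - ‖x‖ ^ 2)) :
    EdgePairing lam mu om θmin θmax h u g₁ g₂ φ := by
  have hh := H.hh
  obtain ⟨C, hC0, hC⟩ := exists_deriv_smoothTransition_bound
  -- With `N = n + 1` the cutoff is `0` where `N (h² - |x|²) ≤ 1` and `1` where it is at least `2`.
  -- Working with `|x|²` keeps it smooth at the origin.
  set k : ℕ → Plane → ℝ := fun n y => -(n + 1 : ℝ) * ‖y‖ ^ 2 + ((n + 1 : ℝ) * h ^ 2 - 1) with hk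
  have hk' : ∀ n x, k n x = (n + 1 : ℝ) * (h ^ 2 - ‖x‖ ^ 2) - 1 := fun n x => by
    simp only [hk]; ring
  have hks : ∀ n, ContDiff ℝ ∞ (k n) := fun n => contDiff_affine_norm_sq _ _
  have hRs := fun n => contDiff_smoothTransition_comp (hks n)
  have kev : ∀ x : Plane, ‖x‖ < h → ∀ᶠ n in atTop, 1 < k n x := fun x hx => by
    have hp : 0 < h ^ 2 - ‖x‖ ^ 2 := by nlinarith [norm_nonneg x]
    have := tendsto_atTop_add_const_right _ (-1)
      (tendsto_natCast_add_one.atTop_mul_const hp)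
    filter_upwards [this.eventually_gt_atTop 1] with n hn
    rw [hk']; linarith
  refine EdgePairing.of_cutoff H hu hg₁ hg₂ (hφ.of_le (by norm_num))
    (R := fun n x => ((Real.smoothTransition (k n x) : ℝ) : ℂ))
    (fun n => (hRs n).of_le (by norm_num)) (fun n x => norm_smoothTransition_le _) ?_ ?_ ?_
  · intro x _ hx
    refine tendsto_const_nhds.congr' ((kev x hx).mono fun n hn => ?_)
    beta_reduce
    rw [Real.smoothTransition.one_of_one_le hn.le, Complex.ofReal_one]
  · intro i j q hq
    have hB := isBallMeasure_sectorDisk H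
    have := hB.finite
    have e : ∀ n x, pderiv j (fun x => ((Real.smoothTransition (k n x) : ℝ) : ℂ)) x =
        ((deriv Real.smoothTransition (k n x) : ℝ) : ℂ) *
          (((-(n + 1 : ℝ) : ℝ) : ℂ) * (2 * (x j : ℝ))) := fun n x => by
      rw [pderiv_smoothTransition j ((hks n).differentiable (by norm_num) x)]
      rw [pderiv_affine_norm_sq]
    have lim := tendsto_integral_of_dominated_convergence
      (μ := volume.restrict (sectorDisk θmin θmax h))
      (F := fun n x => q x * (pderiv j (fun x => ((Real.smoothTransition (k n x) : ℝ) : ℂ)) x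
        * φ x i)) (f := fun _ => (0 : ℂ)) (fun x => ‖q x‖ * (C * (4 * h * K)))
      (fun n => ?_) ((hq.integrable one_le_two).norm.mul_const _) (fun n => ?_) ?_
    · simpa using lim
    · exact hq.1.mul ((continuous_pderiv ((hRs n).of_le (by norm_num)) j).mul
        (contDiff_component hφ i).continuous).aestronglyMeasurable
    · refine (ae_restrict_mem (measurableSet_sectorDisk H)).mono fun x hx => ?_
      have hxh := norm_lt_of_mem_sectorDisk hx
      have hp : 0 < h ^ 2 - ‖x‖ ^ 2 := by nlinarith [norm_nonneg x]
      rw [norm_mul, norm_mul]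
      refine mul_le_mul_of_nonneg_left ?_ (norm_nonneg _)
      rw [e, norm_mul, norm_mul, norm_mul, Complex.norm_real, Complex.norm_real, norm_neg,
        Real.norm_of_nonneg (by positivity : (0 : ℝ) ≤ n + 1), Complex.norm_ofNat]
      rcases lt_or_ge 1 (k n x) with h1 | h1
      · rw [(hC _).2.2 h1]
        simp only [norm_zero, zero_mul]
        positivity
      -- In the transition layer the gradient of the cutoff has size `N`, while `φ` is at most `K
      -- (h² - |x|²) ≤ 2K/N`. The product is bounded uniformly in `n`, and it vanishes eventually at
      -- each point, so dominated convergence applies.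
      · have hkx : (n + 1 : ℝ) * (h ^ 2 - ‖x‖ ^ 2) ≤ 2 := by rw [hk'] at h1; linarith
        calc ‖deriv Real.smoothTransition (k n x)‖ * ((n + 1 : ℝ) * (2 * ‖((x j : ℝ) : ℂ)‖))
              * ‖φ x i‖ ≤ C * ((n + 1 : ℝ) * (2 * h)) * (K * (h ^ 2 - ‖x‖ ^ 2)) := by
              gcongr
              · exact (hC _).1
              · exact (norm_coord_le x j).trans hxh.le
              · exact hK i x hx
          _ = C * (2 * h * K * ((n + 1 : ℝ) * (h ^ 2 - ‖x‖ ^ 2))) := by ring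
          _ ≤ C * (2 * h * K * 2) := by gcongr
          _ = C * (4 * h * K) := by ring
    · refine (ae_restrict_mem (measurableSet_sectorDisk H)).mono fun x hx => ?_
      refine tendsto_const_nhds.congr' ((kev x (norm_lt_of_mem_sectorDisk hx)).mono fun n hn => ?_)
      beta_reduce
      rw [e, (hC _).2.2 hn]; simp
  · intro n
    refine edgePairing_of_eq_zero_near H hu hg₁ hg₂ T₁ T₂ ((hRs n).smul hφ)
      (ε := min ε ((n + 1 : ℝ)⁻¹)) (lt_min hε (by positivity)) (fun x hx => ?_) (fun x hx => ?_)
    · rw [h0 x (hx.trans_le (min_le_left _ _)), smul_zero]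
    · rw [Real.smoothTransition.zero_of_nonpos, Complex.ofReal_zero, zero_smul]
      rw [hk']
      have h1 : h ^ 2 - ‖x‖ ^ 2 < (n + 1 : ℝ)⁻¹ := by
        have := min_le_right ε ((n + 1 : ℝ)⁻¹); linarith
      have h2 : (n + 1 : ℝ) * (h ^ 2 - ‖x‖ ^ 2) ≤ (n + 1 : ℝ) * (n + 1 : ℝ)⁻¹ := by gcongr
      rw [mul_inv_cancel₀ (by positivity)] at h2
      linarith

/-- Green's formula for test fields that vanish on the arc. -/
theorem edgePairing_of_eq_zero_on_arc (H : IsConvexSector θmin θmax h)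
    {u g₁ g₂ φ : Plane → CVec} (hu : MemH1 (sectorDisk θmin θmax h) u)
    (hg₁ : ∀ i, MemLp (fun x => g₁ x i) 2 (edgeMeasure θmax h))
    (hg₂ : ∀ i, MemLp (fun x => g₂ x i) 2 (edgeMeasure θmin h))
    (T₁ : ∀ φ, IsBoundaryTest (sectorDisk θmin θmax h) (edge θmax h) φ →
      lameForm lam mu om (sectorDisk θmin θmax h) u φ = ∫ x, g₁ x ⬝ᵥ φ x ∂(edgeMeasure θmax h))
    (T₂ : ∀ φ, IsBoundaryTest (sectorDisk θmin θmax h) (edge θmin h) φ →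
      lameForm lam mu om (sectorDisk θmin θmax h) u φ = ∫ x, g₂ x ⬝ᵥ φ x ∂(edgeMeasure θmin h))
    (hφ : ContDiff ℝ ∞ φ) (h0 : ∀ x ∈ arc θmin θmax h, φ x = 0) :
    EdgePairing lam mu om θmin θmax h u g₁ g₂ φ := by
  have hh := H.hh
  obtain ⟨C, hC0, hC⟩ := exists_deriv_smoothTransition_bound
  choose K hK0 hK using fun i => exists_bound_of_eq_zero_on_arc H
    ((contDiff_component hφ i).of_le (by norm_num)) fun x hx => congrFun (h0 x hx) i
  -- Cutoff at the corner: `0` where `N|x| ≤ 1` and `1` where `(N|x|)² ≥ 2`.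
  set k : ℕ → Plane → ℝ := fun n y => (n + 1 : ℝ) ^ 2 * ‖y‖ ^ 2 + (-1) with hk
  have hks : ∀ n, ContDiff ℝ ∞ (k n) := fun n => contDiff_affine_norm_sq _ _
  have hRs := fun n => contDiff_smoothTransition_comp (hks n)
  refine EdgePairing.of_cutoff H hu hg₁ hg₂ (hφ.of_le (by norm_num))
    (R := fun n x => ((Real.smoothTransition (k n x) : ℝ) : ℂ))
    (fun n => (hRs n).of_le (by norm_num)) (fun n x => norm_smoothTransition_le _) ?_ ?_ ?_
  · intro x hx _
    have h1 : ∀ᶠ n in atTop, 1 < k n x := by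
      have hp : 0 < ‖x‖ ^ 2 := by positivity
      have := tendsto_atTop_add_const_right _ (-1)
        (((tendsto_pow_atTop two_ne_zero).comp tendsto_natCast_add_one).atTop_mul_const hp)
      exact this.eventually_gt_atTop 1
    refine tendsto_const_nhds.congr' (h1.mono fun n hn => ?_)
    beta_reduce
    rw [Real.smoothTransition.one_of_one_le hn.le, Complex.ofReal_one]
  · intro i j q hq
    obtain ⟨M, hM0, hM⟩ := exists_bound_sectorDisk h (contDiff_component hφ i).continuous
    -- The gradient is at most `4CN` and is supported where `N|x| ≤ 2`, so `(1 + N|x|)³ ≤ 27` there;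
    -- `108 = 4 · 27`. It need not tend to zero in the `L²` norm, but it does so weakly.
    refine tendsto_integral_mul_kernel H hq (C := C * 108 * M) fun n x hx => ?_
    have hxh := norm_lt_of_mem_sectorDisk hx
    have e : pderiv j (fun x => ((Real.smoothTransition (k n x) : ℝ) : ℂ)) x =
        ((deriv Real.smoothTransition (k n x) : ℝ) : ℂ) *
          ((((n + 1 : ℝ) ^ 2 : ℝ) : ℂ) * (2 * (x j : ℝ))) := by
      rw [pderiv_smoothTransition j ((hks n).differentiable (by norm_num) x),
        pderiv_affine_norm_sq]
    rw [norm_mul, e, norm_mul, norm_mul, norm_mul, Complex.norm_real, Complex.norm_real,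
      Real.norm_of_nonneg (by positivity : (0 : ℝ) ≤ (n + 1) ^ 2), Complex.norm_ofNat]
    set N : ℝ := n + 1 with hN
    have hNpos : 0 < N := by positivity
    rcases lt_or_ge 1 (k n x) with h1 | h1
    · rw [(hC _).2.2 h1]
      simp only [norm_zero, zero_mul]
      positivity
    · have hkx : (N * ‖x‖) ^ 2 ≤ 2 := by simp only [hk] at h1; rw [mul_pow]; linarith
      have hNx : N * ‖x‖ ≤ 2 := by nlinarith [norm_nonneg x]
      have h3 : (1 + N * ‖x‖) ^ 3 ≤ 27 := by
        calc (1 + N * ‖x‖) ^ 3 ≤ (1 + 2) ^ 3 := by gcongr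
          _ = 27 := by norm_num
      calc ‖deriv Real.smoothTransition (k n x)‖ * (N ^ 2 * (2 * ‖((x j : ℝ) : ℂ)‖)) * ‖φ x i‖
          ≤ C * (N ^ 2 * (2 * ‖x‖)) * M := by
            gcongr
            · exact (hC _).1
            · exact norm_coord_le x j
            · exact hM x hxh.le
        _ = C * (2 * N * (N * ‖x‖)) * M := by ring
        _ ≤ C * (2 * N * 2) * M := by gcongr
        _ = C * 108 * M * (N / 27) := by ring
        _ ≤ C * 108 * M * (N / (1 + N * ‖x‖) ^ 3) := by gcongr
  · intro n
    refine edgePairing_of_eq_zero_near_corner H hu hg₁ hg₂ T₁ T₂ ((hRs n).smul hφ)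
      (ε := (n + 1 : ℝ)⁻¹) (by positivity) (fun x hx => ?_) (K := ∑ i, K i)
      (Finset.sum_nonneg fun i _ => hK0 i) fun i x hx => ?_
    · rw [Real.smoothTransition.zero_of_nonpos, Complex.ofReal_zero, zero_smul]
      have h1 : (n + 1 : ℝ) * ‖x‖ ≤ 1 := by
        have : (n + 1 : ℝ) * ‖x‖ ≤ (n + 1 : ℝ) * (n + 1 : ℝ)⁻¹ := by gcongr
        rwa [mul_inv_cancel₀ (by positivity)] at this
      have h2 : ((n + 1 : ℝ) * ‖x‖) ^ 2 ≤ 1 := pow_le_one₀ (by positivity) h1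
      simp only [hk]
      rw [mul_pow] at h2
      linarith
    · have hxh := norm_lt_of_mem_sectorDisk hx
      have hp : 0 < h ^ 2 - ‖x‖ ^ 2 := by nlinarith [norm_nonneg x]
      simp only [Pi.smul_apply, smul_eq_mul, norm_mul]
      calc _ ≤ 1 * (K i * (h ^ 2 - ‖x‖ ^ 2)) := by
            gcongr
            · exact norm_smoothTransition_le _
            · exact hK i x hx
        _ ≤ (∑ i, K i) * (h ^ 2 - ‖x‖ ^ 2) := by
            rw [one_mul]
            gcongr
            exact Finset.single_le_sum (fun i _ => hK0 i) (Finset.mem_univ i)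


/-! ### Hölder continuous boundary data -/

lemma HolderOnWith.exists_bound_Ico {k : ℝ → CVec} {C β : ℝ≥0}
    (hk : HolderOnWith C β k (Ico 0 h)) : ∃ M, ∀ r ∈ Ico 0 h, ‖k r‖ ≤ M := by
  refine ⟨‖k 0‖ + C * h ^ (β : ℝ), fun r hr => ?_⟩
  have h0 : (0 : ℝ) ∈ Ico 0 h := ⟨le_rfl, hr.1.trans_lt hr.2⟩
  have hd := hk.dist_le hr h0
  rw [dist_eq_norm, Real.dist_eq, sub_zero, abs_of_nonneg hr.1] at hd
  have h1 : (C : ℝ) * r ^ (β : ℝ) ≤ C * h ^ (β : ℝ) :=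
    mul_le_mul_of_nonneg_left (Real.rpow_le_rpow hr.1 hr.2.le β.2) C.2
  have h2 := norm_le_norm_add_norm_sub' (k r) (k 0)
  linarith

lemma IsHolder.exists_bound {θ : ℝ} {β : ℝ≥0} {g : Plane → CVec} (hg : IsHolder θ h β g) :
    ∃ M, ∀ r ∈ Ico 0 h, ‖alongEdge θ g r‖ ≤ M := by
  obtain ⟨C, hC⟩ := hg
  exact HolderOnWith.exists_bound_Ico hC

lemma IsHolder.continuousOn {θ : ℝ} {β : ℝ≥0} {g : Plane → CVec} (hβ : 0 < β)
    (hg : IsHolder θ h β g) : ContinuousOn (alongEdge θ g) (Ico 0 h) := by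
  obtain ⟨C, hC⟩ := hg
  exact hC.continuousOn hβ

lemma IsC1Holder.continuousOn {θ : ℝ} {α : ℝ≥0} {f : Plane → CVec} (hf : IsC1Holder θ h α f) :
    ContinuousOn (alongEdge θ f) (Ico 0 h) := hf.1.continuousOn

lemma IsC1Holder.exists_lipschitz_bound {θ : ℝ} {α : ℝ≥0} {f : Plane → CVec}
    (hf : IsC1Holder θ h α f) :
    ∃ M, ∀ r ∈ Ico 0 h, ‖alongEdge θ f r - f 0‖ ≤ M * r := by
  obtain ⟨hd, C, hC⟩ := hf
  obtain ⟨M, hM⟩ := HolderOnWith.exists_bound_Ico hC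
  refine ⟨M, fun r hr => ?_⟩
  have h0 : (0 : ℝ) ∈ Ico 0 h := ⟨le_rfl, hr.1.trans_lt hr.2⟩
  have key := (convex_Ico 0 h).norm_image_sub_le_of_norm_derivWithin_le hd hM h0 hr
  rw [sub_zero, Real.norm_of_nonneg hr.1] at key
  simpa [alongEdge] using key

lemma IsC1Holder.exists_bound {θ : ℝ} {α : ℝ≥0} {f : Plane → CVec} (hf : IsC1Holder θ h α f) :
    ∃ M, ∀ r ∈ Ico 0 h, ‖alongEdge θ f r‖ ≤ M := by
  obtain ⟨M, hM⟩ := hf.exists_lipschitz_bound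
  refine ⟨‖f 0‖ + |M| * h, fun r hr => ?_⟩
  have h2 := norm_le_norm_add_norm_sub' (alongEdge θ f r) (f 0)
  have h3 : M * r ≤ |M| * h := by
    have := hr.1; have := hr.2.le
    calc M * r ≤ |M| * r := by gcongr; exact le_abs_self M
      _ ≤ |M| * h := by gcongr
  linarith [hM r hr]

lemma memLp_edge {θ : ℝ} {g : Plane → CVec} (hg : ContinuousOn (alongEdge θ g) (Ico 0 h))
    {M : ℝ} (hM : ∀ r ∈ Ico 0 h, ‖alongEdge θ g r‖ ≤ M) (i : Fin 2) :
    MemLp (fun x => g x i) 2 (edgeMeasure θ h) := by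
  have := (isBallMeasure_edge θ h).finite
  refine MemLp.of_bound (aestronglyMeasurable_edge hg i) M ?_
  filter_upwards [ae_edgeMeasure θ h] with x hx
  obtain ⟨r, hr, hrh, rfl⟩ := hx
  exact (norm_le_pi_norm _ i).trans (hM r ⟨hr.le, hrh⟩)

/-! ### Betti's formula -/

/-- Green's formula for the Lamé operator applied to a smooth solution `ψ`. -/
theorem lameForm_eq_boundary (H : IsConvexSector θmin θmax h) {lam mu om : ℝ}
    {u f₁ f₂ t ψ : Plane → CVec} (hu : MemH1 (sectorDisk θmin θmax h) u)
    (hf₁ : ∀ i, MemLp (fun x => f₁ x i) 2 (edgeMeasure θmax h))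
    (hf₂ : ∀ i, MemLp (fun x => f₂ x i) 2 (edgeMeasure θmin h))
    (ht : ∀ i, MemLp (fun x => t x i) 2 (arcMeasure θmin θmax h))
    (hG : ∀ i, GreenFormula θmin θmax h (fun x => u x i)
      (fun j x => weakGrad (sectorDisk θmin θmax h) u x i j) (fun x => f₁ x i)
      (fun x => f₂ x i) fun x => t x i)
    (hψ : ContDiff ℝ 1 ψ)
    (hS : ∀ i j, ContDiff ℝ 1 fun x => stress lam mu (fieldGrad ψ x) i j)
    (hdiv : ∀ i x, ∑ j, pderiv j (fun y => stress lam mu (fieldGrad ψ y) i j) x =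
      -(om : ℂ) ^ 2 * ψ x i) :
    lameForm lam mu om (sectorDisk θmin θmax h) u ψ =
      (∫ x, traction lam mu (normalMax θmax) ψ x ⬝ᵥ f₁ x ∂(edgeMeasure θmax h))
      + (∫ x, traction lam mu (normalMin θmin) ψ x ⬝ᵥ f₂ x ∂(edgeMeasure θmin h))
      + ∫ x, traction lam mu (h⁻¹ • x) ψ x ⬝ᵥ t x ∂(arcMeasure θmin θmax h) := by
  have hB := isBallMeasure_sectorDisk H
  have hSc := fun i j => (hS i j).continuous
  have htr : ∀ (ν : Plane → Plane), Continuous ν → ∀ i,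
      Continuous fun x => ∑ j, ((ν x j : ℝ) : ℂ) * stress lam mu (fieldGrad ψ x) i j := by
    intro ν hν i
    refine continuous_finsetSum _ fun j _ => Continuous.mul ?_ (hSc i j)
    exact (contDiff_coord (n := 0) j).continuous.comp hν
  have etr : ∀ (ν : Plane) (x : Plane) (f : CVec), traction lam mu ν ψ x ⬝ᵥ f =
      ∑ i, (∑ j, ((ν j : ℝ) : ℂ) * stress lam mu (fieldGrad ψ x) i j) * f i := by
    intro ν x f
    simp only [traction, dotProduct, Matrix.mulVec, mul_comm]
  have e : ∀ (σ : Measure Plane) (ν : Plane → Plane) (f : Plane → CVec), IsBallMeasure h σ →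
      Continuous ν → (∀ i, MemLp (fun x => f x i) 2 σ) →
      ∫ x, traction lam mu (ν x) ψ x ⬝ᵥ f x ∂σ = ∑ i, ∫ x,
        (∑ j, ((ν x j : ℝ) : ℂ) * stress lam mu (fieldGrad ψ x) i j) * f x i ∂σ := by
    intro σ ν f hσ hν hf
    simp_rw [etr]
    exact integral_finsetSum _ fun i _ => integrable_mul_of_memLp (hσ.memLp (htr ν hν i) 2) (hf i)
  rw [e _ (fun _ => normalMax θmax) f₁ (isBallMeasure_edge _ _) continuous_const hf₁,
    e _ (fun _ => normalMin θmin) f₂ (isBallMeasure_edge _ _) continuous_const hf₂,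
    e _ (fun x => h⁻¹ • x) t (isBallMeasure_arc H) (continuous_const_smul _) ht,
    ← Finset.sum_add_distrib, ← Finset.sum_add_distrib]
  have e4 : ∀ i, ∫ x in sectorDisk θmin θmax h,
      (∑ j, pderiv j (fun y => stress lam mu (fieldGrad ψ y) i j) x) * u x i =
      ∫ x in sectorDisk θmin θmax h, -(om : ℂ) ^ 2 * ψ x i * u x i := fun i =>
    integral_congr_ae (.of_forall fun x => congrArg (· * u x i) (hdiv i x))
  -- Green's formula is applied to each component `u_i` with the `i`-th row of the stress of `ψ` as
  -- vector field; the divergence of that row is `-ω² ψ_i`, which supplies the zeroth order term of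
  -- the form.
  refine Eq.trans ?_ (Finset.sum_congr rfl fun i _ =>
    (congrArg (_ + ·) (e4 i).symm).trans (hG i _ (hS i)))
  beta_reduce
  rw [lameForm_eq_sum hB hu hψ, Finset.sum_add_distrib, sub_eq_add_neg]
  congr 1
  · have i1 : ∀ i, Integrable (fun x => ∑ j, stress lam mu (fieldGrad ψ x) i j *
        weakGrad (sectorDisk θmin θmax h) u x i j)
        (volume.restrict (sectorDisk θmin θmax h)) := fun i =>
      integrable_finsetSum _ fun j _ => integrable_mul_of_memLp
        (hB.memLp (hSc i j) 2) (hu.memLp_weakGrad i j)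
    have i2 : ∀ i, Integrable (fun x => ∑ j, stress lam mu
        (weakGrad (sectorDisk θmin θmax h) u x) i j * fieldGrad ψ x i j)
        (volume.restrict (sectorDisk θmin θmax h)) := fun i =>
      integrable_finsetSum _ fun j _ => integrable_stress_mul hB hu hψ i j
    refine (Finset.sum_congr rfl fun i _ => (integral_finsetSum _ fun j _ =>
      integrable_stress_mul hB hu hψ i j).symm).trans ?_
    refine (integral_finsetSum _ fun i _ => i2 i).symm.trans ?_
    refine Eq.trans ?_ (integral_finsetSum _ fun i _ => i1 i)
    exact integral_congr_ae (.of_forall fun x => stress_symm lam mu _ _)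
  · simp_rw [Finset.mul_sum, ← Finset.sum_neg_distrib]
    refine Finset.sum_congr rfl fun i _ => ?_
    rw [← integral_const_mul, ← integral_neg]
    congr 1 with x
    ring

/-! ### Exponential solutions -/

/-- The field `e^{ξ·x} η`. -/
noncomputable def expField (ξ η : CVec) (x : Plane) : CVec :=
  Complex.exp (∑ j, ξ j * (x j : ℂ)) • η

lemma contDiff_linearForm {n : WithTop ℕ∞} (ξ : CVec) :
    ContDiff ℝ n fun x : Plane => ∑ j, ξ j * ((x j : ℝ) : ℂ) :=
  ContDiff.sum fun j _ => contDiff_const.mul (contDiff_coord j)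

lemma contDiff_exp_linearForm {n : WithTop ℕ∞} (ξ : CVec) :
    ContDiff ℝ n fun x : Plane => Complex.exp (∑ j, ξ j * ((x j : ℝ) : ℂ)) :=
  (contDiff_linearForm ξ).cexp

lemma pderiv_linearForm (ξ : CVec) (j : Fin 2) (x : Plane) :
    pderiv j (fun y : Plane => ∑ i, ξ i * ((y i : ℝ) : ℂ)) x = ξ j := by
  have hd : ∀ i : Fin 2, DifferentiableAt ℝ (fun y : Plane => ((y i : ℝ) : ℂ)) x :=
    fun i => (contDiff_coord (n := 1) i).differentiable one_ne_zero x
  simp only [Fin.sum_univ_two]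
  rw [pderiv_add j ((hd 0).const_mul _) ((hd 1).const_mul _), pderiv_const_mul j _ (hd 0),
    pderiv_const_mul j _ (hd 1), pderiv_coord, pderiv_coord]
  fin_cases j <;> simp

lemma pderiv_exp_linearForm (ξ : CVec) (j : Fin 2) (x : Plane) :
    pderiv j (fun y : Plane => Complex.exp (∑ i, ξ i * ((y i : ℝ) : ℂ))) x =
      Complex.exp (∑ i, ξ i * ((x i : ℝ) : ℂ)) * ξ j := by
  rw [pderiv_cexp j ((contDiff_linearForm (n := 1) ξ).differentiable one_ne_zero x),
    pderiv_linearForm]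

lemma contDiff_expField {n : WithTop ℕ∞} (ξ η : CVec) : ContDiff ℝ n (expField ξ η) :=
  (contDiff_exp_linearForm ξ).smul contDiff_const

lemma fieldGrad_expField (ξ η : CVec) (x : Plane) (i j : Fin 2) :
    fieldGrad (expField ξ η) x i j =
      Complex.exp (∑ j, ξ j * ((x j : ℝ) : ℂ)) * (η i * ξ j) := by
  have : (fun y => expField ξ η y i) =
      fun y => η i * Complex.exp (∑ j, ξ j * ((y j : ℝ) : ℂ)) := by
    funext y; simp [expField, mul_comm]
  simp only [fieldGrad, Matrix.of_apply]
  rw [this, pderiv_const_mul j _ ((contDiff_exp_linearForm (n := 1) ξ).differentiable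
    one_ne_zero x), pderiv_exp_linearForm]
  ring

lemma stress_fieldGrad_expField (lam mu : ℝ) (ξ η : CVec) (x : Plane) (i j : Fin 2) :
    stress lam mu (fieldGrad (expField ξ η) x) i j =
      stress lam mu (Matrix.vecMulVec η ξ) i j * Complex.exp (∑ j, ξ j * ((x j : ℝ) : ℂ)) := by
  simp only [stress_apply, fieldGrad_expField, Matrix.vecMulVec_apply]
  ring

lemma contDiff_stress_expField {n : WithTop ℕ∞} (lam mu : ℝ) (ξ η : CVec) (i j : Fin 2) :
    ContDiff ℝ n fun x => stress lam mu (fieldGrad (expField ξ η) x) i j := by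
  simp_rw [stress_fieldGrad_expField]
  exact contDiff_const.mul (contDiff_exp_linearForm ξ)

/-- The Lamé operator on exponential fields of shear type. -/
lemma div_stress_expField (lam mu : ℝ) {ξ η : CVec} {s : ℂ} (hξη : ξ ⬝ᵥ η = 0)
    (hξ : ξ ⬝ᵥ ξ = s) (i : Fin 2) (x : Plane) :
    ∑ j, pderiv j (fun y => stress lam mu (fieldGrad (expField ξ η) y) i j) x =
      mu * s * expField ξ η x i := by
  simp_rw [stress_fieldGrad_expField]
  simp_rw [fun j => pderiv_const_mul (x := x) j (stress lam mu (Matrix.vecMulVec η ξ) i j)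
    ((contDiff_exp_linearForm (n := 1) ξ).differentiable one_ne_zero x), pderiv_exp_linearForm]
  simp only [dotProduct, Fin.sum_univ_two] at hξη hξ
  simp only [stress_apply, Matrix.vecMulVec_apply, Fin.sum_univ_two, expField, Pi.smul_apply,
    smul_eq_mul]
  rw [← hξ]
  fin_cases i <;> simp
  · linear_combination (Complex.exp (ξ 0 * ((x 0 : ℝ) : ℂ) + ξ 1 * ((x 1 : ℝ) : ℂ)) *
      (lam + mu) * ξ 0) * hξη
  · linear_combination (Complex.exp (ξ 0 * ((x 0 : ℝ) : ℂ) + ξ 1 * ((x 1 : ℝ) : ℂ)) *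
      (lam + mu) * ξ 1) * hξη

lemma cgo_eq_expField (mu om τ : ℝ) (d dperp : Plane) :
    cgo mu om τ d dperp = expField (cgoXi mu om τ d dperp) (cgoEta mu om τ d dperp) := rfl

/-- The two square roots differ by the factor `τ`, so `ξ · η = i (√(κ_s² + τ²) - τ √(1 + κ_s²/τ²)) =
0`: the field is a shear wave and only `μ` enters. Moreover `ξ · ξ = τ² - (κ_s² + τ²) = -κ_s²` and
`μ κ_s² = ω²`. -/
lemma cgo_algebra {mu om τ : ℝ} (hmu : 0 < mu) (hτ : 0 < τ) {d dperp : Plane} (hd : ‖d‖ = 1)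
    (hdp : ‖dperp‖ = 1) (ho : inner ℝ d dperp = 0) :
    cgoXi mu om τ d dperp ⬝ᵥ cgoEta mu om τ d dperp = 0 ∧
      mu * (cgoXi mu om τ d dperp ⬝ᵥ cgoXi mu om τ d dperp) = -(om : ℂ) ^ 2 := by
  have e1 : (d 0 : ℝ) ^ 2 + (d 1 : ℝ) ^ 2 = (1 : ℝ) := by
    have := EuclideanSpace.norm_sq_eq d
    rw [hd, Fin.sum_univ_two] at this; simpa using this.symm
  have e2 : (dperp 0 : ℝ) ^ 2 + (dperp 1 : ℝ) ^ 2 = (1 : ℝ) := by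
    have := EuclideanSpace.norm_sq_eq dperp
    rw [hdp, Fin.sum_univ_two] at this; simpa using this.symm
  have e3 : (d 0 : ℝ) * (dperp 0 : ℝ) + (d 1 : ℝ) * (dperp 1 : ℝ) = (0 : ℝ) := by
    rw [PiLp.inner_apply, Fin.sum_univ_two] at ho
    simp only [RCLike.inner_apply, conj_trivial] at ho
    linarith
  set K := kappaS mu om with hK
  have hK2 : mu * K ^ 2 = om ^ 2 := by
    rw [hK, kappaS, mul_pow, Real.sq_sqrt (by positivity)]; field_simp
  set A := Real.sqrt (K ^ 2 + τ ^ 2) with hA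
  set B := Real.sqrt (1 + K ^ 2 / τ ^ 2) with hB
  have hA2 : A ^ 2 = K ^ 2 + τ ^ 2 := Real.sq_sqrt (by positivity)
  have hAB : A = τ * B := by
    have : K ^ 2 + τ ^ 2 = τ ^ 2 * (1 + K ^ 2 / τ ^ 2) := by field_simp; ring
    rw [hA, this, Real.sqrt_mul (by positivity), Real.sqrt_sq hτ.le]
  have c1 : ((d 0 : ℝ) : ℂ) ^ 2 + ((d 1 : ℝ) : ℂ) ^ 2 = 1 := by exact_mod_cast e1
  have c2 : ((dperp 0 : ℝ) : ℂ) ^ 2 + ((dperp 1 : ℝ) : ℂ) ^ 2 = 1 := by exact_mod_cast e2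
  have c3 : ((d 0 : ℝ) : ℂ) * ((dperp 0 : ℝ) : ℂ) + ((d 1 : ℝ) : ℂ) * ((dperp 1 : ℝ) : ℂ) = 0 := by
    exact_mod_cast e3
  have cA : (A : ℂ) ^ 2 = (K : ℂ) ^ 2 + (τ : ℂ) ^ 2 := by exact_mod_cast hA2
  have cK : (mu : ℂ) * (K : ℂ) ^ 2 = (om : ℂ) ^ 2 := by exact_mod_cast hK2
  have cAB : (A : ℂ) = τ * B := by exact_mod_cast hAB
  simp only [cgoXi, cgoEta, dotProduct, Fin.sum_univ_two, ← hK, ← hA, ← hB]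
  constructor
  · linear_combination (τ - Complex.I ^ 2 * A * B) * c3 - Complex.I * B * τ * c1 +
      Complex.I * A * c2 + Complex.I * cAB
  · linear_combination (mu * τ ^ 2) * c1 + mu * Complex.I ^ 2 * A ^ 2 * c2 +
      mu * 2 * τ * Complex.I * A * c3 + mu * A ^ 2 * Complex.I_sq - mu * cA - cK


/-! ### The traction pairing on the arc -/

lemma edge_subset_frontier (H : IsConvexSector θmin θmax h) {θ : ℝ} (hθ : θ ∈ Icc θmin θmax)
    (hθ' : θ ∉ Ioo θmin θmax) :
    edge θ h ⊆ frontier (sectorDisk θmin θmax h) \ arc θmin θmax h := by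
  rintro x ⟨r, hr, hrh, rfl⟩
  have hpi : θ ∈ Ioo (-Real.pi) Real.pi := ⟨H.hmin.trans_le hθ.1, hθ.2.trans_lt H.hmax⟩
  refine ⟨?_, fun hx => ?_⟩
  · rw [frontier, (isOpen_sectorDisk H).interior_eq]
    refine ⟨?_, fun hx => hθ' ((smul_unitDir_mem_sectorDisk_iff H hr hpi).1 hx).2⟩
    have h1 : θ ∈ closure (Ioo θmin θmax) := by rwa [closure_Ioo H.hlt.ne]
    have h2 := image_closure_subset_closure_image (s := Ioo θmin θmax)
      (continuous_smul_unitDir r) (mem_image_of_mem _ h1)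
    refine closure_mono ?_ h2
    rintro _ ⟨t, ht, rfl⟩
    exact (smul_unitDir_mem_sectorDisk_iff H hr
      ⟨H.hmin.trans ht.1, ht.2.trans H.hmax⟩).2 ⟨hrh, ht⟩
  · have := norm_of_mem_arc hx
    rw [norm_smul_unitDir hr.le] at this
    exact hrh.ne this

lemma IsBoundaryTest.eq_zero_on_edge (H : IsConvexSector θmin θmax h) {φ : Plane → CVec}
    (hφ : IsBoundaryTest (sectorDisk θmin θmax h) (arc θmin θmax h) φ) {θ : ℝ}
    (hθ : θ ∈ Icc θmin θmax) (hθ' : θ ∉ Ioo θmin θmax) : ∀ x ∈ edge θ h, φ x = 0 :=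
  fun _ hx => image_eq_zero_of_notMem_tsupport fun hx' =>
    Set.disjoint_left.1 hφ.2.2 hx' (edge_subset_frontier H hθ hθ' hx)

/-- The edge tractions of `v - w` are `-g₁` and `-g₂`, so adding the integrals of `g₁` and `g₂`
removes the edges from Green's formula. Boundedness is the trace inequality, dependence on the arc
alone is `hE`, and fields vanishing near the rest of the boundary do not see the edges at all. -/
theorem isTractionPairing_arc (H : IsConvexSector θmin θmax h) {v w g₁ g₂ : Plane → CVec}
    (hv : MemH1 (sectorDisk θmin θmax h) v) (hw : MemH1 (sectorDisk θmin θmax h) w)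
    (hg₁ : ∀ i, MemLp (fun x => g₁ x i) 2 (edgeMeasure θmax h))
    (hg₂ : ∀ i, MemLp (fun x => g₂ x i) 2 (edgeMeasure θmin h))
    (hE : ∀ φ : Plane → CVec, ContDiff ℝ ∞ φ → (∀ x ∈ arc θmin θmax h, φ x = 0) →
      EdgePairing lam mu om θmin θmax h (fun x => w x - v x) g₁ g₂ φ) :
    IsTractionPairing lam mu om (sectorDisk θmin θmax h) (arc θmin θmax h)
      (fun x => v x - w x) fun φ =>
        lameForm lam mu om (sectorDisk θmin θmax h) (fun x => v x - w x) φ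
        + ((∫ x, g₁ x ⬝ᵥ φ x ∂(edgeMeasure θmax h)) + ∫ x, g₂ x ⬝ᵥ φ x ∂(edgeMeasure θmin h)) := by
  have hU := isOpen_sectorDisk H
  have hB := isBallMeasure_sectorDisk H
  have hE₁ := isBallMeasure_edge θmax h
  have hE₂ := isBallMeasure_edge θmin h
  have hu : MemH1 (sectorDisk θmin θmax h) fun x => v x - w x := hv.sub hB hw
  have le1 : (1 : WithTop ℕ∞) ≤ ∞ := by norm_num
  constructor
  · intro φ ψ hφ hψ
    rw [lameForm_add hB hu (hφ.of_le le1) (hψ.of_le le1)]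
    simp_rw [dotProduct_add]
    rw [integral_add (integrable_dotProduct hE₁ hg₁ hφ.continuous)
        (integrable_dotProduct hE₁ hg₁ hψ.continuous),
      integral_add (integrable_dotProduct hE₂ hg₂ hφ.continuous)
        (integrable_dotProduct hE₂ hg₂ hψ.continuous)]
    ring
  · intro c φ hφ
    rw [lameForm_smul hB hu (hφ.of_le le1)]
    simp_rw [dotProduct_smul, smul_eq_mul, integral_const_mul]
    ring
  · obtain ⟨C₀, h0⟩ := norm_lameForm_le (lam := lam) (mu := mu) (om := om) hB hu
    obtain ⟨C₁, h1⟩ := norm_integral_dotProduct_le hB hE₁ (traceBounded_edges H).1 hg₁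
    obtain ⟨C₂, h2⟩ := norm_integral_dotProduct_le hB hE₂ (traceBounded_edges H).2 hg₂
    refine ⟨C₀ + (C₁ + C₂), fun φ hφ => ?_⟩
    rw [add_mul, add_mul]
    exact (norm_add_le _ _).trans (add_le_add (h0 φ (hφ.of_le le1))
      ((norm_add_le _ _).trans (add_le_add (h1 φ (hφ.of_le le1)) (h2 φ (hφ.of_le le1)))))
  · intro φ hφ h0
    have e := hE φ hφ h0
    unfold EdgePairing at e
    rw [lameForm_sub hU hB hv hw (hφ.of_le le1)] at e
    rw [lameForm_sub hU hB hw hv (hφ.of_le le1)]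
    linear_combination -e
  · intro φ hφ
    rw [integral_dotProduct_eq_zero_of_edge (hφ.eq_zero_on_edge H ⟨H.hlt.le, le_rfl⟩
        (fun hx => lt_irrefl _ hx.2)),
      integral_dotProduct_eq_zero_of_edge (hφ.eq_zero_on_edge H ⟨le_rfl, H.hlt.le⟩
        (fun hx => lt_irrefl _ hx.1)), add_zero, add_zero]

/-! ### The integral identity -/

lemma dotProduct_integral {σ : Measure Plane} (hσ : IsBallMeasure h σ) {φ : Plane → CVec}
    (hφ : Continuous φ) (c : CVec) : c ⬝ᵥ (∫ x, φ x ∂σ) = ∫ x, c ⬝ᵥ φ x ∂σ := by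
  have hc : ∀ i, Integrable (fun x => φ x i) σ := fun i =>
    hσ.integrable ((continuous_apply i).comp hφ)
  simp only [dotProduct]
  rw [integral_finsetSum _ fun i _ => (hc i).const_mul _]
  refine Finset.sum_congr rfl fun i _ => ?_
  rw [eval_integral hc, integral_const_mul]

lemma integral_dotProduct_sub_const {σ : Measure Plane} (hσ : IsBallMeasure h σ)
    {φ f : Plane → CVec} (hφ : Continuous φ) (hf : ∀ i, MemLp (fun x => f x i) 2 σ) (c : CVec) :
    ∫ x, (f x - c) ⬝ᵥ φ x ∂σ = (∫ x, f x ⬝ᵥ φ x ∂σ) - c ⬝ᵥ ∫ x, φ x ∂σ := by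
  have hfin := hσ.finite
  simp_rw [sub_dotProduct]
  rw [dotProduct_integral hσ hφ, integral_sub (integrable_dotProduct hσ hf hφ)
    (integrable_dotProduct hσ (fun i => memLp_const (c i)) hφ)]

lemma continuous_traction {ψ : Plane → CVec} (hψ : ContDiff ℝ 1 ψ) (ν : Plane) :
    Continuous (traction lam mu ν ψ) := by
  have hg := fun i j => continuous_fieldGrad hψ i j
  refine continuous_pi fun i => ?_
  simp only [traction, Matrix.mulVec, dotProduct, stress_apply]
  fun_prop

/-- The integral identity for a smooth field `ψ` with `Δ* ψ + ω² ψ = 0`. -/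
theorem corner_identity (H : IsConvexSector θmin θmax h)
    {v w f₁ f₂ g₁ g₂ t ψ : Plane → CVec} (hv : MemH1 (sectorDisk θmin θmax h) v)
    (hw : MemH1 (sectorDisk θmin θmax h) w)
    (hf₁ : ∀ i, MemLp (fun x => f₁ x i) 2 (edgeMeasure θmax h))
    (hf₂ : ∀ i, MemLp (fun x => f₂ x i) 2 (edgeMeasure θmin h))
    (hg₁ : ∀ i, MemLp (fun x => g₁ x i) 2 (edgeMeasure θmax h))
    (hg₂ : ∀ i, MemLp (fun x => g₂ x i) 2 (edgeMeasure θmin h))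
    (hψ : ContDiff ℝ 1 ψ)
    (hB : lameForm lam mu om (sectorDisk θmin θmax h) (fun x => w x - v x) ψ =
      (∫ x, traction lam mu (normalMax θmax) ψ x ⬝ᵥ f₁ x ∂(edgeMeasure θmax h))
      + (∫ x, traction lam mu (normalMin θmin) ψ x ⬝ᵥ f₂ x ∂(edgeMeasure θmin h))
      + ∫ x, traction lam mu (h⁻¹ • x) ψ x ⬝ᵥ t x ∂(arcMeasure θmin θmax h)) :
    g₁ 0 ⬝ᵥ (∫ x, ψ x ∂(edgeMeasure θmax h)) + g₂ 0 ⬝ᵥ (∫ x, ψ x ∂(edgeMeasure θmin h))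
      - f₁ 0 ⬝ᵥ (∫ x, traction lam mu (normalMax θmax) ψ x ∂(edgeMeasure θmax h))
      - f₂ 0 ⬝ᵥ (∫ x, traction lam mu (normalMin θmin) ψ x ∂(edgeMeasure θmin h))
    = (∫ x, traction lam mu (normalMax θmax) ψ x ⬝ᵥ (f₁ x - f₁ 0) ∂(edgeMeasure θmax h))
      - (∫ x, (g₁ x - g₁ 0) ⬝ᵥ ψ x ∂(edgeMeasure θmax h))
      + (∫ x, traction lam mu (normalMin θmin) ψ x ⬝ᵥ (f₂ x - f₂ 0) ∂(edgeMeasure θmin h))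
      - (∫ x, (g₂ x - g₂ 0) ⬝ᵥ ψ x ∂(edgeMeasure θmin h))
      + (lameForm lam mu om (sectorDisk θmin θmax h) (fun x => v x - w x) ψ
        + ((∫ x, g₁ x ⬝ᵥ ψ x ∂(edgeMeasure θmax h)) + ∫ x, g₂ x ⬝ᵥ ψ x ∂(edgeMeasure θmin h))
        - ∫ x, traction lam mu (h⁻¹ • x) ψ x ⬝ᵥ -t x ∂(arcMeasure θmin θmax h)) := by
  have hE₁ := isBallMeasure_edge θmax h
  have hE₂ := isBallMeasure_edge θmin h
  have c₁ := continuous_traction (lam := lam) (mu := mu) hψ (normalMax θmax)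
  have c₂ := continuous_traction (lam := lam) (mu := mu) hψ (normalMin θmin)
  have e₁ := integral_dotProduct_sub_const hE₁ c₁ hf₁ (f₁ 0)
  have e₂ := integral_dotProduct_sub_const hE₂ c₂ hf₂ (f₂ 0)
  have e₃ := integral_dotProduct_sub_const hE₁ hψ.continuous hg₁ (g₁ 0)
  have e₄ := integral_dotProduct_sub_const hE₂ hψ.continuous hg₂ (g₂ 0)
  rw [lameForm_sub (isOpen_sectorDisk H) (isBallMeasure_sectorDisk H) hv hw hψ] at hB
  rw [lameForm_sub (isOpen_sectorDisk H) (isBallMeasure_sectorDisk H) hw hv hψ, e₃, e₄]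
  simp_rw [dotProduct_comm (traction lam mu _ ψ _) (_ : CVec)] at hB ⊢
  rw [e₁, e₂]
  simp_rw [neg_dotProduct, integral_neg]
  linear_combination hB


/-! ### Concentration at the corner -/

lemma exists_bound_pow_mul_exp (p : ℕ) {c : ℝ} (hc : 0 < c) :
    ∃ C, 0 ≤ C ∧ ∀ s, 0 ≤ s → Real.exp (-(c * s)) ≤ C / (1 + s) ^ p := by
  -- One term of the exponential series at `c (1 + s)` bounds `(c (1 + s))^p / p!`; the shift by `1`
  -- costs the factor `e^c`.
  refine ⟨p.factorial / c ^ p * Real.exp c, by positivity, fun s hs => ?_⟩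
  have h1 := Real.pow_div_factorial_le_exp (c * (1 + s)) (by positivity) p
  have hp : (0 : ℝ) < p.factorial := by positivity
  rw [mul_pow, div_le_iff₀ hp] at h1
  have h2 : Real.exp (-(c * s)) * Real.exp (c * (1 + s)) = Real.exp c := by
    rw [← Real.exp_add]; congr 1; ring
  rw [le_div_iff₀ (by positivity), div_mul_eq_mul_div, le_div_iff₀ (by positivity)]
  calc Real.exp (-(c * s)) * (1 + s) ^ p * c ^ p
      = Real.exp (-(c * s)) * (c ^ p * (1 + s) ^ p) := by ring
    _ ≤ Real.exp (-(c * s)) * (Real.exp (c * (1 + s)) * p.factorial) := by gcongr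
    _ = p.factorial * Real.exp c := by rw [← h2]; ring

/-- The kernels `N m(N r)` concentrate at `r = 0`. -/
lemma tendsto_integral_concentrate (hh : 0 < h) {k m : ℝ → ℂ} {M : ℝ}
    (hk : ContinuousOn k (Ico 0 h)) (hM : ∀ r ∈ Ico 0 h, ‖k r‖ ≤ M)
    (hm : IntegrableOn m (Ioi 0)) :
    Tendsto (fun n : ℕ => ((n + 1 : ℝ) : ℂ) * ∫ r in Ioo 0 h, k r * m ((n + 1 : ℝ) * r)) atTop
      (𝓝 (k 0 * ∫ s in Ioi 0, m s)) := by
  have hM0 : 0 ≤ M := (norm_nonneg _).trans (hM 0 ⟨le_rfl, hh⟩)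
  -- Substituting `s = N r` turns the kernel into the fixed function `m` and `k` into its dilation,
  -- extended by zero to the half-line. The limit is then dominated by `M |m|`.
  have e : ∀ n : ℕ, ((n + 1 : ℝ) : ℂ) * ∫ r in Ioo 0 h, k r * m ((n + 1 : ℝ) * r) =
      ∫ s in Ioi 0, (Ioo 0 ((n + 1 : ℝ) * h)).indicator (fun s => k ((n + 1 : ℝ)⁻¹ * s)) s * m s := by
    intro n
    have hN : (0 : ℝ) < n + 1 := by positivity
    have h1 := integral_comp_mul_left_Ioi (fun s : ℝ => (Ioo 0 ((n + 1 : ℝ) * h)).indicator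
      (fun s => k ((n + 1 : ℝ)⁻¹ * s)) s * m s) 0 hN
    rw [mul_zero] at h1
    have h2 : ∫ r in Ioo 0 h, k r * m ((n + 1 : ℝ) * r) = ∫ r in Ioi 0,
        (Ioo 0 ((n + 1 : ℝ) * h)).indicator (fun s => k ((n + 1 : ℝ)⁻¹ * s)) ((n + 1 : ℝ) * r)
          * m ((n + 1 : ℝ) * r) := by
      rw [← integral_indicator measurableSet_Ioo, ← integral_indicator measurableSet_Ioi]
      congr 1 with r
      by_cases hr : r ∈ Ioo 0 h
      · have hr' : (n + 1 : ℝ) * r ∈ Ioo 0 ((n + 1 : ℝ) * h) :=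
          ⟨mul_pos hN hr.1, mul_lt_mul_of_pos_left hr.2 hN⟩
        rw [indicator_of_mem hr, indicator_of_mem (show r ∈ Ioi 0 from hr.1), indicator_of_mem hr',
          inv_mul_cancel_left₀ hN.ne']
      · have hr' : (n + 1 : ℝ) * r ∉ Ioo 0 ((n + 1 : ℝ) * h) := fun h' =>
          hr ⟨pos_of_mul_pos_right h'.1 hN.le, lt_of_mul_lt_mul_left h'.2 hN.le⟩
        rw [indicator_of_notMem hr]
        simp only [indicator, if_neg hr', zero_mul, ite_self]
    rw [h2, h1, Complex.real_smul, ← mul_assoc, ← Complex.ofReal_mul, mul_inv_cancel₀ hN.ne',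
      Complex.ofReal_one, one_mul]
  simp_rw [e]
  rw [← integral_const_mul]
  refine tendsto_integral_of_dominated_convergence (fun s => M * ‖m s‖) (fun n => ?_)
    (hm.norm.const_mul M) (fun n => .of_forall fun s => ?_) ?_
  · have hN : (0 : ℝ) < n + 1 := by positivity
    refine AEStronglyMeasurable.mul ?_ hm.1
    refine ((aestronglyMeasurable_indicator_iff measurableSet_Ioo).2
      (ContinuousOn.aestronglyMeasurable ?_ measurableSet_Ioo)).restrict
    refine hk.comp (by fun_prop) fun s hs => ⟨by have := hs.1; positivity, ?_⟩
    rw [inv_mul_lt_iff₀ hN]; exact hs.2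
  · rw [norm_mul]
    gcongr
    have hN : (0 : ℝ) < n + 1 := by positivity
    by_cases hs : s ∈ Ioo 0 ((n + 1 : ℝ) * h)
    · rw [indicator_of_mem hs]
      refine hM _ ⟨by have := hs.1; positivity, ?_⟩
      rw [inv_mul_lt_iff₀ hN]; exact hs.2
    · rwa [indicator_of_notMem hs, norm_zero]
  · refine (ae_restrict_mem measurableSet_Ioi).mono fun s hs => ?_
    refine Tendsto.mul_const _ ?_
    have h0 : Tendsto (fun n : ℕ => (n + 1 : ℝ)⁻¹ * s) atTop (𝓝 0) := by
      simpa using tendsto_natCast_add_one.inv_tendsto_atTop.mul_const s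
    have h1 : Tendsto (fun n : ℕ => (n + 1 : ℝ)⁻¹ * s) atTop (𝓝[Ico 0 h] 0) :=
      tendsto_nhdsWithin_iff.2 ⟨h0, by
        filter_upwards [h0.eventually_lt_const hh] with n hn
        exact ⟨by have : (0 : ℝ) < s := hs
                  positivity, hn⟩⟩
    have h2 := (hk 0 ⟨le_rfl, hh⟩).tendsto.comp h1
    refine h2.congr' ?_
    filter_upwards [h0.eventually_lt_const hh] with n hn
    have hN : (0 : ℝ) < n + 1 := by positivity
    rw [inv_mul_lt_iff₀ hN] at hn
    rw [indicator_of_mem (show s ∈ Ioo 0 ((n + 1 : ℝ) * h) from ⟨hs, hn⟩)]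
    rfl

/-! ### Traces on the two edges agree at the corner -/

/-- With `s = N|x|`, the inequality `s² ≥ 2s - 1` replaces the Gaussian by `e · e^{-2s}`. Decay of
order four is asked for because the factor `|x|` consumes one power. The `+ 0` in the exponent
matches the affine form of `pderiv_affine_norm_sq`. -/
lemma norm_gaussian_kernel_le : ∃ C, ∀ (n : ℕ) (x : Plane) (j : Fin 2),
    ‖((n + 1 : ℝ) ^ 2 : ℂ) * (((x j : ℝ) : ℂ) *
      Complex.exp ((-(n + 1 : ℝ) ^ 2 * ‖x‖ ^ 2 + 0 : ℝ) : ℂ))‖ ≤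
      C * ((n + 1 : ℝ) / (1 + (n + 1 : ℝ) * ‖x‖) ^ 3) := by
  obtain ⟨C, hC0, hC⟩ := exists_bound_pow_mul_exp 4 (c := 2) (by norm_num)
  refine ⟨Real.exp 1 * C, fun n x j => ?_⟩
  have hN : (0 : ℝ) < n + 1 := by positivity
  set N : ℝ := n + 1 with hNdef
  have e1 : ‖((N : ℂ) ^ 2)‖ = N ^ 2 := by
    rw [norm_pow, Complex.norm_real, Real.norm_of_nonneg hN.le]
  rw [norm_mul, norm_mul, e1, Complex.norm_exp_ofReal]
  set s := N * ‖x‖ with hs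
  have hs0 : 0 ≤ s := by positivity
  have h1 : Real.exp (-N ^ 2 * ‖x‖ ^ 2 + 0) ≤ Real.exp 1 * (C / (1 + s) ^ 4) := by
    refine le_trans ?_ (mul_le_mul_of_nonneg_left (hC s hs0) (Real.exp_pos 1).le)
    rw [← Real.exp_add, Real.exp_le_exp, hs]
    nlinarith [sq_nonneg (N * ‖x‖ - 1)]
  calc N ^ 2 * (‖((x j : ℝ) : ℂ)‖ * Real.exp (-N ^ 2 * ‖x‖ ^ 2 + 0))
      ≤ N ^ 2 * (‖x‖ * (Real.exp 1 * (C / (1 + s) ^ 4))) := by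
        gcongr; exact norm_coord_le x j
    _ = Real.exp 1 * C * N * (s / (1 + s) ^ 4) := by rw [hs]; ring
    _ ≤ Real.exp 1 * C * N * ((1 + s) / (1 + s) ^ 4) := by gcongr; linarith
    _ = Real.exp 1 * C * (N / (1 + s) ^ 3) := by field_simp

/-- The test fields `F n` are `N² e^{-N²|x|²}` times the rotation field `(-x₂, x₁)`. They are
divergence free, which removes `u`, and orthogonal to `x`, which removes the arc. On the two edges
their fluxes are `±N² r e^{-N² r²}`, kernels of mass one half concentrating at the corner. Since `F
n` tends weakly to zero in `L²`, the two corner values must cancel. -/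
lemma GreenFormula.corner_eq (H : IsConvexSector θmin θmax h) {u a₁ a₂ t : Plane → ℂ}
    {G : Fin 2 → Plane → ℂ}
    (hG : ∀ j, MemLp (G j) 2 (volume.restrict (sectorDisk θmin θmax h)))
    (hgreen : GreenFormula θmin θmax h u G a₁ a₂ t)
    (hc₁ : ContinuousOn (fun r : ℝ => a₁ (r • unitDir θmax)) (Ico 0 h))
    (hc₂ : ContinuousOn (fun r : ℝ => a₂ (r • unitDir θmin)) (Ico 0 h)) {M₁ M₂ : ℝ}
    (hM₁ : ∀ r ∈ Ico 0 h, ‖a₁ (r • unitDir θmax)‖ ≤ M₁)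
    (hM₂ : ∀ r ∈ Ico 0 h, ‖a₂ (r • unitDir θmin)‖ ≤ M₂) : a₁ 0 = a₂ 0 := by
  set E : ℕ → Plane → ℂ := fun n x =>
    Complex.exp ((-(n + 1 : ℝ) ^ 2 * ‖x‖ ^ 2 + 0 : ℝ) : ℂ) with hE
  set K : ℕ → Fin 2 → Plane → ℂ := fun n j x =>
    ((n + 1 : ℝ) ^ 2 : ℂ) * (((x j : ℝ) : ℂ) * E n x) with hK
  set F : ℕ → Fin 2 → Plane → ℂ := fun n => ![fun x => -K n 1 x, K n 0] with hF
  have sE : ∀ n, ContDiff ℝ 1 (E n) := fun n =>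
    (Complex.ofRealCLM.contDiff.comp ((contDiff_affine_norm_sq _ _).of_le (by norm_num))).cexp
  have sK : ∀ n j, ContDiff ℝ 1 (K n j) := fun n j =>
    contDiff_const.mul ((contDiff_coord j).mul (sE n))
  have sF : ∀ n j, ContDiff ℝ 1 (F n j) := fun n j => by
    fin_cases j
    · exact (sK n 1).neg
    · exact sK n 0
  have dE : ∀ n j x, pderiv j (E n) x =
      E n x * (((-(n + 1 : ℝ) ^ 2 : ℝ) : ℂ) * (2 * (x j : ℝ))) := fun n j x => by
    have hd : DifferentiableAt ℝ
        (fun y : Plane => ((-(n + 1 : ℝ) ^ 2 * ‖y‖ ^ 2 + 0 : ℝ) : ℂ)) x :=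
      Complex.ofRealCLM.differentiableAt.comp x
        ((contDiff_affine_norm_sq _ _).differentiable (by norm_num) x)
    rw [hE]
    rw [pderiv_cexp j hd, pderiv_affine_norm_sq]
  have dK : ∀ n i j x, i ≠ j → pderiv i (K n j) x = ((n + 1 : ℝ) ^ 2 : ℂ) * (((x j : ℝ) : ℂ) *
      (E n x * (((-(n + 1 : ℝ) ^ 2 : ℝ) : ℂ) * (2 * (x i : ℝ))))) := fun n i j x hij => by
    have d1 : DifferentiableAt ℝ (fun y : Plane => ((y j : ℝ) : ℂ)) x :=
      (contDiff_coord (n := 1) j).differentiable one_ne_zero x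
    have d2 := (sE n).differentiable one_ne_zero x
    change pderiv i (fun y => ((n + 1 : ℝ) ^ 2 : ℂ) * (((y j : ℝ) : ℂ) * E n y)) x = _
    rw [pderiv_const_mul (f := fun y => ((y j : ℝ) : ℂ) * E n y) i _ (d1.mul d2), pderiv_mul i d1 d2, pderiv_coord, dE]
    simp [hij.symm]
  have hdiv : ∀ n x, ∑ j, pderiv j (F n j) x = 0 := fun n x => by
    rw [Fin.sum_univ_two]
    simp only [hF, Matrix.cons_val_zero, Matrix.cons_val_one]
    rw [pderiv_neg, dK n 0 1 x (by decide), dK n 1 0 x (by decide)]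
    ring
  have lim0 : Tendsto (fun n => ∫ x in sectorDisk θmin θmax h, ∑ j, F n j x * G j x) atTop
      (𝓝 0) := by
    obtain ⟨C, hC⟩ := norm_gaussian_kernel_le
    have l : ∀ j, Tendsto (fun n => ∫ x in sectorDisk θmin θmax h, G j x * F n j x) atTop
        (𝓝 0) := fun j => tendsto_integral_mul_kernel H (hG j) (C := C) fun n x _ => by
      fin_cases j
      · change ‖-K n 1 x‖ ≤ _
        rw [norm_neg]; exact hC n x 1
      · exact hC n x 0
    have hs := tendsto_finsetSum Finset.univ fun j _ => l j
    rw [Finset.sum_const_zero] at hs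
    refine hs.congr fun n => ?_
    rw [← integral_finsetSum _ fun j _ => integrable_mul_of_memLp (hG j)
      ((isBallMeasure_sectorDisk H).memLp (sF n j).continuous 2)]
    simp_rw [mul_comm]
  have edgeval : ∀ (n : ℕ) (θ r : ℝ), 0 ≤ r → E n (r • unitDir θ) =
      Complex.exp (-1 * (((n + 1 : ℝ) * r : ℝ) : ℂ) ^ 2) := fun n θ r hr => by
    simp only [hE, norm_smul_unitDir hr]
    congr 1; push_cast; ring
  have hsc : ∀ θ : ℝ, Complex.sin θ ^ 2 + Complex.cos θ ^ 2 = 1 := fun θ =>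
    Complex.sin_sq_add_cos_sq θ
  set m : ℝ → ℂ := fun s => (s : ℂ) * Complex.exp (-1 * (s : ℂ) ^ 2) with hm
  have hmi : IntegrableOn m (Ioi 0) :=
    (integrable_mul_cexp_neg_mul_sq (b := 1) (by simp)).integrableOn
  have hmv : ∫ s in Ioi 0, m s = (2 * 1 : ℂ)⁻¹ := integral_mul_cexp_neg_mul_sq (b := 1) (by simp)
  have r₁ : ∀ n, ∫ x, (∑ j, ((normalMax θmax j : ℝ) : ℂ) * F n j x) * a₁ x ∂(edgeMeasure θmax h) =
      ((n + 1 : ℝ) : ℂ) * ∫ r in Ioo 0 h, a₁ (r • unitDir θmax) * m ((n + 1 : ℝ) * r) := fun n => by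
    rw [integral_edgeMeasure, ← integral_const_mul]
    refine setIntegral_congr_fun measurableSet_Ioo fun r hr => ?_
    simp only [Fin.sum_univ_two, hF, hK, Matrix.cons_val_zero, Matrix.cons_val_one,
      edgeval n θmax r hr.1.le, normalMax_zero, normalMax_one, PiLp.smul_apply, unitDir_zero,
      unitDir_one, smul_eq_mul, hm]
    push_cast
    linear_combination (a₁ (r • unitDir θmax) * ((n : ℂ) + 1) ^ 2 * r *
      Complex.exp (-1 * (((n : ℂ) + 1) * r) ^ 2)) * hsc θmax
  have r₂ : ∀ n, ∫ x, (∑ j, ((normalMin θmin j : ℝ) : ℂ) * F n j x) * a₂ x ∂(edgeMeasure θmin h) =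
      -(((n + 1 : ℝ) : ℂ) * ∫ r in Ioo 0 h, a₂ (r • unitDir θmin) * m ((n + 1 : ℝ) * r)) := fun n => by
    rw [integral_edgeMeasure, ← integral_const_mul, ← integral_neg]
    refine setIntegral_congr_fun measurableSet_Ioo fun r hr => ?_
    simp only [Fin.sum_univ_two, hF, hK, Matrix.cons_val_zero, Matrix.cons_val_one,
      edgeval n θmin r hr.1.le, normalMin_zero, normalMin_one, PiLp.smul_apply, unitDir_zero,
      unitDir_one, smul_eq_mul, hm]
    push_cast
    linear_combination -(a₂ (r • unitDir θmin) * ((n : ℂ) + 1) ^ 2 * r *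
      Complex.exp (-1 * (((n : ℂ) + 1) * r) ^ 2)) * hsc θmin
  have key : ∀ n, (∫ x in sectorDisk θmin θmax h, ∑ j, F n j x * G j x) =
      ((n + 1 : ℝ) : ℂ) * (∫ r in Ioo 0 h, a₁ (r • unitDir θmax) * m ((n + 1 : ℝ) * r)) -
      ((n + 1 : ℝ) : ℂ) * ∫ r in Ioo 0 h, a₂ (r • unitDir θmin) * m ((n + 1 : ℝ) * r) := fun n => by
    have h1 := hgreen (F n) (sF n)
    rw [r₁, r₂] at h1
    have h2 : ∫ x in sectorDisk θmin θmax h, (∑ j, pderiv j (F n j) x) * u x = 0 := by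
      simp [hdiv]
    have h3 : ∫ x, (∑ j, (((h⁻¹ • x) j : ℝ) : ℂ) * F n j x) * t x ∂(arcMeasure θmin θmax h) = 0 := by
      refine integral_eq_zero_of_ae (.of_forall fun x => ?_)
      simp only [Fin.sum_univ_two, hF, hK, Matrix.cons_val_zero, Matrix.cons_val_one,
        PiLp.smul_apply, smul_eq_mul, Pi.zero_apply]
      push_cast
      ring
    rw [h2, h3] at h1
    linear_combination h1
  have lim₁ := tendsto_integral_concentrate H.hh hc₁ hM₁ hmi
  have lim₂ := tendsto_integral_concentrate H.hh hc₂ hM₂ hmi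
  have := tendsto_nhds_unique (lim0.congr key) (lim₁.sub lim₂)
  rw [hmv, zero_smul, zero_smul, ← sub_mul] at this
  have h2 := (mul_eq_zero.1 this.symm).resolve_right (by norm_num)
  exact sub_eq_zero.1 h2


/-! ### Blow-up at the corner -/

/-- Constants have zero gradient and are their own traces. Subtracting the corner value makes the
edge displacements of order `o(r)` in the blow-up. -/
lemma GreenFormula.sub_const (H : IsConvexSector θmin θmax h) {u f₁ f₂ t : Plane → ℂ}
    {G : Fin 2 → Plane → ℂ} (hu : MemLp u 2 (volume.restrict (sectorDisk θmin θmax h)))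
    (hf₁ : MemLp f₁ 2 (edgeMeasure θmax h)) (hf₂ : MemLp f₂ 2 (edgeMeasure θmin h))
    (ht : MemLp t 2 (arcMeasure θmin θmax h)) (hG : GreenFormula θmin θmax h u G f₁ f₂ t) (c : ℂ) :
    GreenFormula θmin θmax h (fun x => u x - c) G (fun x => f₁ x - c) (fun x => f₂ x - c)
      fun x => t x - c := by
  intro F hF
  have h1 := hG F hF
  have h2 := greenFormula_of_contDiff H (contDiff_const (c := c)) F hF
  have key : ∀ {σ : Measure Plane} (_ : IsBallMeasure h σ) {k f : Plane → ℂ} (_ : Continuous k)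
      (_ : MemLp f 2 σ), ∫ x, k x * (f x - c) ∂σ = (∫ x, k x * f x ∂σ) - ∫ x, k x * c ∂σ := by
    intro σ hσ k f hk hf
    have := hσ.finite
    simp_rw [mul_sub]
    exact integral_sub (integrable_mul_of_memLp (hσ.memLp hk 2) hf)
      ((hσ.integrable hk).mul_const c)
  have c3 := fun j => (hF j).continuous
  have c4 := fun j => continuous_pderiv (hF j) j
  have c5 : ∀ j : Fin 2, Continuous fun x : Plane => (((h⁻¹ • x : Plane) j : ℝ) : ℂ) := fun j =>
    (contDiff_coord (n := 0) j).continuous.comp (continuous_const_smul _)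
  rw [key (isBallMeasure_sectorDisk H) (by fun_prop) hu,
    key (isBallMeasure_edge _ _) (by fun_prop) hf₁,
    key (isBallMeasure_edge _ _) (by fun_prop) hf₂,
    key (isBallMeasure_arc H) (by fun_prop) ht]
  simp only [pderiv_const, mul_zero, Finset.sum_const_zero, integral_zero, zero_add] at h2
  linear_combination h1 - h2

/-- A field `u` with square integrable displacements `f₁`, `f₂` and tractions `g₁`, `g₂` on the
edges and displacement `t` on the arc. -/
structure HasCauchyData (lam mu om θmin θmax h : ℝ) (u f₁ f₂ g₁ g₂ t : Plane → CVec) : Prop where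
  memH1 : MemH1 (sectorDisk θmin θmax h) u
  memLp_f₁ : ∀ i, MemLp (fun x => f₁ x i) 2 (edgeMeasure θmax h)
  memLp_f₂ : ∀ i, MemLp (fun x => f₂ x i) 2 (edgeMeasure θmin h)
  memLp_t : ∀ i, MemLp (fun x => t x i) 2 (arcMeasure θmin θmax h)
  green : ∀ i, GreenFormula θmin θmax h (fun x => u x i)
    (fun j x => weakGrad (sectorDisk θmin θmax h) u x i j) (fun x => f₁ x i) (fun x => f₂ x i)
    fun x => t x i
  pairing : ∀ φ : Plane → CVec, ContDiff ℝ ∞ φ → (∀ x ∈ arc θmin θmax h, φ x = 0) →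
    EdgePairing lam mu om θmin θmax h u g₁ g₂ φ

lemma fieldGrad_smul_comp_smul {χ : Plane → ℂ} {ψ : Plane → CVec} (hχ : ContDiff ℝ 1 χ)
    (hψ : ContDiff ℝ 1 ψ) (N : ℝ) (x : Plane) (i j : Fin 2) :
    fieldGrad (fun y => χ y • ψ (N • y)) x i j =
      pderiv j χ x * ψ (N • x) i + χ x * (N * fieldGrad ψ (N • x) i j) := by
  have hd := (contDiff_component hψ i).differentiable one_ne_zero
  have hd' : DifferentiableAt ℝ (fun y => ψ (N • y) i) x :=
    (hd (N • x)).comp x (differentiableAt_id.const_smul N)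
  have h1 : pderiv j (fun y => χ y * ψ (N • y) i) x = _ :=
    pderiv_mul j (hχ.differentiable one_ne_zero x) hd'
  simp only [fieldGrad, Matrix.of_apply, Pi.smul_apply, smul_eq_mul]
  rw [h1, pderiv_comp_smul hd]
  ring

lemma contDiff_stress_fieldGrad {ψ : Plane → CVec} (hψ : ContDiff ℝ ∞ ψ) (i j : Fin 2) :
    ContDiff ℝ 1 fun x => stress lam mu (fieldGrad ψ x) i j := by
  have hg : ∀ i j, ContDiff ℝ 1 fun x => fieldGrad ψ x i j := fun i j =>
    contDiff_pderiv (contDiff_component hψ i) (WithTop.coe_le_coe.2 le_top) j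
  simp_rw [stress_apply]
  exact ((contDiff_const.mul ((hg 0 0).add (hg 1 1))).mul contDiff_const).add
    (contDiff_const.mul ((hg i j).add (hg j i)))

/-- Green's formulas for `u` and for the rescaled field `ψ(N·)`, cut off by `χ`. -/
lemma HasCauchyData.blowup_identity (H : IsConvexSector θmin θmax h)
    {u f₁ f₂ g₁ g₂ t ψ : Plane → CVec} {χ : Plane → ℂ}
    (D : HasCauchyData lam mu om θmin θmax h u f₁ f₂ g₁ g₂ t) (hψ : ContDiff ℝ ∞ ψ)
    (hdiv : ∀ i x, ∑ j, pderiv j (fun y => stress lam mu (fieldGrad ψ y) i j) x = 0)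
    (hχ : ContDiff ℝ ∞ χ) (h0 : ∀ x ∈ arc θmin θmax h, χ x = 0) (N : ℝ) (c : CVec) :
    (∫ x, g₁ x ⬝ᵥ (χ x • ψ (N • x)) ∂(edgeMeasure θmax h))
      + (∫ x, g₂ x ⬝ᵥ (χ x • ψ (N • x)) ∂(edgeMeasure θmin h)) =
    (∑ i, ∑ j, ∫ x in sectorDisk θmin θmax h,
        stress lam mu (weakGrad (sectorDisk θmin θmax h) u x) i j *
          (pderiv j χ x * ψ (N • x) i))
      - (om : ℂ) ^ 2 * (∑ i, ∫ x in sectorDisk θmin θmax h, u x i * (χ x * ψ (N • x) i))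
      - (∑ i, ∫ x in sectorDisk θmin θmax h, (u x i - c i) *
          ∑ j, pderiv j χ x * (N * stress lam mu (fieldGrad ψ (N • x)) i j))
      + ∑ i, ((∫ x, (∑ j, (normalMax θmax j : ℂ) *
            (χ x * (N * stress lam mu (fieldGrad ψ (N • x)) i j))) * (f₁ x i - c i)
              ∂(edgeMeasure θmax h))
          + ∫ x, (∑ j, (normalMin θmin j : ℂ) *
            (χ x * (N * stress lam mu (fieldGrad ψ (N • x)) i j))) * (f₂ x i - c i)
              ∂(edgeMeasure θmin h)) := by
  have le1 : (1 : WithTop ℕ∞) ≤ ∞ := by norm_num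
  have hB := isBallMeasure_sectorDisk H
  have hs : ∀ {n : WithTop ℕ∞}, ContDiff ℝ n fun x : Plane => N • x := contDiff_const_smul N
  have hΦ : ContDiff ℝ ∞ fun x => χ x • ψ (N • x) := hχ.smul (hψ.comp hs)
  have cχ := hχ.continuous
  have cχ' := fun j => continuous_pderiv (hχ.of_le le1) j
  have cψ : ∀ i, Continuous fun x => ψ (N • x) i := fun i =>
    (contDiff_component (hψ.comp hs) i).continuous
  have cg : ∀ i j, Continuous fun x => fieldGrad ψ (N • x) i j := fun i j =>
    (continuous_fieldGrad (hψ.of_le le1) i j).comp (continuous_const_smul N)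
  have sS : ∀ i j, ContDiff ℝ 1 fun x => stress lam mu (fieldGrad ψ x) i j :=
    contDiff_stress_fieldGrad hψ
  have sS' : ∀ i j, ContDiff ℝ 1 fun x => stress lam mu (fieldGrad ψ (N • x)) i j := fun i j =>
    (sS i j).comp hs
  have sF : ∀ i j, ContDiff ℝ 1
      fun x => χ x * (N * stress lam mu (fieldGrad ψ (N • x)) i j) := fun i j =>
    (hχ.of_le le1).mul (contDiff_const.mul (sS' i j))
  have hp := D.pairing _ hΦ fun x hx => by rw [h0 x hx, zero_smul]
  unfold EdgePairing at hp
  rw [← hp, lameForm_eq_sum hB D.memH1 (hΦ.of_le le1)]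
  -- As `ψ` solves the static equations, and these are invariant under dilation, the divergence
  -- falls on the cutoff alone.
  have hdivF : ∀ i x, ∑ j, pderiv j (fun x => χ x *
      (N * stress lam mu (fieldGrad ψ (N • x)) i j)) x =
      ∑ j, pderiv j χ x * (N * stress lam mu (fieldGrad ψ (N • x)) i j) := by
    intro i x
    have e : ∀ j, pderiv j (fun x => χ x * (N * stress lam mu (fieldGrad ψ (N • x)) i j)) x =
        pderiv j χ x * (N * stress lam mu (fieldGrad ψ (N • x)) i j) + χ x * N ^ 2 *
          pderiv j (fun y => stress lam mu (fieldGrad ψ y) i j) (N • x) := by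
      intro j
      have d2 := (sS' i j).differentiable one_ne_zero x
      have h2 := pderiv_comp_smul ((sS i j).differentiable one_ne_zero) j N x
      refine (pderiv_mul j (hχ.differentiable (by norm_num) x) (d2.const_mul _)).trans ?_
      rw [pderiv_const_mul j _ d2, h2]
      ring
    rw [Finset.sum_congr rfl fun j _ => e j, Finset.sum_add_distrib, ← Finset.mul_sum, hdiv,
      mul_zero, add_zero]
  have hgr : ∀ i, (∫ x in sectorDisk θmin θmax h, ∑ j,
        (χ x * (N * stress lam mu (fieldGrad ψ (N • x)) i j)) *
          weakGrad (sectorDisk θmin θmax h) u x i j)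
      + (∫ x in sectorDisk θmin θmax h, (u x i - c i) *
          ∑ j, pderiv j χ x * (N * stress lam mu (fieldGrad ψ (N • x)) i j)) =
      (∫ x, (∑ j, (normalMax θmax j : ℂ) *
            (χ x * (N * stress lam mu (fieldGrad ψ (N • x)) i j))) * (f₁ x i - c i)
              ∂(edgeMeasure θmax h))
          + ∫ x, (∑ j, (normalMin θmin j : ℂ) *
            (χ x * (N * stress lam mu (fieldGrad ψ (N • x)) i j))) * (f₂ x i - c i)
              ∂(edgeMeasure θmin h) := by
    intro i
    have h1 := (D.green i).sub_const H (D.memH1.memLp i) (D.memLp_f₁ i) (D.memLp_f₂ i)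
      (D.memLp_t i) (c i) _ (sF i)
    have h2 : ∫ x, (∑ j, (((h⁻¹ • x : Plane) j : ℝ) : ℂ) *
        (χ x * (N * stress lam mu (fieldGrad ψ (N • x)) i j))) * (t x i - c i)
        ∂(arcMeasure θmin θmax h) = 0 := by
      refine integral_eq_zero_of_ae ((ae_arcMeasure H).mono fun x hx => ?_)
      simp [h0 x hx]
    rw [h2, add_zero] at h1
    rw [← h1]
    congr 1
    refine integral_congr_ae (.of_forall fun x => ?_)
    exact (mul_comm _ _).trans (congrArg (· * (u x i - c i)) (hdivF i x).symm)
  -- Once `χ` carries a factor `N`, the part with `N ∇ψ(N·)` has size `N²` at the corner, too large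
  -- for a weak limit against `∇u`. It is the part moved onto `u - c` by Green's formula.
  have split : ∀ i j, ∫ x in sectorDisk θmin θmax h,
      stress lam mu (weakGrad (sectorDisk θmin θmax h) u x) i j *
        fieldGrad (fun x => χ x • ψ (N • x)) x i j =
      (∫ x in sectorDisk θmin θmax h,
        stress lam mu (weakGrad (sectorDisk θmin θmax h) u x) i j *
          (pderiv j χ x * ψ (N • x) i)) +
      ∫ x in sectorDisk θmin θmax h,
        stress lam mu (weakGrad (sectorDisk θmin θmax h) u x) i j *
          (χ x * (N * fieldGrad ψ (N • x) i j)) := by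
    intro i j
    have m := D.memH1.memLp_stress (lam := lam) (mu := mu) i j
    refine Eq.trans (integral_congr_ae (.of_forall fun x => ?_)) (integral_add
      (integrable_mul_of_memLp m (hB.memLp ((cχ' j).mul (cψ i)) 2))
      (integrable_mul_of_memLp m (hB.memLp (cχ.mul (continuous_const.mul (cg i j))) 2)))
    beta_reduce
    rw [fieldGrad_smul_comp_smul (hχ.of_le le1) (hψ.of_le le1), mul_add]
  have symm : (∑ i, ∑ j, ∫ x in sectorDisk θmin θmax h,
        stress lam mu (weakGrad (sectorDisk θmin θmax h) u x) i j *
          (χ x * (N * fieldGrad ψ (N • x) i j))) =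
      ∑ i, ∫ x in sectorDisk θmin θmax h, ∑ j,
        (χ x * (N * stress lam mu (fieldGrad ψ (N • x)) i j)) *
          weakGrad (sectorDisk θmin θmax h) u x i j := by
    have i1 : ∀ i j, IntegrableOn (fun x =>
        stress lam mu (weakGrad (sectorDisk θmin θmax h) u x) i j *
          (χ x * (N * fieldGrad ψ (N • x) i j))) (sectorDisk θmin θmax h) := fun i j => by
      exact integrable_mul_of_memLp (D.memH1.memLp_stress i j)
        (hB.memLp (cχ.mul (continuous_const.mul (cg i j))) 2)
    have i2 : ∀ i, IntegrableOn (fun x => ∑ j,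
        (χ x * (N * stress lam mu (fieldGrad ψ (N • x)) i j)) *
          weakGrad (sectorDisk θmin θmax h) u x i j) (sectorDisk θmin θmax h) := fun i =>
      integrable_finsetSum _ fun j _ => integrable_mul_of_memLp
        (hB.memLp (sF i j).continuous 2) (D.memH1.memLp_weakGrad i j)
    refine (Finset.sum_congr rfl fun i _ => (integral_finsetSum _ fun j _ => i1 i j).symm).trans ?_
    refine (integral_finsetSum _ fun i _ => integrable_finsetSum _ fun j _ => i1 i j).symm.trans ?_
    refine Eq.trans ?_ (integral_finsetSum _ fun i _ => i2 i)
    refine integral_congr_ae (.of_forall fun x => ?_)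
    have e := stress_symm lam mu (weakGrad (sectorDisk θmin θmax h) u x) (fieldGrad ψ (N • x))
    simp only [Fin.sum_univ_two] at e ⊢
    linear_combination (χ x * N) * e
  rw [← Finset.sum_congr rfl fun i _ => hgr i, Finset.sum_add_distrib, ← symm]
  rw [Finset.sum_congr rfl fun i _ => Finset.sum_congr rfl fun j _ => split i j]
  simp only [Finset.sum_add_distrib, Pi.smul_apply, smul_eq_mul]
  ring


/-! ### Decay in the sector -/

/-- Decay of order four in the closed sector. -/
def SectorDecay (θmin θmax : ℝ) (φ : Plane → ℂ) : Prop :=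
  ∃ C, 0 ≤ C ∧ ∀ s, 0 ≤ s → ∀ θ ∈ Icc θmin θmax, ‖φ (s • unitDir θ)‖ ≤ C / (1 + s) ^ 4

lemma SectorDecay.add {φ ψ : Plane → ℂ} (hφ : SectorDecay θmin θmax φ)
    (hψ : SectorDecay θmin θmax ψ) : SectorDecay θmin θmax fun x => φ x + ψ x := by
  obtain ⟨A, hA0, hA⟩ := hφ
  obtain ⟨B, hB0, hB⟩ := hψ
  refine ⟨A + B, by positivity, fun s hs θ hθ => ?_⟩
  rw [add_div]
  exact (norm_add_le _ _).trans (add_le_add (hA s hs θ hθ) (hB s hs θ hθ))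

lemma SectorDecay.const_mul {φ : Plane → ℂ} (hφ : SectorDecay θmin θmax φ) (c : ℂ) :
    SectorDecay θmin θmax fun x => c * φ x := by
  obtain ⟨A, hA0, hA⟩ := hφ
  refine ⟨‖c‖ * A, by positivity, fun s hs θ hθ => ?_⟩
  rw [norm_mul, mul_div_assoc]
  exact mul_le_mul_of_nonneg_left (hA s hs θ hθ) (norm_nonneg c)

lemma SectorDecay.exists_bound {φ : Plane → ℂ} (hφ : SectorDecay θmin θmax φ) :
    ∃ C, 0 ≤ C ∧ ∀ N : ℝ, 0 ≤ N → ∀ x ∈ sectorDisk θmin θmax h,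
      ‖φ (N • x)‖ ≤ C / (1 + N * ‖x‖) ^ 4 := by
  obtain ⟨C, hC0, hC⟩ := hφ
  refine ⟨C, hC0, ?_⟩
  rintro N hN x ⟨⟨r, θ, hr, h1, h2, rfl⟩, -⟩
  rw [norm_smul_unitDir hr.le, smul_smul]
  exact hC _ (by positivity) θ ⟨h1.le, h2.le⟩

lemma SectorDecay.stress {lam mu : ℝ} {ψ : Plane → CVec}
    (hψ : ∀ i j, SectorDecay θmin θmax fun x => fieldGrad ψ x i j) (i j : Fin 2) :
    SectorDecay θmin θmax fun x => stress lam mu (fieldGrad ψ x) i j := by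
  simp_rw [stress_apply]
  refine SectorDecay.add ?_ (((hψ i j).add (hψ j i)).const_mul _)
  have := (((hψ 0 0).add (hψ 1 1)).const_mul (lam : ℂ)).const_mul (if i = j then 1 else 0)
  simpa only [mul_comm] using this

/-- The first moment is needed as well: the displacement terms concentrate with the kernel `s φ(s)`,
the traction terms with `φ(s)`. -/
lemma SectorDecay.integrableOn {φ : Plane → ℂ} (hφ : SectorDecay θmin θmax φ)
    (hc : Continuous φ) {θ : ℝ} (hθ : θ ∈ Icc θmin θmax) :
    IntegrableOn (fun s : ℝ => φ (s • unitDir θ)) (Ioi 0) ∧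
      IntegrableOn (fun s : ℝ => (s : ℂ) * φ (s • unitDir θ)) (Ioi 0) := by
  obtain ⟨C, hC0, hC⟩ := hφ
  have hi : IntegrableOn (fun s : ℝ => C * (1 + ‖s‖) ^ (-(2 : ℝ))) (Ioi 0) :=
    ((integrable_one_add_norm (E := ℝ) (r := 2) (by simp)).const_mul C).integrableOn
  have e : ∀ s : ℝ, 0 < s → C * (1 + ‖s‖) ^ (-(2 : ℝ)) = C / (1 + s) ^ 2 := fun s hs => by
    rw [Real.norm_of_nonneg hs.le, Real.rpow_neg (by positivity), div_eq_mul_inv,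
      show (2 : ℝ) = ((2 : ℕ) : ℝ) by norm_num, Real.rpow_natCast]
  have c1 : Continuous fun s : ℝ => φ (s • unitDir θ) := hc.comp (by fun_prop)
  constructor
  · refine hi.mono' c1.aestronglyMeasurable ((ae_restrict_mem measurableSet_Ioi).mono fun s hs => ?_)
    have hs' : (0 : ℝ) < s := hs
    rw [e s hs']
    refine (hC s hs'.le θ hθ).trans ?_
    gcongr
    · linarith
    · norm_num
  · refine hi.mono' (Complex.continuous_ofReal.mul c1).aestronglyMeasurable
      ((ae_restrict_mem measurableSet_Ioi).mono fun s hs => ?_)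
    have hs' : (0 : ℝ) < s := hs
    rw [e s hs', norm_mul, Complex.norm_real, Real.norm_of_nonneg hs'.le]
    calc s * ‖φ (s • unitDir θ)‖ ≤ (1 + s) ^ 2 * (C / (1 + s) ^ 4) := by
          gcongr
          · nlinarith
          · exact hC s hs'.le θ hθ
      _ = C / (1 + s) ^ 2 := by field_simp

/-! ### The quadratic cutoff and the limits of the edge terms -/

/-- The function `N (h² - |x|²)`. -/
noncomputable def arcCutoff (h N : ℝ) (x : Plane) : ℂ := ((-N * ‖x‖ ^ 2 + N * h ^ 2 : ℝ) : ℂ)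

lemma contDiff_arcCutoff (h N : ℝ) : ContDiff ℝ ∞ (arcCutoff h N) :=
  Complex.ofRealCLM.contDiff.comp (contDiff_affine_norm_sq _ _)

lemma arcCutoff_eq_zero {N : ℝ} {x : Plane} (hx : x ∈ arc θmin θmax h) : arcCutoff h N x = 0 := by
  rw [arcCutoff, norm_of_mem_arc hx]; simp

lemma arcCutoff_smul_unitDir {N r : ℝ} (hr : 0 ≤ r) (θ : ℝ) :
    arcCutoff h N (r • unitDir θ) = N * ((h ^ 2 - r ^ 2 : ℝ) : ℂ) := by
  rw [arcCutoff, norm_smul_unitDir hr]; push_cast; ring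

lemma norm_arcCutoff_le {N : ℝ} (hN : 0 ≤ N) {x : Plane} (hx : ‖x‖ < h) :
    ‖arcCutoff h N x‖ ≤ N * h ^ 2 := by
  have h1 : ‖x‖ ^ 2 ≤ h ^ 2 := by gcongr
  have h2 : -N * ‖x‖ ^ 2 + N * h ^ 2 = N * (h ^ 2 - ‖x‖ ^ 2) := by ring
  rw [arcCutoff, Complex.norm_real, h2, Real.norm_of_nonneg (mul_nonneg hN (by linarith))]
  gcongr
  linarith [sq_nonneg ‖x‖]

lemma norm_pderiv_arcCutoff_le {N : ℝ} (hN : 0 ≤ N) (j : Fin 2) (x : Plane) :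
    ‖pderiv j (arcCutoff h N) x‖ ≤ 2 * (N * ‖x‖) := by
  have h1 : pderiv j (arcCutoff h N) x = _ := pderiv_affine_norm_sq _ _ j x
  rw [h1, norm_mul, norm_mul, Complex.norm_real, Complex.norm_ofNat, norm_neg,
    Real.norm_of_nonneg hN]
  have := norm_coord_le x j
  nlinarith [mul_le_mul_of_nonneg_left this hN]

lemma continuousOn_sq_sub_mul {k : ℝ → ℂ} {M : ℝ} (hk : ContinuousOn k (Ico 0 h))
    (hM : ∀ r ∈ Ico 0 h, ‖k r‖ ≤ M) :
    ContinuousOn (fun r => ((h ^ 2 - r ^ 2 : ℝ) : ℂ) * k r) (Ico 0 h) ∧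
      ∀ r ∈ Ico 0 h, ‖((h ^ 2 - r ^ 2 : ℝ) : ℂ) * k r‖ ≤ h ^ 2 * M := by
  refine ⟨ContinuousOn.mul (by fun_prop) hk, fun r hr => ?_⟩
  have h1 : r ^ 2 ≤ h ^ 2 := pow_le_pow_left₀ hr.1 hr.2.le 2
  rw [norm_mul, Complex.norm_real, Real.norm_of_nonneg (by linarith)]
  have := sq_nonneg r
  exact mul_le_mul (by linarith) (hM r hr) (norm_nonneg _) (by positivity)

/-- The contribution of the traction on an edge in the blow-up limit. -/
lemma tendsto_integral_edge_traction (hh : 0 < h) {φ g : Plane → ℂ}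
    (hφ : SectorDecay θmin θmax φ) (hc : Continuous φ) {θ M : ℝ} (hθ : θ ∈ Icc θmin θmax)
    (hg : ContinuousOn (fun r : ℝ => g (r • unitDir θ)) (Ico 0 h))
    (hM : ∀ r ∈ Ico 0 h, ‖g (r • unitDir θ)‖ ≤ M) :
    Tendsto (fun n : ℕ => ∫ x, g x * (arcCutoff h (n + 1) x * φ ((n + 1 : ℝ) • x))
      ∂(edgeMeasure θ h)) atTop
      (𝓝 ((h : ℂ) ^ 2 * (g 0 * ∫ s in Ioi (0 : ℝ), φ (s • unitDir θ)))) := by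
  obtain ⟨h1, h2⟩ := continuousOn_sq_sub_mul hg hM
  -- The factor `N` in the cutoff is what normalises `φ(N·)` on a one-dimensional edge; the weight
  -- `h² - r²` joins the data and leaves `h²` in the limit.
  have := tendsto_integral_concentrate hh h1 h2 (hφ.integrableOn hc hθ).1
  have e : ((h ^ 2 - 0 ^ 2 : ℝ) : ℂ) * g ((0 : ℝ) • unitDir θ) = (h : ℂ) ^ 2 * g 0 := by
    rw [zero_smul]; push_cast; ring
  rw [e, mul_assoc] at this
  refine this.congr fun n => ?_
  rw [integral_edgeMeasure, ← integral_const_mul]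
  refine setIntegral_congr_fun measurableSet_Ioo fun r hr => ?_
  simp only [arcCutoff_smul_unitDir hr.1.le, smul_smul]
  ring

/-- The contribution of the displacement on an edge in the blow-up limit. -/
lemma tendsto_integral_edge_displacement (hh : 0 < h) {φ f : Plane → ℂ}
    (hφ : SectorDecay θmin θmax φ) (hc : Continuous φ) {θ M : ℝ} (hθ : θ ∈ Icc θmin θmax) {c : ℂ}
    (hf : ContinuousOn (fun r : ℝ => (r : ℂ)⁻¹ * (f (r • unitDir θ) - c)) (Ico 0 h))
    (hM : ∀ r ∈ Ico 0 h, ‖(r : ℂ)⁻¹ * (f (r • unitDir θ) - c)‖ ≤ M) :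
    Tendsto (fun n : ℕ => ∫ x,
      (arcCutoff h (n + 1) x * (((n + 1 : ℝ) : ℂ) * φ ((n + 1 : ℝ) • x))) * (f x - c)
      ∂(edgeMeasure θ h)) atTop (𝓝 0) := by
  obtain ⟨h1, h2⟩ := continuousOn_sq_sub_mul hf hM
  -- Write `f - c = r q(r)`: the integrand becomes `(h² - r²) q(r)` times `N · (N r) φ(N r)`. The
  -- limit is a multiple of the value of `q` at `0`, which is `0` by the convention `0⁻¹ = 0`.
  have := tendsto_integral_concentrate hh h1 h2 (hφ.integrableOn hc hθ).2
  simp only [Complex.ofReal_zero, inv_zero, zero_mul, mul_zero] at this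
  refine this.congr fun n => ?_
  rw [integral_edgeMeasure, ← integral_const_mul]
  refine setIntegral_congr_fun measurableSet_Ioo fun r hr => ?_
  have hr0 : (r : ℂ) ≠ 0 := by exact_mod_cast hr.1.ne'
  simp only [arcCutoff_smul_unitDir hr.1.le, smul_smul]
  push_cast
  field_simp

/-- At `r = 0` the quotient is `0` by the convention `0⁻¹ = 0`, so continuity there says precisely
that the difference quotients tend to zero, which is the vanishing of the edge derivative. The bound
is the Lipschitz estimate. -/
lemma IsC1Holder.quotient {θ : ℝ} {α : ℝ≥0} {f : Plane → CVec} (hh : 0 < h)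
    (hf : IsC1Holder θ h α f) (h0 : edgeDerivAtCorner θ h f = 0) (i : Fin 2) :
    ContinuousOn (fun r : ℝ => (r : ℂ)⁻¹ * (f (r • unitDir θ) i - f 0 i)) (Ico 0 h) ∧
      ∃ M, ∀ r ∈ Ico 0 h, ‖(r : ℂ)⁻¹ * (f (r • unitDir θ) i - f 0 i)‖ ≤ M := by
  have hmem : (0 : ℝ) ∈ Ico 0 h := ⟨le_rfl, hh⟩
  constructor
  · intro r hr
    rcases hr.1.eq_or_lt with rfl | hr0
    · have hd := (hf.1 0 hmem).hasDerivWithinAt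
      rw [show derivWithin (alongEdge θ f) (Ico 0 h) 0 = 0 from h0] at hd
      have hdi := hasDerivWithinAt_iff_tendsto_slope.1 (hasDerivWithinAt_pi.1 hd i)
      rw [← continuousWithinAt_sdiff_self]
      unfold ContinuousWithinAt
      simp only [Complex.ofReal_zero, inv_zero, zero_mul]
      refine hdi.congr fun r => ?_
      simp [slope, alongEdge, Complex.real_smul]
    · have hr0' : (r : ℂ) ≠ 0 := by exact_mod_cast hr0.ne'
      have c1 : ContinuousWithinAt (fun r : ℝ => f (r • unitDir θ) i) (Ico 0 h) r :=
        continuousWithinAt_pi.1 (hf.continuousOn r hr) i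
      exact (Complex.continuous_ofReal.continuousWithinAt.inv₀ hr0').mul
        (c1.sub continuousWithinAt_const)
  · obtain ⟨M, hM⟩ := hf.exists_lipschitz_bound
    refine ⟨|M|, fun r hr => ?_⟩
    rw [norm_mul, norm_inv, Complex.norm_real, Real.norm_of_nonneg hr.1]
    have h1 : ‖f (r • unitDir θ) i - f 0 i‖ ≤ M * r :=
      (norm_le_pi_norm (alongEdge θ f r - f 0) i).trans (hM r hr)
    rcases hr.1.eq_or_lt with rfl | hr0
    · simp
    · rw [inv_mul_le_iff₀ hr0, mul_comm]
      exact h1.trans (mul_le_mul_of_nonneg_right (le_abs_self M) hr.1)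

/-- The tractions at the corner are orthogonal to the decaying solutions `ψ` of the equations of
elasticity, if the displacements agree at the corner and have vanishing derivatives there. -/
theorem HasCauchyData.corner_orthogonality (H : IsConvexSector θmin θmax h)
    {u f₁ f₂ g₁ g₂ t ψ : Plane → CVec} {α₁ α₂ β₁ β₂ : ℝ≥0}
    (D : HasCauchyData lam mu om θmin θmax h u f₁ f₂ g₁ g₂ t)
    (hf₁ : IsC1Holder θmax h α₁ f₁) (hf₂ : IsC1Holder θmin h α₂ f₂)
    (hg₁ : IsHolder θmax h β₁ g₁) (hg₂ : IsHolder θmin h β₂ g₂) (hβ₁ : 0 < β₁) (hβ₂ : 0 < β₂)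
    (h0 : f₁ 0 = f₂ 0) (hd₁ : edgeDerivAtCorner θmax h f₁ = 0)
    (hd₂ : edgeDerivAtCorner θmin h f₂ = 0) (hψ : ContDiff ℝ ∞ ψ)
    (hdiv : ∀ i x, ∑ j, pderiv j (fun y => stress lam mu (fieldGrad ψ y) i j) x = 0)
    (hdec : ∀ i, SectorDecay θmin θmax fun x => ψ x i)
    (hdec' : ∀ i j, SectorDecay θmin θmax fun x => fieldGrad ψ x i j) :
    ∑ i, (g₁ 0 i * (∫ s in Ioi (0 : ℝ), ψ (s • unitDir θmax) i)
      + g₂ 0 i * ∫ s in Ioi (0 : ℝ), ψ (s • unitDir θmin) i) = 0 := by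
  have hh := H.hh
  have hB := isBallMeasure_sectorDisk H
  have hfin := hB.finite
  have mem₁ : θmax ∈ Icc θmin θmax := ⟨H.hlt.le, le_rfl⟩
  have mem₂ : θmin ∈ Icc θmin θmax := ⟨le_rfl, H.hlt.le⟩
  obtain ⟨M₁, hM₁⟩ := hg₁.exists_bound
  obtain ⟨M₂, hM₂⟩ := hg₂.exists_bound
  have cg₁ := hg₁.continuousOn hβ₁
  have cg₂ := hg₂.continuousOn hβ₂
  have cψ := fun i => (contDiff_component hψ i).continuous
  have cS := fun i j => (contDiff_stress_fieldGrad (lam := lam) (mu := mu) hψ i j).continuous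
  have dS := fun i j => SectorDecay.stress (lam := lam) (mu := mu) hdec' i j
  have cχ := fun n : ℕ => (contDiff_arcCutoff h (n + 1)).continuous
  have pos : ∀ n : ℕ, (0 : ℝ) < n + 1 := fun n => by positivity
  have pos' : ∀ (n : ℕ) (x : Plane), 0 < 1 + (n + 1 : ℝ) * ‖x‖ := fun n x => by positivity
  -- the tractions on the edges
  have limG : ∀ {θ M : ℝ} {g : Plane → CVec} (_ : θ ∈ Icc θmin θmax)
      (_ : ContinuousOn (alongEdge θ g) (Ico 0 h)) (_ : ∀ r ∈ Ico 0 h, ‖alongEdge θ g r‖ ≤ M),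
      Tendsto (fun n : ℕ => ∫ x, g x ⬝ᵥ (arcCutoff h (n + 1) x • ψ ((n + 1 : ℝ) • x))
        ∂(edgeMeasure θ h)) atTop
        (𝓝 (∑ i, (h : ℂ) ^ 2 * (g 0 i * ∫ s in Ioi (0 : ℝ), ψ (s • unitDir θ) i))) := by
    intro θ M g hθ hg hM
    have l := tendsto_finsetSum Finset.univ fun i _ => tendsto_integral_edge_traction hh (hdec i)
      (cψ i) hθ (g := fun x => g x i) (M := M) (continuousOn_pi.1 hg i)
      fun r hr => (norm_le_pi_norm _ i).trans (hM r hr)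
    refine l.congr fun n => ?_
    exact (integral_finsetSum _ fun i _ => integrable_mul_of_memLp (memLp_edge hg hM i)
      ((isBallMeasure_edge θ h).memLp ((cχ n).mul ((cψ i).comp (continuous_const_smul _))) 2)).symm
  -- the displacements on the edges
  have limF : ∀ {θ : ℝ} {ν : Plane} {f : Plane → CVec} {α : ℝ≥0} (_ : θ ∈ Icc θmin θmax)
      (_ : IsC1Holder θ h α f) (_ : edgeDerivAtCorner θ h f = 0) (i : Fin 2),
      Tendsto (fun n : ℕ => ∫ x, (∑ j, (ν j : ℂ) * (arcCutoff h (n + 1) x * (((n + 1 : ℝ) : ℂ) *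
        stress lam mu (fieldGrad ψ ((n + 1 : ℝ) • x)) i j))) * (f x i - f 0 i)
        ∂(edgeMeasure θ h)) atTop (𝓝 0) := by
    intro θ ν f α hθ hf hd i
    obtain ⟨hk, M, hM⟩ := hf.quotient hh hd i
    have hdecν : SectorDecay θmin θmax
        fun x => ∑ j, (ν j : ℂ) * stress lam mu (fieldGrad ψ x) i j := by
      simp only [Fin.sum_univ_two]
      exact ((dS i 0).const_mul _).add ((dS i 1).const_mul _)
    refine (tendsto_integral_edge_displacement hh (f := fun x => f x i) hdecν
      (continuous_finsetSum _ fun j _ => continuous_const.mul (cS i j)) hθ hk hM).congr fun n => ?_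
    refine integral_congr_ae (.of_forall fun x => ?_)
    simp only [Fin.sum_univ_two]
    ring
  -- the integrals over the sector
  have lim1 : ∀ i j, Tendsto (fun n : ℕ => ∫ x in sectorDisk θmin θmax h,
      stress lam mu (weakGrad (sectorDisk θmin θmax h) u x) i j *
        (pderiv j (arcCutoff h (n + 1)) x * ψ ((n + 1 : ℝ) • x) i)) atTop (𝓝 0) := by
    intro i j
    obtain ⟨C, hC0, hC⟩ := (hdec i).exists_bound (h := h)
    refine tendsto_integral_mul_kernel H (D.memH1.memLp_stress i j) (C := 2 * h * C)
      fun n x hx => ?_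
    have hxh := norm_lt_of_mem_sectorDisk hx
    have hp := pos' n x
    rw [norm_mul]
    calc _ ≤ 2 * ((n + 1 : ℝ) * h) * (C / (1 + (n + 1 : ℝ) * ‖x‖) ^ 4) := by
          gcongr
          · exact (norm_pderiv_arcCutoff_le (pos n).le j x).trans (by gcongr)
          · exact hC _ (pos n).le x hx
      _ = 2 * h * C * ((n + 1 : ℝ) / (1 + (n + 1 : ℝ) * ‖x‖) ^ 4) := by ring
      _ ≤ 2 * h * C * ((n + 1 : ℝ) / (1 + (n + 1 : ℝ) * ‖x‖) ^ 3) := by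
          gcongr
          · linarith [mul_nonneg (pos n).le (norm_nonneg x)]
          · norm_num
  have lim2 : ∀ i, Tendsto (fun n : ℕ => ∫ x in sectorDisk θmin θmax h,
      u x i * (arcCutoff h (n + 1) x * ψ ((n + 1 : ℝ) • x) i)) atTop (𝓝 0) := by
    intro i
    obtain ⟨C, hC0, hC⟩ := (hdec i).exists_bound (h := h)
    refine tendsto_integral_mul_kernel H (D.memH1.memLp i) (C := h ^ 2 * C) fun n x hx => ?_
    have hxh := norm_lt_of_mem_sectorDisk hx
    have hp := pos' n x
    rw [norm_mul]
    calc _ ≤ ((n + 1 : ℝ) * h ^ 2) * (C / (1 + (n + 1 : ℝ) * ‖x‖) ^ 4) := by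
          gcongr
          · exact norm_arcCutoff_le (pos n).le hxh
          · exact hC _ (pos n).le x hx
      _ = h ^ 2 * C * ((n + 1 : ℝ) / (1 + (n + 1 : ℝ) * ‖x‖) ^ 4) := by ring
      _ ≤ h ^ 2 * C * ((n + 1 : ℝ) / (1 + (n + 1 : ℝ) * ‖x‖) ^ 3) := by
          gcongr
          · linarith [mul_nonneg (pos n).le (norm_nonneg x)]
          · norm_num
  -- The gradient of the cutoff is at most `2N|x|` and the rescaled stress brings another `N`. One
  -- of the four orders of decay absorbs `N|x|`, leaving a kernel `N (1 + N|x|)⁻³`.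
  have lim3 : ∀ i, Tendsto (fun n : ℕ => ∫ x in sectorDisk θmin θmax h, (u x i - f₁ 0 i) *
      ∑ j, pderiv j (arcCutoff h (n + 1)) x *
        (((n + 1 : ℝ) : ℂ) * stress lam mu (fieldGrad ψ ((n + 1 : ℝ) • x)) i j))
      atTop (𝓝 0) := by
    intro i
    choose C hC0 hC using fun j => (dS i j).exists_bound (h := h)
    refine tendsto_integral_mul_kernel H ((D.memH1.memLp i).sub (memLp_const (f₁ 0 i)))
      (C := ∑ j, 2 * C j) fun n x hx => ?_
    have hp := pos' n x
    have hN := pos n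
    rw [Finset.sum_mul]
    refine (norm_sum_le _ _).trans (Finset.sum_le_sum fun j _ => ?_)
    rw [norm_mul, norm_mul, Complex.norm_real, Real.norm_of_nonneg hN.le]
    have := hC0 j
    calc _ ≤ 2 * ((n + 1 : ℝ) * ‖x‖) * ((n + 1 : ℝ) * (C j / (1 + (n + 1 : ℝ) * ‖x‖) ^ 4)) := by
          gcongr
          · exact norm_pderiv_arcCutoff_le hN.le j x
          · exact hC j _ hN.le x hx
      _ = 2 * C j * (((n + 1 : ℝ) * ‖x‖) * ((n + 1 : ℝ) / (1 + (n + 1 : ℝ) * ‖x‖) ^ 4)) := by ring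
      _ ≤ 2 * C j * ((1 + (n + 1 : ℝ) * ‖x‖) * ((n + 1 : ℝ) / (1 + (n + 1 : ℝ) * ‖x‖) ^ 4)) := by
          gcongr
          linarith
      _ = 2 * C j * ((n + 1 : ℝ) / (1 + (n + 1 : ℝ) * ‖x‖) ^ 3) := by field_simp
  have limL := (limG mem₁ cg₁ hM₁).add (limG mem₂ cg₂ hM₂)
  have limR := (((tendsto_finsetSum Finset.univ fun i _ => tendsto_finsetSum Finset.univ
    fun j _ => lim1 i j).sub ((tendsto_finsetSum Finset.univ fun i _ => lim2 i).const_mul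
      ((om : ℂ) ^ 2))).sub (tendsto_finsetSum Finset.univ fun i _ => lim3 i)).add
    (tendsto_finsetSum Finset.univ fun i _ =>
      (limF (ν := normalMax θmax) mem₁ hf₁ hd₁ i).add (limF (ν := normalMin θmin) mem₂ hf₂ hd₂ i))
  -- A single constant is subtracted from `u`, so the displacement terms vanish on both edges only
  -- because the two corner values agree.
  rw [← h0] at limR
  have key := tendsto_nhds_unique limL (limR.congr fun n =>
    (D.blowup_identity H hψ hdiv (contDiff_arcCutoff h (n + 1)) (fun x hx => arcCutoff_eq_zero hx)
      (n + 1) (f₁ 0)).symm)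
  simp only [Finset.sum_const_zero, mul_zero, sub_zero, add_zero] at key
  rw [← Finset.mul_sum, ← Finset.mul_sum, ← mul_add, ← Finset.sum_add_distrib] at key
  have hne : (h : ℂ) ^ 2 ≠ 0 := pow_ne_zero 2 (by exact_mod_cast hh.ne')
  exact (mul_eq_zero.1 key).resolve_left hne


/-! ### Decaying solutions of the equations of elasticity -/

/-- Integrate the derivative of `s e^{cs}` over the half-line. Both this function and its derivative
are integrable, so it tends to zero at infinity and the total is zero. -/
lemma integral_mul_exp_Ioi {c : ℂ} (hc : c.re < 0)
    (hi : IntegrableOn (fun s : ℝ => (s : ℂ) * Complex.exp (c * s)) (Ioi 0)) :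
    ∫ s in Ioi (0 : ℝ), (s : ℂ) * Complex.exp (c * s) = (c ^ 2)⁻¹ := by
  have hc0 : c ≠ 0 := by rintro rfl; simp at hc
  have hi' := integrableOn_exp_mul_complex_Ioi hc 0
  have hd : ∀ s : ℝ, HasDerivAt (fun s : ℝ => (s : ℂ) * Complex.exp (c * s))
      (Complex.exp (c * s) + c * ((s : ℂ) * Complex.exp (c * s))) s := fun s => by
    have h1 : HasDerivAt (fun s : ℝ => (s : ℂ)) 1 s := Complex.ofRealCLM.hasDerivAt
    exact (h1.mul (h1.const_mul c).cexp).congr_deriv (by ring)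
  have hint := hi'.add (hi.const_mul c)
  have key := integral_Ioi_of_hasDerivAt_of_tendsto' (fun s _ => hd s) hint
    (tendsto_zero_of_hasDerivAt_of_integrableOn_Ioi (fun s _ => hd s) hint hi)
  rw [integral_add hi' (hi.const_mul c), integral_const_mul,
    integral_exp_mul_complex_Ioi hc 0] at key
  simp only [Complex.ofReal_zero, mul_zero, Complex.exp_zero, zero_mul, sub_zero] at key
  field_simp at key ⊢
  linear_combination key

/-- The field `e^{ζ·x} (b + (ζ'·x) ζ)`. -/
noncomputable def polyExpField (ζ ζ' b : CVec) (x : Plane) : CVec :=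
  Complex.exp (∑ j, ζ j * (x j : ℂ)) • (b + (∑ j, ζ' j * (x j : ℂ)) • ζ)

lemma contDiff_polyExpField {n : WithTop ℕ∞} (ζ ζ' b : CVec) :
    ContDiff ℝ n (polyExpField ζ ζ' b) :=
  (contDiff_exp_linearForm ζ).smul (contDiff_const.add ((contDiff_linearForm ζ').smul
    contDiff_const))

lemma polyExpField_apply (ζ ζ' b : CVec) (x : Plane) (i : Fin 2) :
    polyExpField ζ ζ' b x i = b i * Complex.exp (∑ j, ζ j * (x j : ℂ)) +
      ζ i * ((∑ j, ζ' j * (x j : ℂ)) * Complex.exp (∑ j, ζ j * (x j : ℂ))) := by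
  simp only [polyExpField, Pi.smul_apply, Pi.add_apply, smul_eq_mul]; ring

lemma contDiff_linearForm_mul_exp {n : WithTop ℕ∞} (ζ ζ' : CVec) :
    ContDiff ℝ n fun x : Plane =>
      (∑ j, ζ' j * ((x j : ℝ) : ℂ)) * Complex.exp (∑ j, ζ j * ((x j : ℝ) : ℂ)) :=
  (contDiff_linearForm ζ').mul (contDiff_exp_linearForm ζ)

lemma pderiv_linearForm_mul_exp (ζ ζ' : CVec) (j : Fin 2) (x : Plane) :
    pderiv j (fun x => (∑ j, ζ' j * ((x j : ℝ) : ℂ)) *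
      Complex.exp (∑ j, ζ j * ((x j : ℝ) : ℂ))) x =
      ζ' j * Complex.exp (∑ j, ζ j * ((x j : ℝ) : ℂ)) + ζ j * ((∑ j, ζ' j * ((x j : ℝ) : ℂ)) *
        Complex.exp (∑ j, ζ j * ((x j : ℝ) : ℂ))) := by
  rw [pderiv_mul j ((contDiff_linearForm (n := 1) ζ').differentiable one_ne_zero x)
    ((contDiff_exp_linearForm (n := 1) ζ).differentiable one_ne_zero x), pderiv_linearForm,
    pderiv_exp_linearForm]
  ring

lemma pderiv_combination_exp (ζ ζ' : CVec) (a c : ℂ) (j : Fin 2) (x : Plane) :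
    pderiv j (fun x => a * Complex.exp (∑ j, ζ j * ((x j : ℝ) : ℂ)) +
      c * ((∑ j, ζ' j * ((x j : ℝ) : ℂ)) * Complex.exp (∑ j, ζ j * ((x j : ℝ) : ℂ)))) x =
      (a * ζ j + c * ζ' j) * Complex.exp (∑ j, ζ j * ((x j : ℝ) : ℂ)) +
      c * ζ j * ((∑ j, ζ' j * ((x j : ℝ) : ℂ)) *
        Complex.exp (∑ j, ζ j * ((x j : ℝ) : ℂ))) := by
  have d1 := (contDiff_exp_linearForm (n := 1) ζ).differentiable one_ne_zero x
  have d2 := (contDiff_linearForm_mul_exp (n := 1) ζ ζ').differentiable one_ne_zero x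
  rw [pderiv_add j (d1.const_mul a) (d2.const_mul c), pderiv_const_mul j a d1,
    pderiv_const_mul j c d2, pderiv_exp_linearForm, pderiv_linearForm_mul_exp]
  ring

lemma fieldGrad_polyExpField (ζ ζ' b : CVec) (x : Plane) (i j : Fin 2) :
    fieldGrad (polyExpField ζ ζ' b) x i j =
      (b i * ζ j + ζ i * ζ' j) * Complex.exp (∑ j, ζ j * (x j : ℂ)) +
      ζ i * ζ j * ((∑ j, ζ' j * (x j : ℂ)) * Complex.exp (∑ j, ζ j * (x j : ℂ))) := by
  simp only [fieldGrad, Matrix.of_apply, polyExpField_apply]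
  exact pderiv_combination_exp ζ ζ' (b i) (ζ i) j x

lemma stress_fieldGrad_polyExpField (lam mu : ℝ) (ζ ζ' b : CVec) (x : Plane) (i j : Fin 2) :
    stress lam mu (fieldGrad (polyExpField ζ ζ' b) x) i j =
      stress lam mu (Matrix.vecMulVec b ζ + Matrix.vecMulVec ζ ζ') i j *
        Complex.exp (∑ j, ζ j * (x j : ℂ)) +
      stress lam mu (Matrix.vecMulVec ζ ζ) i j *
        ((∑ j, ζ' j * (x j : ℂ)) * Complex.exp (∑ j, ζ j * (x j : ℂ))) := by
  simp only [stress_apply, fieldGrad_polyExpField, Matrix.add_apply, Matrix.vecMulVec_apply]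
  ring

/-- For isotropic `ζ` the exponential is harmonic, so the Laplacian of the field is `2 (ζ·ζ')
e^{ζ·x} ζ` and its divergence is `(ζ·b + ζ·ζ') e^{ζ·x}`. The whole equation is thus a multiple of
`ζ`, and one scalar condition suffices. The linear factor is there to allow `b` that is not
orthogonal to `ζ`. -/
lemma div_stress_polyExpField {lam mu : ℝ} {ζ ζ' b : CVec} (h1 : ζ ⬝ᵥ ζ = 0)
    (h2 : (lam + mu) * (ζ ⬝ᵥ b + ζ ⬝ᵥ ζ') + 2 * mu * (ζ ⬝ᵥ ζ') = 0) (i : Fin 2) (x : Plane) :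
    ∑ j, pderiv j (fun y => stress lam mu (fieldGrad (polyExpField ζ ζ' b) y) i j) x = 0 := by
  have e : ∀ j, (fun y => stress lam mu (fieldGrad (polyExpField ζ ζ' b) y) i j) = _ :=
    fun j => funext fun y => stress_fieldGrad_polyExpField lam mu ζ ζ' b y i j
  have e' : ∀ j, pderiv j (fun y => stress lam mu (fieldGrad (polyExpField ζ ζ' b) y) i j) x = _ :=
    fun j => (congrArg (fun F => pderiv j F x) (e j)).trans (pderiv_combination_exp ζ ζ' _ _ j x)
  rw [Finset.sum_congr rfl fun j _ => e' j]
  simp only [dotProduct, Fin.sum_univ_two] at h1 h2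
  simp only [stress_apply, Matrix.add_apply, Matrix.vecMulVec_apply, Fin.sum_univ_two]
  set E := Complex.exp (ζ 0 * ((x 0 : ℝ) : ℂ) + ζ 1 * ((x 1 : ℝ) : ℂ))
  set L := ζ' 0 * ((x 0 : ℝ) : ℂ) + ζ' 1 * ((x 1 : ℝ) : ℂ)
  fin_cases i
  · simp
    linear_combination E * ζ 0 * h2 +
      (E * (mu * (b 0 + ζ' 0) + lam * ζ' 0) + L * E * (lam + 2 * mu) * ζ 0) * h1
  · simp
    linear_combination E * ζ 1 * h2 +
      (E * (mu * (b 1 + ζ' 1) + lam * ζ' 1) + L * E * (lam + 2 * mu) * ζ 1) * h1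

lemma linearForm_smul_unitDir (ζ : CVec) (s θ : ℝ) :
    ∑ j, ζ j * (((s • unitDir θ) j : ℝ) : ℂ) = (∑ j, ζ j * ((unitDir θ j : ℝ) : ℂ)) * s := by
  rw [Finset.sum_mul]
  refine Finset.sum_congr rfl fun j _ => ?_
  rw [PiLp.smul_apply, smul_eq_mul]; push_cast; ring

/-- Exponential decay of `e^{ζ·x}` in the closed sector. -/
def DecayDirection (θmin θmax : ℝ) (ζ : CVec) : Prop :=
  ∃ δ, 0 < δ ∧ ∀ θ ∈ Icc θmin θmax, (∑ j, ζ j * ((unitDir θ j : ℝ) : ℂ)).re ≤ -δ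

lemma norm_exp_linearForm_le {ζ : CVec} {δ : ℝ}
    (hζ : ∀ θ ∈ Icc θmin θmax, (∑ j, ζ j * ((unitDir θ j : ℝ) : ℂ)).re ≤ -δ) {s θ : ℝ} (hs : 0 ≤ s) (hθ : θ ∈ Icc θmin θmax) :
    ‖Complex.exp (∑ j, ζ j * (((s • unitDir θ) j : ℝ) : ℂ))‖ ≤ Real.exp (-(δ * s)) := by
  rw [linearForm_smul_unitDir, Complex.norm_exp, Real.exp_le_exp, Complex.re_mul_ofReal]
  nlinarith [hζ θ hθ]

lemma sectorDecay_exp {ζ : CVec} (hζ : DecayDirection θmin θmax ζ) :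
    SectorDecay θmin θmax fun x => Complex.exp (∑ j, ζ j * ((x j : ℝ) : ℂ)) := by
  obtain ⟨δ, hδ, hζ⟩ := hζ
  obtain ⟨C, hC0, hC⟩ := exists_bound_pow_mul_exp 4 hδ
  exact ⟨C, hC0, fun s hs θ hθ => (norm_exp_linearForm_le hζ hs hθ).trans (hC s hs)⟩

lemma sectorDecay_linearForm_mul_exp {ζ : CVec} (hζ : DecayDirection θmin θmax ζ) (ζ' : CVec) :
    SectorDecay θmin θmax fun x =>
      (∑ j, ζ' j * ((x j : ℝ) : ℂ)) * Complex.exp (∑ j, ζ j * ((x j : ℝ) : ℂ)) := by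
  obtain ⟨δ, hδ, hζ⟩ := hζ
  obtain ⟨C, hC0, hC⟩ := exists_bound_pow_mul_exp 5 hδ
  refine ⟨(∑ j, ‖ζ' j‖) * C, by positivity, fun s hs θ hθ => ?_⟩
  have h1 : ‖∑ j, ζ' j * (((s • unitDir θ) j : ℝ) : ℂ)‖ ≤ (∑ j, ‖ζ' j‖) * (1 + s) := by
    rw [Finset.sum_mul]
    refine (norm_sum_le _ _).trans (Finset.sum_le_sum fun j _ => ?_)
    rw [norm_mul]
    gcongr
    refine (norm_coord_le _ j).trans ?_
    rw [norm_smul_unitDir hs]; linarith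
  rw [norm_mul]
  calc _ ≤ (∑ j, ‖ζ' j‖) * (1 + s) * (C / (1 + s) ^ 5) := by
        gcongr
        exact (norm_exp_linearForm_le hζ hs hθ).trans (hC s hs)
    _ = (∑ j, ‖ζ' j‖) * C / (1 + s) ^ 4 := by field_simp

lemma sectorDecay_polyExpField {ζ : CVec} (hζ : DecayDirection θmin θmax ζ) (ζ' b : CVec) (i : Fin 2) :
    SectorDecay θmin θmax fun x => polyExpField ζ ζ' b x i := by
  simp_rw [polyExpField_apply]
  exact ((sectorDecay_exp hζ).const_mul _).add
    ((sectorDecay_linearForm_mul_exp hζ ζ').const_mul _)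

lemma sectorDecay_fieldGrad_polyExpField {ζ : CVec} (hζ : DecayDirection θmin θmax ζ) (ζ' b : CVec) (i j : Fin 2) :
    SectorDecay θmin θmax fun x => fieldGrad (polyExpField ζ ζ' b) x i j := by
  simp_rw [fieldGrad_polyExpField]
  exact ((sectorDecay_exp hζ).const_mul _).add
    ((sectorDecay_linearForm_mul_exp hζ ζ').const_mul _)

lemma integral_polyExpField {ζ : CVec} (hζ : DecayDirection θmin θmax ζ) (ζ' b : CVec) (i : Fin 2) {θ : ℝ} (hθ : θ ∈ Icc θmin θmax) {c c' : ℂ}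
    (hc : ∑ j, ζ j * ((unitDir θ j : ℝ) : ℂ) = c) (hc' : ∑ j, ζ' j * ((unitDir θ j : ℝ) : ℂ) = c') :
    ∫ s in Ioi (0 : ℝ), polyExpField ζ ζ' b (s • unitDir θ) i =
      -(b i * c⁻¹) + ζ i * (c' * (c ^ 2)⁻¹) := by
  have hre : c.re < 0 := by
    obtain ⟨δ, hδ, h1⟩ := hζ
    rw [← hc]; linarith [h1 θ hθ]
  have i1 := ((sectorDecay_exp hζ).integrableOn (contDiff_exp_linearForm (n := 0) ζ).continuous
    hθ).1.const_mul (b i)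
  have i2 := ((sectorDecay_linearForm_mul_exp hζ ζ').integrableOn
    (contDiff_linearForm_mul_exp (n := 0) ζ ζ').continuous hθ).1.const_mul (ζ i)
  have i3 := ((sectorDecay_exp hζ).integrableOn (contDiff_exp_linearForm (n := 0) ζ).continuous
    hθ).2
  simp_rw [linearForm_smul_unitDir, hc] at i3
  simp_rw [polyExpField_apply]
  rw [integral_add i1 i2, integral_const_mul, integral_const_mul]
  simp_rw [linearForm_smul_unitDir, hc, hc', mul_assoc]
  rw [integral_const_mul, integral_mul_exp_Ioi hre i3, integral_exp_mul_complex_Ioi hre 0]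
  simp only [Complex.ofReal_zero, mul_zero, Complex.exp_zero]
  ring


/-! ### The tractions at the corner -/

/-- The isotropic vectors `-e^{-iεθ} (1, iε)`, `ε = ±1`. -/
noncomputable def isotropicVec (ε θ : ℝ) : CVec :=
  ![-Complex.exp (-(ε * θ : ℝ) * Complex.I),
    -(Complex.exp (-(ε * θ : ℝ) * Complex.I) * (ε * Complex.I))]

lemma isotropicVec_dotProduct_self {ε : ℝ} (hε : ε ^ 2 = 1) (θ : ℝ) :
    isotropicVec ε θ ⬝ᵥ isotropicVec ε θ = 0 := by
  have h1 : (ε : ℂ) ^ 2 = 1 := by exact_mod_cast hε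
  simp only [isotropicVec, dotProduct, Fin.sum_univ_two, Matrix.cons_val_zero, Matrix.cons_val_one]
  linear_combination Complex.exp (-(ε * θ : ℝ) * Complex.I) ^ 2 *
    (h1 * Complex.I ^ 2 + Complex.I_sq)

lemma isotropicVec_dotProduct_neg {ε : ℝ} (hε : ε ^ 2 = 1) (θ : ℝ) :
    isotropicVec ε θ ⬝ᵥ isotropicVec (-ε) θ = 2 := by
  have h1 : (ε : ℂ) ^ 2 = 1 := by exact_mod_cast hε
  have h2 : Complex.exp (-(ε * θ : ℝ) * Complex.I) *
      Complex.exp (-((-ε) * θ : ℝ) * Complex.I) = 1 := by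
    rw [← Complex.exp_add, ← Complex.exp_zero]; congr 1; push_cast; ring
  simp only [isotropicVec, dotProduct, Fin.sum_univ_two, Matrix.cons_val_zero, Matrix.cons_val_one]
  push_cast at h2 ⊢
  linear_combination (1 - ε ^ 2 * Complex.I ^ 2) * h2 - Complex.I ^ 2 * h1 - Complex.I_sq

/-- In complex notation the linear form of the vector is `-e^{-iθ} z` for `ε = 1` and its conjugate
for `ε = -1`; here it is evaluated at `z = e^{iφ}`. -/
lemma isotropicVec_unitDir {ε : ℝ} (hε : ε ^ 2 = 1) (θ φ : ℝ) :
    ∑ j, isotropicVec ε θ j * ((unitDir φ j : ℝ) : ℂ) =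
      -Complex.exp ((ε * (φ - θ) : ℝ) * Complex.I) := by
  have h1 : Complex.exp ((ε * φ : ℝ) * Complex.I) =
      Complex.cos φ + Complex.sin φ * (ε * Complex.I) := by
    rcases sq_eq_sq_iff_eq_or_eq_neg.1 (hε.trans (one_pow 2).symm) with rfl | rfl
    · rw [Complex.exp_mul_I]; push_cast; ring_nf
    · rw [Complex.exp_mul_I]; push_cast; simp
  have h2 : Complex.exp ((ε * (φ - θ) : ℝ) * Complex.I) =
      Complex.exp (-(ε * θ : ℝ) * Complex.I) * Complex.exp ((ε * φ : ℝ) * Complex.I) := by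
    rw [← Complex.exp_add]; congr 1; push_cast; ring
  rw [h2, h1]
  simp only [isotropicVec, Fin.sum_univ_two, Matrix.cons_val_zero, Matrix.cons_val_one,
    unitDir_zero, unitDir_one]
  push_cast
  ring

lemma isotropicVec_unitDir_edge {ε : ℝ} (hε : ε ^ 2 = 1) :
    ∑ j, isotropicVec ε ((θmin + θmax) / 2) j * ((unitDir θmax j : ℝ) : ℂ) =
      -Complex.exp ((ε * ((θmax - θmin) / 2) : ℝ) * Complex.I) ∧
    ∑ j, isotropicVec ε ((θmin + θmax) / 2) j * ((unitDir θmin j : ℝ) : ℂ) =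
      -Complex.exp ((-ε * ((θmax - θmin) / 2) : ℝ) * Complex.I) := by
  rw [isotropicVec_unitDir hε, isotropicVec_unitDir hε]
  constructor <;> congr 4 <;> ring

/-- Based on the bisector, the real part at argument `φ` is minus the cosine of the angle from the
bisector. That angle is at most the half-opening, which is below `π/2`: this is where convexity of
the sector enters. -/
lemma decayDirection_isotropicVec (H : IsConvexSector θmin θmax h) {ε : ℝ} (hε : ε ^ 2 = 1) :
    DecayDirection θmin θmax (isotropicVec ε ((θmin + θmax) / 2)) := by
  have hlt := H.hlt
  have hangle := H.hangle
  refine ⟨Real.cos ((θmax - θmin) / 2), Real.cos_pos_of_mem_Ioo ⟨by linarith, by linarith⟩,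
    fun θ hθ => ?_⟩
  rw [isotropicVec_unitDir hε, Complex.neg_re, Complex.exp_ofReal_mul_I_re, neg_le_neg_iff,
    ← Real.cos_abs (ε * _), abs_mul, ((pow_eq_one_iff_of_nonneg (abs_nonneg ε) two_ne_zero).1
      ((sq_abs ε).trans hε)), one_mul]
  refine Real.cos_le_cos_of_nonneg_of_le_pi (abs_nonneg _) (by linarith) ?_
  rw [abs_le]
  constructor <;> linarith [hθ.1, hθ.2]

/-- The linear relations between the tractions at the corner. -/
lemma HasCauchyData.corner_relations (H : IsConvexSector θmin θmax h)
    {u f₁ f₂ g₁ g₂ t : Plane → CVec} {α₁ α₂ β₁ β₂ : ℝ≥0}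
    (D : HasCauchyData lam mu om θmin θmax h u f₁ f₂ g₁ g₂ t)
    (hf₁ : IsC1Holder θmax h α₁ f₁) (hf₂ : IsC1Holder θmin h α₂ f₂)
    (hg₁ : IsHolder θmax h β₁ g₁) (hg₂ : IsHolder θmin h β₂ g₂) (hβ₁ : 0 < β₁) (hβ₂ : 0 < β₂)
    (h0 : f₁ 0 = f₂ 0) (hd₁ : edgeDerivAtCorner θmax h f₁ = 0)
    (hd₂ : edgeDerivAtCorner θmin h f₂ = 0) {ζ ζ' b : CVec} (hζ : DecayDirection θmin θmax ζ)
    (h1 : ζ ⬝ᵥ ζ = 0) (h2 : (lam + mu) * (ζ ⬝ᵥ b + ζ ⬝ᵥ ζ') + 2 * mu * (ζ ⬝ᵥ ζ') = 0)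
    {c₁ c₂ c₁' c₂' : ℂ}
    (hc₁ : ∑ j, ζ j * ((unitDir θmax j : ℝ) : ℂ) = c₁)
    (hc₂ : ∑ j, ζ j * ((unitDir θmin j : ℝ) : ℂ) = c₂)
    (hc₁' : ∑ j, ζ' j * ((unitDir θmax j : ℝ) : ℂ) = c₁')
    (hc₂' : ∑ j, ζ' j * ((unitDir θmin j : ℝ) : ℂ) = c₂') :
    -(g₁ 0 ⬝ᵥ b) * c₁⁻¹ + g₁ 0 ⬝ᵥ ζ * (c₁' * (c₁ ^ 2)⁻¹)
      + (-(g₂ 0 ⬝ᵥ b) * c₂⁻¹ + g₂ 0 ⬝ᵥ ζ * (c₂' * (c₂ ^ 2)⁻¹)) = 0 := by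
  have key := D.corner_orthogonality H hf₁ hf₂ hg₁ hg₂ hβ₁ hβ₂ h0 hd₁ hd₂
    (contDiff_polyExpField ζ ζ' b) (div_stress_polyExpField h1 h2)
    (sectorDecay_polyExpField hζ ζ' b) (sectorDecay_fieldGrad_polyExpField hζ ζ' b)
  simp_rw [fun i => integral_polyExpField hζ ζ' b i ⟨H.hlt.le, le_rfl⟩ hc₁ hc₁',
    fun i => integral_polyExpField hζ ζ' b i ⟨le_rfl, H.hlt.le⟩ hc₂ hc₂'] at key
  simp only [dotProduct, Fin.sum_univ_two] at key ⊢
  linear_combination key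

/-- The first two relations express `P₁` by `P₂` and `Q₂` by `Q₁`. The other two then become `(z⁴ -
1)(P₂ - κ Q₁) = 0` and `(z⁴ - 1)(Q₁ - κ P₂) = 0`, whence `(κ² - 1) Q₁ = 0`. -/
lemma eq_zero_of_corner_relations {z y κ P₁ P₂ Q₁ Q₂ : ℂ} (hzy : z * y = 1) (hz : z ^ 4 ≠ 1)
    (hκ : κ ^ 2 ≠ 1) (e1 : P₁ * y + P₂ * z = 0) (e2 : Q₁ * z + Q₂ * y = 0)
    (e3 : κ * (Q₁ * y) + P₁ * y ^ 3 + (κ * (Q₂ * z) + P₂ * z ^ 3) = 0)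
    (e4 : κ * (P₁ * z) + Q₁ * z ^ 3 + (κ * (P₂ * y) + Q₂ * y ^ 3) = 0) :
    P₁ = 0 ∧ P₂ = 0 ∧ Q₁ = 0 ∧ Q₂ = 0 := by
  have hz4 : z ^ 4 - 1 ≠ 0 := sub_ne_zero.2 hz
  have a1 : P₁ = -(P₂ * z ^ 2) := by linear_combination z * e1 - P₁ * hzy
  have a2 : Q₂ = -(Q₁ * z ^ 2) := by linear_combination z * e2 - Q₂ * hzy
  subst a1 a2
  have a3 : P₂ = κ * Q₁ := by
    have : (z ^ 4 - 1) * (P₂ - κ * Q₁) = 0 := by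
      linear_combination z * e3 + (P₂ * (z ^ 2 * y ^ 2 + z * y + 1) - κ * Q₁) * hzy
    exact sub_eq_zero.1 ((mul_eq_zero.1 this).resolve_left hz4)
  have a4 : Q₁ = κ * P₂ := by
    have : (z ^ 4 - 1) * (Q₁ - κ * P₂) = 0 := by
      linear_combination z * e4 + (Q₁ * (z ^ 2 * y ^ 2 + z * y + 1) - κ * P₂) * hzy
    exact sub_eq_zero.1 ((mul_eq_zero.1 this).resolve_left hz4)
  have a5 : Q₁ = 0 := by
    have : (κ ^ 2 - 1) * Q₁ = 0 := by rw [a3] at a4; linear_combination -a4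
    exact (mul_eq_zero.1 this).resolve_left (sub_ne_zero.2 hκ)
  subst a5
  simp [a3]

/-- The two isotropic directions `(1, i)` and `(1, -i)` form a basis of `ℂ²`. -/
lemma eq_zero_of_isotropicVec {θ : ℝ} {g : CVec} (h1 : g ⬝ᵥ isotropicVec 1 θ = 0)
    (h2 : g ⬝ᵥ isotropicVec (-1) θ = 0) : g = 0 := by
  simp only [isotropicVec, dotProduct, Fin.sum_univ_two, Matrix.cons_val_zero,
    Matrix.cons_val_one] at h1 h2
  set A := Complex.exp (-((1 : ℝ) * θ : ℝ) * Complex.I) with hA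
  set B := Complex.exp (-((-1 : ℝ) * θ : ℝ) * Complex.I) with hB
  have hA0 : A ≠ 0 := Complex.exp_ne_zero _
  have hB0 : B ≠ 0 := Complex.exp_ne_zero _
  push_cast at h1 h2
  have k1 : g 0 + g 1 * Complex.I = 0 :=
    (mul_eq_zero.1 (show A * (g 0 + g 1 * Complex.I) = 0 by linear_combination -h1)).resolve_left
      hA0
  have k2 : g 0 - g 1 * Complex.I = 0 :=
    (mul_eq_zero.1 (show B * (g 0 - g 1 * Complex.I) = 0 by linear_combination -h2)).resolve_left
      hB0
  funext i
  fin_cases i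
  · show g 0 = 0
    linear_combination (k1 + k2) / 2
  · show g 1 = 0
    linear_combination (-Complex.I / 2) * (k1 - k2) + g 1 * Complex.I_sq

/-- If the displacements agree at the corner and their derivatives vanish there, then the
tractions vanish at the corner. -/
theorem HasCauchyData.traction_eq_zero (H : IsConvexSector θmin θmax h)
    {u f₁ f₂ g₁ g₂ t : Plane → CVec} {α₁ α₂ β₁ β₂ : ℝ≥0}
    (D : HasCauchyData lam mu om θmin θmax h u f₁ f₂ g₁ g₂ t)
    (hmu : 0 < mu) (hlam : 0 < 2 * mu + 2 * lam)
    (hf₁ : IsC1Holder θmax h α₁ f₁) (hf₂ : IsC1Holder θmin h α₂ f₂)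
    (hg₁ : IsHolder θmax h β₁ g₁) (hg₂ : IsHolder θmin h β₂ g₂) (hβ₁ : 0 < β₁) (hβ₂ : 0 < β₂)
    (h0 : f₁ 0 = f₂ 0) (hd₁ : edgeDerivAtCorner θmax h f₁ = 0)
    (hd₂ : edgeDerivAtCorner θmin h f₂ = 0) : g₁ 0 = 0 ∧ g₂ 0 = 0 := by
  have hlm : 0 < lam + mu := by linarith
  -- The value for which `b = -κ ζ'` satisfies the scalar condition of `div_stress_polyExpField`. It
  -- exceeds `1` because `μ` and `λ + μ` are positive, which gives `κ² ≠ 1`.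
  set κ : ℝ := 1 + 2 * mu / (lam + mu) with hκdef
  have hκ1 : 1 < κ := by have : 0 < 2 * mu / (lam + mu) := by positivity
                         linarith
  have hκe : ((lam : ℂ) + mu) * (1 - κ) + 2 * mu = 0 := by
    have : (lam + mu) * (1 - κ) + 2 * mu = 0 := by rw [hκdef]; field_simp; ring
    exact_mod_cast this
  set γ : ℝ := (θmax - θmin) / 2 with hγ
  set z : ℂ := Complex.exp ((γ : ℝ) * Complex.I) with hzdef
  set y : ℂ := Complex.exp ((-γ : ℝ) * Complex.I) with hydef
  have hzy : z * y = 1 := by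
    rw [hzdef, hydef, ← Complex.exp_add, ← Complex.exp_zero]; congr 1; push_cast; ring
  have hz0 : z ≠ 0 := Complex.exp_ne_zero _
  have hzi : z⁻¹ = y := inv_eq_of_mul_eq_one_right hzy
  have hyi : y⁻¹ = z := by rw [← hzi, inv_inv]
  -- `z` is the exponential of `i` times the half-opening, so `z⁴ = 1` would make the opening an
  -- integer multiple of `π`; it lies strictly between `0` and `π`.
  have hz4 : z ^ 4 ≠ 1 := by
    rw [hzdef, ← Complex.exp_nat_mul]
    intro he
    obtain ⟨n, hn⟩ := Complex.exp_eq_one_iff.1 he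
    have h3 : (θmax - θmin : ℂ) * (2 * Complex.I) = (n * Real.pi : ℂ) * (2 * Complex.I) := by
      rw [hγ] at hn; push_cast at hn; linear_combination hn
    have h4 := mul_right_cancel₀ (by simp) h3
    have h5 : θmax - θmin = n * Real.pi := by exact_mod_cast h4
    have hlt := H.hlt
    have hangle := H.hangle
    have h6 : (0 : ℝ) < n := by
      by_contra hle
      nlinarith [Real.pi_pos]
    have h7 : (1 : ℝ) ≤ n := by exact_mod_cast (show (0 : ℤ) < n by exact_mod_cast h6)
    nlinarith [Real.pi_pos]
  set ζ := isotropicVec 1 ((θmin + θmax) / 2) with hζ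
  set ρ := isotropicVec (-1) ((θmin + θmax) / 2) with hρ
  have s1 : (1 : ℝ) ^ 2 = 1 := by norm_num
  have s2 : (-1 : ℝ) ^ 2 = 1 := by norm_num
  have dζ := decayDirection_isotropicVec H s1
  have dρ := decayDirection_isotropicVec H s2
  have eζ := isotropicVec_unitDir_edge (θmin := θmin) (θmax := θmax) s1
  have eρ := isotropicVec_unitDir_edge (θmin := θmin) (θmax := θmax) s2
  rw [one_mul, neg_one_mul, ← hzdef, ← hydef] at eζ
  rw [neg_neg, one_mul, neg_one_mul, ← hzdef, ← hydef] at eρ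
  have ζζ := isotropicVec_dotProduct_self s1 ((θmin + θmax) / 2)
  have ρρ := isotropicVec_dotProduct_self s2 ((θmin + θmax) / 2)
  have ζρ := isotropicVec_dotProduct_neg s1 ((θmin + θmax) / 2)
  rw [← hζ] at dζ eζ ζζ ζρ
  rw [← hρ] at dρ eρ ρρ ζρ
  have ρζ : ρ ⬝ᵥ ζ = 2 := by rw [dotProduct_comm]; exact ζρ
  have z0 : ∀ x : Plane, ∑ j, (0 : CVec) j * ((x j : ℝ) : ℂ) = 0 := fun x => by simp
  have R := fun {ζ ζ' b : CVec} => D.corner_relations (ζ := ζ) (ζ' := ζ') (b := b) H hf₁ hf₂ hg₁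
    hg₂ hβ₁ hβ₂ h0 hd₁ hd₂
  -- The pure exponentials `e^{ζ·x} ζ`, gradients of harmonic functions, one for each isotropic
  -- direction.
  have e1 := R dζ ζζ (b := ζ) (ζ' := 0) (by simp [ζζ]) eζ.1 eζ.2 (z0 _) (z0 _)
  have e2 := R dρ ρρ (b := ρ) (ζ' := 0) (by simp [ρρ]) eρ.1 eρ.2 (z0 _) (z0 _)
  -- The fields with a linear factor bring in the opposite isotropic direction and so couple the
  -- components of the tractions along `ζ` and `ρ`.
  have e3 := R dζ ζζ (b := -(κ : ℂ) • ρ) (ζ' := ρ)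
    (by rw [dotProduct_smul, ζρ, smul_eq_mul]; linear_combination 2 * hκe) eζ.1 eζ.2 eρ.1 eρ.2
  have e4 := R dρ ρρ (b := -(κ : ℂ) • ζ) (ζ' := ζ)
    (by rw [dotProduct_smul, ρζ, smul_eq_mul]; linear_combination 2 * hκe) eρ.1 eρ.2 eζ.1 eζ.2
  simp only [dotProduct_smul, smul_eq_mul, inv_neg, hzi, hyi, neg_sq, ← inv_pow] at e1 e2 e3 e4
  have hκ2 : (κ : ℂ) ^ 2 ≠ 1 := by
    intro he
    have : κ ^ 2 = 1 := by exact_mod_cast he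
    nlinarith
  obtain ⟨k1, k2, k3, k4⟩ := eq_zero_of_corner_relations (P₁ := g₁ 0 ⬝ᵥ ζ) (P₂ := g₂ 0 ⬝ᵥ ζ)
    (Q₁ := g₁ 0 ⬝ᵥ ρ) (Q₂ := g₂ 0 ⬝ᵥ ρ) hzy hz4 hκ2 (by linear_combination e1)
    (by linear_combination e2) (by linear_combination -e3) (by linear_combination -e4)
  exact ⟨eq_zero_of_isotropicVec k1 k3, eq_zero_of_isotropicVec k2 k4⟩

end LameCorner

/-! ### Assembly of the three claims -/

theorem mainTheorem4
    (lam mu om : ℝ) (hmu : 0 < mu) (hlam : 0 < 2 * mu + 2 * lam) (hom : 0 < om)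
    (θmin θmax h : ℝ) (hmin : -Real.pi < θmin) (hlt : θmin < θmax) (hmax : θmax < Real.pi)
    (hangle : θmax - θmin < Real.pi) (hh : 0 < h)
    (α₁ α₂ β₁ β₂ : ℝ≥0) (hα₁ : 0 < α₁ ∧ α₁ < 1) (hα₂ : 0 < α₂ ∧ α₂ < 1)
    (hβ₁ : 0 < β₁ ∧ β₁ < 1) (hβ₂ : 0 < β₂ ∧ β₂ < 1)
    (v w f₁ f₂ g₁ g₂ : Plane → CVec)
    (hv : IsLameSolution lam mu om (sectorDisk θmin θmax h) v)
    (hw : IsLameSolution lam mu om (sectorDisk θmin θmax h) w)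
    (hf₁ : IsC1Holder θmax h α₁ f₁) (hf₂ : IsC1Holder θmin h α₂ f₂)
    (hg₁ : IsHolder θmax h β₁ g₁) (hg₂ : IsHolder θmin h β₂ g₂)
    (hwv₁ : IsTrace (sectorDisk θmin θmax h) (edgeMeasure θmax h) (fun x => w x - v x) f₁)
    (hwv₂ : IsTrace (sectorDisk θmin θmax h) (edgeMeasure θmin h) (fun x => w x - v x) f₂)
    (hT₁ : TractionJumpOn lam mu om (sectorDisk θmin θmax h) (edge θmax h)
      (edgeMeasure θmax h) v w g₁)
    (hT₂ : TractionJumpOn lam mu om (sectorDisk θmin θmax h) (edge θmin h)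
      (edgeMeasure θmin h) v w g₂) :
    (∃ (t : Plane → CVec) (ℓ : (Plane → CVec) → ℂ),
      IsTrace (sectorDisk θmin θmax h) (arcMeasure θmin θmax h) (fun x => v x - w x) t ∧
      IsTractionPairing lam mu om (sectorDisk θmin θmax h) (arc θmin θmax h)
        (fun x => v x - w x) ℓ ∧
      ∀ (τ : ℝ) (d dperp : Plane), 0 < τ → ‖d‖ = 1 → ‖dperp‖ = 1 → inner ℝ d dperp = 0 →
        g₁ 0 ⬝ᵥ (∫ x, cgo mu om τ d dperp x ∂(edgeMeasure θmax h))
          + g₂ 0 ⬝ᵥ (∫ x, cgo mu om τ d dperp x ∂(edgeMeasure θmin h))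
          - f₁ 0 ⬝ᵥ (∫ x, traction lam mu (normalMax θmax) (cgo mu om τ d dperp) x
              ∂(edgeMeasure θmax h))
          - f₂ 0 ⬝ᵥ (∫ x, traction lam mu (normalMin θmin) (cgo mu om τ d dperp) x
              ∂(edgeMeasure θmin h))
        = (∫ x, traction lam mu (normalMax θmax) (cgo mu om τ d dperp) x ⬝ᵥ (f₁ x - f₁ 0)
              ∂(edgeMeasure θmax h))
          - (∫ x, (g₁ x - g₁ 0) ⬝ᵥ cgo mu om τ d dperp x ∂(edgeMeasure θmax h))
          + (∫ x, traction lam mu (normalMin θmin) (cgo mu om τ d dperp) x ⬝ᵥ (f₂ x - f₂ 0)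
              ∂(edgeMeasure θmin h))
          - (∫ x, (g₂ x - g₂ 0) ⬝ᵥ cgo mu om τ d dperp x ∂(edgeMeasure θmin h))
          + (ℓ (cgo mu om τ d dperp)
            - ∫ x, traction lam mu (h⁻¹ • x) (cgo mu om τ d dperp) x ⬝ᵥ t x
              ∂(arcMeasure θmin θmax h))) ∧
    f₁ 0 = f₂ 0 ∧
    (edgeDerivAtCorner θmax h f₁ = 0 → edgeDerivAtCorner θmin h f₂ = 0 →
      g₁ 0 = thetaMatrix (θmax - θmin) *ᵥ g₂ 0) := by
  have H : IsConvexSector θmin θmax h := ⟨hmin, hlt, hmax, hangle, hh⟩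
  have hU := isOpen_sectorDisk H
  have hB := isBallMeasure_sectorDisk H
  have le1 : (1 : WithTop ℕ∞) ≤ ∞ := by norm_num
  have hu : MemH1 (sectorDisk θmin θmax h) fun x => w x - v x := hw.1.sub hB hv.1
  obtain ⟨M₁, hM₁⟩ := hg₁.exists_bound
  obtain ⟨M₂, hM₂⟩ := hg₂.exists_bound
  obtain ⟨K₁, hK₁⟩ := hf₁.exists_bound
  obtain ⟨K₂, hK₂⟩ := hf₂.exists_bound
  have mg₁ := memLp_edge (hg₁.continuousOn hβ₁.1) hM₁
  have mg₂ := memLp_edge (hg₂.continuousOn hβ₂.1) hM₂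
  obtain ⟨t, ht, mf₁, mf₂, mt, hG⟩ := exists_trace_greenFormula H hu
    (fun i => aestronglyMeasurable_edge hf₁.continuousOn i)
    (fun i => aestronglyMeasurable_edge hf₂.continuousOn i) hwv₁ hwv₂
  have hE : ∀ φ : Plane → CVec, ContDiff ℝ ∞ φ → (∀ x ∈ arc θmin θmax h, φ x = 0) →
      EdgePairing lam mu om θmin θmax h (fun x => w x - v x) g₁ g₂ φ := fun φ hφ h0 =>
    -- The traction jump is stated as a difference of two forms; linearity in the solution turns it
    -- into the form of `w - v`.
    edgePairing_of_eq_zero_on_arc H hu mg₁ mg₂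
      (fun φ hφ => (lameForm_sub hU hB hv.1 hw.1 (hφ.1.of_le le1)).trans (hT₁ φ hφ))
      (fun φ hφ => (lameForm_sub hU hB hv.1 hw.1 (hφ.1.of_le le1)).trans (hT₂ φ hφ)) hφ h0
  have D : HasCauchyData lam mu om θmin θmax h (fun x => w x - v x) f₁ f₂ g₁ g₂ t :=
    ⟨hu, mf₁, mf₂, mt, hG, hE⟩
  have h0 : f₁ 0 = f₂ 0 := funext fun i => (hG i).corner_eq H (fun j => hu.memLp_weakGrad i j)
    (continuousOn_pi.1 hf₁.continuousOn i) (continuousOn_pi.1 hf₂.continuousOn i)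
    (fun r hr => (norm_le_pi_norm _ i).trans (hK₁ r hr))
    (fun r hr => (norm_le_pi_norm _ i).trans (hK₂ r hr))
  refine ⟨⟨fun x => -t x, _, ht.neg_sub hU hB hv.1 hw.1,
    isTractionPairing_arc H hv.1 hw.1 mg₁ mg₂ hE, fun τ d dperp hτ hd hdp ho => ?_⟩, h0,
    fun hd₁ hd₂ => ?_⟩
  · obtain ⟨a1, a2⟩ := cgo_algebra (om := om) hmu hτ hd hdp ho
    rw [cgo_eq_expField]
    exact corner_identity H hv.1 hw.1 mf₁ mf₂ mg₁ mg₂ (contDiff_expField _ _)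
      (lameForm_eq_boundary H hu mf₁ mf₂ mt hG (contDiff_expField _ _)
        (fun i j => contDiff_stress_expField lam mu _ _ i j) fun i x => by
          rw [div_stress_expField lam mu a1 rfl i x, a2])
  -- Both corner tractions vanish, so the relation through `Θ` reads `0 = 0`.
  · obtain ⟨e₁, e₂⟩ := D.traction_eq_zero H hmu hlam hf₁ hf₂ hg₁ hg₂ hβ₁.1 hβ₂.1 h0 hd₁ hd₂
    rw [e₁, e₂, Matrix.mulVec_zero]
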